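/- Let $n\ge 0$ be an integer, $t\in(0,1)$, $\alpha\in\mathbb C$, $\gamma=t^{\alpha}$, and let $s_0,s_1,s_2,\dots$ be complex numbers with $s_0\ne 0$. Put $u_j=t^{2n-j}/(\gamma s_0)$ for $1\le j\le 2n$, and assume that $(\gamma s_0)^2\ne t^m$ for $1\le m\le 4n-2$ (so that the denominators below do not vanish). Let $Z_2(a,b)=(1-t)(1-\gamma s_0a)(1-\gamma s_0b)+(1-\gamma)(t-\gamma s_0^2)(1-ab)$ and $$A_{ij}=\frac{(t^{j}-t^{i})\bigl(\gamma^2s_0^2(1-t)(t^i-t^{2n})(t^j-t^{2n})+(1-\gamma)(t-s_0^2\gamma)(t^{i+j}\gamma^2s_0^2-t^{4n})\bigr)}{t^{2i+2j-2n}\,\gamma s_0\,\bigl(\gamma s_0-t^{4n-i-j}/(\gamma s_0)\bigr)\bigl(\gamma s_0-t^{4n+1-i-j}/(\gamma s_0)\bigr)} .$$ Then $$\mathop{\rm Pf}_{1\le i<j\le 2n}\left[\frac{Z_2(u_i,u_j)(u_i-u_j)}{(1-u_iu_j)(1-tu_iu_j)}\right]=\mathop{\rm Pf}_{1\le i<j\le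 2n}[A_{ij}]$$ $$=(-1)^n\gamma^nt^{n^2}\prod_{0\le i<j\le 2n-1}\frac{t^j-t^i}{\gamma s_0-t^{i+j+1}/(\gamma s_0)}\prod_{j=1}^n\bigl(1-s_0^2\gamma t^{-2j+1}\bigr)\bigl(1-\gamma^{-1}t^{2j-2}\bigr).$$ Moreover, suppose that $1-s_xu_j\ne0$ for all $x\ge 0$ and all $j$, that $\gamma t^{2j}\neq 1$ for $1\le j\le n$, and that for some $\varepsilon>0$ one has $\left|\frac{u_j-s_x}{1-s_xu_j}\right|\le 1-\varepsilon$ for all $j$ and all $x\ge1$. Then the series $$\mathcal P(u_1,\dots,u_{2n};t,\alpha)=\sum_{\lambda}\ \prod_{j=1}^{m_0(\lambda)/2}\frac{1-s_0^2\gamma t^{2j-2}}{1-\gamma t^{2j}}\ \prod_{i\ge1}\prod_{j=1}^{m_i(\lambda)/2}\frac{1-s_i^2t^{2j-2}}{1-t^{2j}}\ F^\alpha_\lambda(u_1,\dots,u_{2n})$$ over all $\lambda=(\lambda_1\ge\dots\ge\lambda_{2n}\ge0)$ whose multiplicities $m_i(\lambda)=\#\{k:\lambda_k=i\}$ are all even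 converges absolutely, and $$\mathop{\rm Pf}_{1\le i<j\le 2n}[A_{ij}]=\prod_{j=0}^{2n-1}(1-t^j\gamma^{-1})\prod_{0\le i<j\le 2n-1}\frac{t^j-t^i}{\gamma s_0-t^{i+j+1}/(\gamma s_0)}\ \mathcal P(u_1,\dots,u_{2n};t,\alpha).$$ Here $F^\alpha_\lambda(u_1,\dots,u_N)$ is the spin Hall--Littlewood partition function: the sum over all ensembles of up-right lattice paths in the columns $x\ge0$ and rows $r=1,\dots,N$ (numbered from bottom to top), in which one path enters on the left in every row, no path enters from below or leaves on the right, every horizontal edge carries at most one path, and exactly $m_x(\lambda)$ paths leave at the top of column $x$, of the product of the weights of all vertices. The vertex in column $x$ and row $r$, with $i_1,j_1,i_2,j_2$ paths on its bottom, left, top and right edges, has with $u=u_r$, $s=s_x$, and $q=\gamma$ if $x=0$, $q=1$ if $x\geq 1$, the weight $$\tfrac{1-sqt^{i_1}u}{1-su}\ (j_1=j_2=0,\ i_2=i_1),\qquad \tfrac{(1-s^2qt^{i_2})u}{1-su}\ (j_1=0,j_2=1,\ i_2=i_1-1),$$ $$\tfrac{u-sqt^{i_1}}{1-su}\ (j_1=j_2=1,\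 i_2=i_1),\qquad \tfrac{1-qt^{i_2}}{1-su}\ (j_1=1,j_2=0,\ i_2=i_1+1).$$ -/

import Mathlib

open Finset

noncomputable section

/-- The Pfaffian of a `2n × 2n` antisymmetric complex matrix,
`(1 / (2^n n!)) ∑_σ sgn(σ) ∏_{k<n} A (σ(2k)) (σ(2k+1))` (indices starting from `0`). -/
def pfaffian {n : ℕ} (A : Matrix (Fin (2 * n)) (Fin (2 * n)) ℂ) : ℂ :=
  (1 / ((2 : ℂ) ^ n * (Nat.factorial n : ℂ))) *
    ∑ σ : Equiv.Perm (Fin (2 * n)), ((Equiv.Perm.sign σ : ℤ) : ℂ) *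
      ∏ k : Fin n, A (σ ⟨2 * (k : ℕ), by omega⟩) (σ ⟨2 * (k : ℕ) + 1, by omega⟩)

/-- The polynomial `Z₂(a, b) = (1-t)(1-γ s₀ a)(1-γ s₀ b) + (1-γ)(t-γ s₀²)(1-ab)`. -/
def zTwo (t γ s₀ a b : ℂ) : ℂ :=
  (1 - t) * (1 - γ * s₀ * a) * (1 - γ * s₀ * b)
    + (1 - γ) * (t - γ * s₀ ^ 2) * (1 - a * b)

/-- The entry `Z₂(a, b) (a - b) / ((1 - ab)(1 - t ab))` of the Pfaffian that expresses the
partition function. -/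
def pfKernel (t γ s₀ a b : ℂ) : ℂ :=
  zTwo t γ s₀ a b * (a - b) / ((1 - a * b) * (1 - t * a * b))

/-- The higher spin six vertex weight `w_{u,s}(i₁ + a, j₁; i₂ + a, j₂)`, where `g = t ^ a`:
`i₁` (bottom) and `i₂` (top) count the paths on the vertical edges, up to the shift `a`,
and `j₁` (left), `j₂` (right) are those on the horizontal edges. -/
def vertexWeight (t g s u : ℂ) (i₁ j₁ i₂ j₂ : ℕ) : ℂ :=
  if j₁ = 0 ∧ j₂ = 0 ∧ i₂ = i₁ then (1 - s * g * t ^ i₁ * u) / (1 - s * u)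
  else if j₁ = 0 ∧ j₂ = 1 ∧ i₁ = i₂ + 1 then (1 - s ^ 2 * g * t ^ i₂) * u / (1 - s * u)
  else if j₁ = 1 ∧ j₂ = 1 ∧ i₂ = i₁ then (u - s * g * t ^ i₁) / (1 - s * u)
  else if j₁ = 1 ∧ j₂ = 0 ∧ i₂ = i₁ + 1 then (1 - g * t ^ i₂) / (1 - s * u)
  else 0

/-- The multiplicity `m_i(lam)`, the number of parts of `lam` equal to `i`. -/
def partMult {N : ℕ} (lam : Fin N → ℕ) (i : ℕ) : ℕ :=
  #{k : Fin N | lam k = i}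

/-- The largest part of `lam` (`0` if there are no parts). -/
def largestPart {N : ℕ} (lam : Fin N → ℕ) : ℕ :=
  univ.sup lam

/-- The function `F^α_lam(u₁, …, u_N)`: the sum over all configurations of up-right paths in the
rows `1, …, N` (from bottom to top, row `r` having the variable `u r`) and the columns
`0, …, largestPart lam` of the product of the vertex weights.
The horizontal edges `H r x` carry at most one path; every edge on the left boundary is occupied,
every edge on the right boundary is empty. The vertical edges `V r x` are empty at the bottom and
carry `m_x(lam)` paths at the top. In column `0` all occupation numbers are shifted by `α`. -/
def spinHL (t α : ℂ) (s : ℕ → ℂ) {N : ℕ} (u : Fin N → ℂ) (lam : Fin N → ℕ) : ℂ :=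
  ∑ H : Fin N → Fin (largestPart lam + 2) → Fin 2,
    ∑ V : Fin (N + 1) → Fin (largestPart lam + 1) → Fin (N + 1),
      if (∀ r, H r 0 = 1 ∧ H r (Fin.last _) = 0) ∧
          (∀ x, V 0 x = 0 ∧ (V (Fin.last _) x : ℕ) = partMult lam x) then
        ∏ r : Fin N, ∏ x : Fin (largestPart lam + 1),
          vertexWeight t (if x = 0 then t ^ α else 1) (s x) (u r)
            (V r.castSucc x) (H r x.castSucc) (V r.succ x) (H r x.succ)
      else 0

/-- Signatures `lam₁ ≥ … ≥ lam_N ≥ 0` all of whose multiplicities are even. -/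
def EvenSignature (N : ℕ) : Type :=
  {lam : Fin N → ℕ // Antitone lam ∧ ∀ i, Even (partMult lam i)}

/-- The coefficient `c_lam(t; α)` of the boundary state, for `m₀(lam) ≥ 0`. -/
def boundaryCoeff (t α : ℂ) (s : ℕ → ℂ) {N : ℕ} (lam : Fin N → ℕ) : ℂ :=
  (∏ j ∈ Icc 1 (partMult lam 0 / 2),
      (1 - s 0 ^ 2 * t ^ α * t ^ (2 * j - 2)) / (1 - t ^ α * t ^ (2 * j))) *
    ∏ i ∈ Icc 1 (largestPart lam), ∏ j ∈ Icc 1 (partMult lam i / 2),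
      (1 - s i ^ 2 * t ^ (2 * j - 2)) / (1 - t ^ (2 * j))

/-- The summand of the partition function `𝒫(u₁, …, u_N; t, α)` at a signature. -/
def partitionTerm (t α : ℂ) (s : ℕ → ℂ) {N : ℕ} (u : Fin N → ℂ) (lam : EvenSignature N) : ℂ :=
  boundaryCoeff t α s lam.1 * spinHL t α s u lam.1

/-- The partition function `𝒫(u₁, …, u_N; t, α)`. -/
def partitionFunction (t α : ℂ) (s : ℕ → ℂ) {N : ℕ} (u : Fin N → ℂ) : ℂ :=
  ∑' lam : EvenSignature N, partitionTerm t α s u lam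

/-- The condition under which the partition function converges: no weight has a vanishing
denominator, and `|(u_i - s_x)/(1 - s_x u_i)| ≤ 1 - ε < 1` for all `i` and all `x ≥ 1`. -/
def Admissible (t α : ℂ) (s : ℕ → ℂ) {N : ℕ} (u : Fin N → ℂ) : Prop :=
  (∀ i x, 1 - s x * u i ≠ 0) ∧
    (∀ j ∈ Icc 1 (N / 2), 1 - t ^ α * t ^ (2 * j) ≠ 0) ∧
    ∃ ε : ℝ, 0 < ε ∧ ∀ i, ∀ x, 1 ≤ x → ‖(u i - s x) / (1 - s x * u i)‖ ≤ 1 - ε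

/-- The specialization `u_j = t^{2n-j} / (γ s₀)`, `j = 1, …, 2n`. -/
def specialization (n : ℕ) (t γ s₀ : ℂ) (j : Fin (2 * n)) : ℂ :=
  t ^ (2 * n - ((j : ℕ) + 1)) / (γ * s₀)

/-- The entry `(i, j)`, `1 ≤ i, j ≤ 2n`, of the specialized Pfaffian, written out. -/
def specializedEntry (n : ℕ) (t γ s₀ : ℂ) (i j : ℕ) : ℂ :=
  (t ^ j - t ^ i) *
      (γ ^ 2 * s₀ ^ 2 * (1 - t) * (t ^ i - t ^ (2 * n)) * (t ^ j - t ^ (2 * n))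
        + (1 - γ) * (t - s₀ ^ 2 * γ) * (t ^ (i + j) * γ ^ 2 * s₀ ^ 2 - t ^ (4 * n))) /
    (t ^ (2 * (i : ℤ) + 2 * j - 2 * n) * (γ * s₀)
      * (γ * s₀ - t ^ (4 * n - i - j) / (γ * s₀))
      * (γ * s₀ - t ^ (4 * n + 1 - i - j) / (γ * s₀)))

/-- The product `∏_{0 ≤ i < j ≤ 2n-1} (t^j - t^i) / (γ s₀ - t^{i+j+1} / (γ s₀))`. -/
def vandermondeFactor (n : ℕ) (t γ s₀ : ℂ) : ℂ :=
  ∏ j ∈ range (2 * n), ∏ i ∈ range j,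
    (t ^ j - t ^ i) / (γ * s₀ - t ^ (i + j + 1) / (γ * s₀))

end

/-! The Pfaffian and the partition function are each evaluated as a product, independently of one
another, and the last identity compares the two products.

Pfaffian. Put c = 1/(γ s₀), so that the variables are c t^k with 0 ≤ k < 2n. For fixed c the kernel
matrix is a pencil A + κB, where B has entries (x_i - x_j)/(1 - t x_i x_j) and κ = (1-γ)(t-γs₀²) =
(1-γ)(t - 1/(c²γ)). Its Pfaffian is a polynomial in κ of degree at most n, with coefficient Pf B at
κ^n, and Pf B is Schur's Pfaffian (`pfaffian_schur`). The roots are the values r_l taken by κ at γ =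
t^{2l}, l < n. There the pencil has the null vector `nullCoeff`: a row applied to it telescopes to a
quantity that does not depend on the row variable z (`pencil_telescope`), and at z = c this quantity
is a multiple of a terminating q-Watson sum of odd order, which is zero (`watson_odd`). The r_l are
distinct, so the Pfaffian is Pf B ∏(κ - r_l) (`pfaffian_pencil_eq_prod`), and each κ - r_l splits
into two linear factors.

Partition function. Because the u_j form a geometric progression, rows fuse: if the outputs of a
column x ≥ 1 are summed against a function of their number, the result depends only on the number of
inputs (`sum_colWeight_mul`). In column 0 all inputs are occupied. So F_λ is a product over columns,
and 𝒫 is the limit of a transfer recursion for the number k of pairs of paths still travelling to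
the right. The bound 1 - ε makes the diagonal part of this recursion a contraction, which gives
absolute convergence (`exists_transferSum_norm_le`) and convergence to any stationary solution with
value 1 at k = 0 (`tendsto_transferSum`). By the q-Pfaff–Saalschütz sum, (t;t²)_k/(c²t;t²)_k is
stationary for every column, whatever s_x is (`sum_evenWeight_mul_stationary`). A second Saalschütz
sum evaluates column 0 (`sum_evenWeight_zero_mul_stationary`). -/

/-! ### Pfaffians: congruence, null vectors, splitting off a block. -/

/-- The bijection `(k, b) ↦ 2 k + b`. -/
def pairEquiv (n : ℕ) : Fin n × Fin 2 ≃ Fin (2 * n) :=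
  finProdFinEquiv.trans (finCongr (mul_comm n 2))

theorem pairEquiv_zero (n : ℕ) (k : Fin n) :
    pairEquiv n (k, 0) = ⟨2 * (k : ℕ), by omega⟩ := by
  ext; simp [pairEquiv]

theorem pairEquiv_one (n : ℕ) (k : Fin n) :
    pairEquiv n (k, 1) = ⟨2 * (k : ℕ) + 1, by omega⟩ := by
  ext; simp [pairEquiv]; omega

theorem pfaffian_eq_sum {n : ℕ} (A : Matrix (Fin (2 * n)) (Fin (2 * n)) ℂ) :
    pfaffian A = (1 / ((2 : ℂ) ^ n * (Nat.factorial n : ℂ))) *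
      ∑ σ : Equiv.Perm (Fin (2 * n)), ((Equiv.Perm.sign σ : ℤ) : ℂ) *
        ∏ k : Fin n, A (σ (pairEquiv n (k, 0))) (σ (pairEquiv n (k, 1))) := by
  simp only [pfaffian, pairEquiv_zero, pairEquiv_one]

theorem prod_pairEquiv {n : ℕ} (h : Fin (2 * n) → ℂ) :
    ∏ i, h i = ∏ k : Fin n, h (pairEquiv n (k, 0)) * h (pairEquiv n (k, 1)) := by
  rw [← (pairEquiv n).prod_comp, Fintype.prod_prod_type]
  simp [Fin.prod_univ_two]

/-- A function on `Fin (2 * n)` as a sequence of `n` pairs. -/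
def arrowPairEquiv (n : ℕ) (X : Type*) : (Fin (2 * n) → X) ≃ (Fin n → X × X) :=
  ((Equiv.arrowCongr (pairEquiv n).symm (Equiv.refl X)).trans (Equiv.curry _ _ _)).trans
    (Equiv.arrowCongr (Equiv.refl _) (finTwoArrowEquiv X))

theorem arrowPairEquiv_apply {n : ℕ} {X : Type*} (f : Fin (2 * n) → X) (k : Fin n) :
    arrowPairEquiv n X f k = (f (pairEquiv n (k, 0)), f (pairEquiv n (k, 1))) := by
  simp [arrowPairEquiv, finTwoArrowEquiv, Function.curry]

theorem sum_arrow_eq_sum_perm {X : Type*} [Fintype X] [DecidableEq X] (F : (X → X) → ℂ)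
    (hF : ∀ f, ¬ Function.Injective f → F f = 0) :
    ∑ f, F f = ∑ τ : Equiv.Perm X, F τ := by
  have : ∑ τ : Equiv.Perm X, F τ
      = ∑ f ∈ univ.map ⟨fun τ : Equiv.Perm X => (τ : X → X), DFunLike.coe_injective⟩, F f := by
    simp
  rw [this]
  symm
  apply Finset.sum_subset (Finset.subset_univ _)
  intro f _ hf
  apply hF
  intro hi
  apply hf
  simp only [mem_map, mem_univ, true_and, Function.Embedding.coeFn_mk]
  exact ⟨Equiv.ofBijective f (Finite.injective_iff_bijective.mp hi), rfl⟩

/-- After expansion, the sum over σ is a determinant of `B` with columns chosen by a map `f`. It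
vanishes unless `f` is a permutation τ, and then it is sgn τ · det B. This replaces any appeal to
Pf² = det. -/
theorem pfaffian_congr_mul {n : ℕ} (A B : Matrix (Fin (2 * n)) (Fin (2 * n)) ℂ) :
    pfaffian (B * A * B.transpose) = B.det * pfaffian A := by
  have key : ∀ σ : Equiv.Perm (Fin (2 * n)),
      ∏ k : Fin n, (B * A * B.transpose) (σ (pairEquiv n (k, 0))) (σ (pairEquiv n (k, 1)))
      = ∑ f : Fin (2 * n) → Fin (2 * n), (∏ i, B (σ i) (f i)) *
          ∏ k : Fin n, A (f (pairEquiv n (k, 0))) (f (pairEquiv n (k, 1))) := by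
    intro σ
    have h1 : ∀ i j, (B * A * B.transpose) i j
        = ∑ p : Fin (2 * n) × Fin (2 * n), B i p.1 * B j p.2 * A p.1 p.2 := by
      intro i j
      rw [Fintype.sum_prod_type, Finset.sum_comm]
      simp only [Matrix.mul_apply, Matrix.transpose_apply, Finset.sum_mul]
      refine Finset.sum_congr rfl fun a _ => Finset.sum_congr rfl fun b _ => by ring
    simp only [h1]
    rw [Finset.prod_univ_sum, Fintype.piFinset_univ,
      ← (arrowPairEquiv n (Fin (2 * n))).sum_comp]
    refine Finset.sum_congr rfl fun f _ => ?_
    simp only [arrowPairEquiv_apply]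
    rw [prod_pairEquiv (fun i => B (σ i) (f i)), ← Finset.prod_mul_distrib]
  rw [pfaffian_eq_sum, pfaffian_eq_sum]
  simp only [key, Finset.mul_sum]
  rw [Finset.sum_comm]
  have h2 : ∀ f : Fin (2 * n) → Fin (2 * n),
      ∑ σ : Equiv.Perm (Fin (2 * n)), 1 / ((2 : ℂ) ^ n * (Nat.factorial n : ℂ)) *
        (((Equiv.Perm.sign σ : ℤ) : ℂ) * ((∏ i, B (σ i) (f i)) *
          ∏ k : Fin n, A (f (pairEquiv n (k, 0))) (f (pairEquiv n (k, 1)))))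
      = (B.submatrix id f).det * (1 / ((2 : ℂ) ^ n * (Nat.factorial n : ℂ)) *
          ∏ k : Fin n, A (f (pairEquiv n (k, 0))) (f (pairEquiv n (k, 1)))) := by
    intro f
    rw [Matrix.det_apply', Finset.sum_mul]
    refine Finset.sum_congr rfl fun σ _ => ?_
    simp only [Matrix.submatrix_apply, id]
    ring
  simp only [h2]
  rw [sum_arrow_eq_sum_perm]
  · refine Finset.sum_congr rfl fun τ _ => ?_
    rw [Matrix.det_permute']
    ring
  · intro f hf
    rw [Function.not_injective_iff] at hf
    obtain ⟨a, b, hab, hne⟩ := hf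
    rw [Matrix.det_zero_of_column_eq hne, zero_mul]
    intro i
    simp [hab]

theorem pfaffian_eq_zero_of_row_col_zero {n : ℕ} (A : Matrix (Fin (2 * n)) (Fin (2 * n)) ℂ)
    (i : Fin (2 * n)) (hr : ∀ j, A i j = 0) (hc : ∀ j, A j i = 0) : pfaffian A = 0 := by
  rw [pfaffian_eq_sum]
  convert mul_zero _
  refine Finset.sum_eq_zero fun σ _ => ?_
  convert mul_zero _
  obtain ⟨⟨k, b⟩, hk⟩ := (pairEquiv n).surjective (σ.symm i)
  apply Finset.prod_eq_zero (Finset.mem_univ k)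
  have hk' : σ (pairEquiv n (k, b)) = i := by rw [hk]; simp
  fin_cases b
  · simp only [Fin.zero_eta] at hk'
    rw [hk', hr]
  · simp only [Fin.mk_one] at hk'
    rw [hk', hc]

/-- Congruence by the identity with row k replaced by `v`, where `v k` ≠ 0, kills row and column k
and multiplies the Pfaffian by `v k`. -/
theorem pfaffian_eq_zero_of_mulVec {n : ℕ} (A : Matrix (Fin (2 * n)) (Fin (2 * n)) ℂ)
    (hA : A.transpose = -A) (v : Fin (2 * n) → ℂ) (hv : v ≠ 0) (h : A.mulVec v = 0) :
    pfaffian A = 0 := by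
  obtain ⟨k, hk⟩ := Function.ne_iff.mp hv
  have hk : v k ≠ 0 := hk
  set B : Matrix (Fin (2 * n)) (Fin (2 * n)) ℂ := Matrix.updateRow 1 k v with hB
  have hdet : B.det = v k := by
    rw [hB]
    have := Matrix.det_updateRow_sum (1 : Matrix (Fin (2 * n)) (Fin (2 * n)) ℂ) k v
    simp only [Matrix.det_one, smul_eq_mul, mul_one] at this
    rw [← this]
    congr 2
    ext j
    simp [Matrix.one_apply]
  have h' : Matrix.vecMul v A = 0 := by
    have := Matrix.vecMul_transpose (A.transpose) v
    rw [Matrix.transpose_transpose] at this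
    rw [this, hA, Matrix.neg_mulVec, h, neg_zero]
  have hz : pfaffian (B * A * B.transpose) = 0 := by
    apply pfaffian_eq_zero_of_row_col_zero _ k
    · intro j
      rw [Matrix.mul_apply]
      refine Finset.sum_eq_zero fun a _ => ?_
      have : (B * A) k a = Matrix.vecMul v A a := by
        simp [Matrix.mul_apply, hB, Matrix.vecMul, dotProduct]
      rw [this, h']
      simp
    · intro j
      rw [Matrix.mul_assoc, Matrix.mul_apply]
      refine Finset.sum_eq_zero fun a _ => ?_
      have : (A * B.transpose) a k = Matrix.mulVec A v a := by
        simp [Matrix.mul_apply, hB, Matrix.mulVec, dotProduct]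
      rw [this, h]
      simp
  rw [pfaffian_congr_mul, hdet] at hz
  exact (mul_eq_zero.mp hz).resolve_left hk

theorem sum_perm_of_fix_zero {m : ℕ} (G : Equiv.Perm (Fin (m + 1)) → ℂ)
    (hG : ∀ σ, σ 0 ≠ 0 → G σ = 0) :
    ∑ σ, G σ = ∑ e : Equiv.Perm (Fin m), G (Equiv.Perm.decomposeFin.symm (0, e)) := by
  rw [← Equiv.Perm.decomposeFin.symm.sum_comp, Fintype.sum_prod_type, Fin.sum_univ_succ]
  rw [add_eq_left]
  refine Finset.sum_eq_zero fun p _ => Finset.sum_eq_zero fun e _ => hG _ ?_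
  rw [Equiv.Perm.decomposeFin_symm_apply_zero]
  exact Fin.succ_ne_zero p

/-- The summand of the Pfaffian at a permutation. -/
noncomputable def pfTerm {n : ℕ} (A : Matrix (Fin (2 * n)) (Fin (2 * n)) ℂ)
    (σ : Equiv.Perm (Fin (2 * n))) : ℂ :=
  ((Equiv.Perm.sign σ : ℤ) : ℂ) *
        ∏ k : Fin n, A (σ (pairEquiv n (k, 0))) (σ (pairEquiv n (k, 1)))

theorem pfTerm_mul_swap {n : ℕ} (A : Matrix (Fin (2 * n)) (Fin (2 * n)) ℂ)
    (hA : ∀ i j, A j i = - A i j) (σ : Equiv.Perm (Fin (2 * n))) (k : Fin n) :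
    pfTerm A (σ * Equiv.swap (pairEquiv n (k, 0)) (pairEquiv n (k, 1))) = pfTerm A σ := by
  have hne : pairEquiv n (k, 0) ≠ pairEquiv n (k, 1) := by simp
  have h : ∏ j : Fin n, A ((σ * Equiv.swap (pairEquiv n (k, 0)) (pairEquiv n (k, 1)))
          (pairEquiv n (j, 0)))
        ((σ * Equiv.swap (pairEquiv n (k, 0)) (pairEquiv n (k, 1))) (pairEquiv n (j, 1)))
      = ∏ j : Fin n, (if j = k then -1 else 1) *
          A (σ (pairEquiv n (j, 0))) (σ (pairEquiv n (j, 1))) := by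
    refine Finset.prod_congr rfl fun j _ => ?_
    by_cases hj : j = k
    · subst hj
      rw [if_pos rfl, Equiv.Perm.mul_apply, Equiv.Perm.mul_apply, Equiv.swap_apply_left,
        Equiv.swap_apply_right, hA, neg_one_mul]
    · rw [if_neg hj, one_mul]
      simp only [Equiv.Perm.mul_apply]
      rw [Equiv.swap_apply_of_ne_of_ne, Equiv.swap_apply_of_ne_of_ne] <;> simp [hj]
  unfold pfTerm
  rw [h, Finset.prod_mul_distrib]
  simp [Equiv.Perm.sign_mul, Equiv.Perm.sign_swap hne]

/-- The permutation exchanging two pairs. -/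
def pairSwap {n : ℕ} (k l : Fin n) : Equiv.Perm (Fin (2 * n)) :=
  (pairEquiv n).permCongr (Equiv.prodCongrLeft fun _ : Fin 2 => Equiv.swap k l)

theorem pfTerm_mul_pairSwap {n : ℕ} (A : Matrix (Fin (2 * n)) (Fin (2 * n)) ℂ)
    (σ : Equiv.Perm (Fin (2 * n))) (k l : Fin n) :
    pfTerm A (σ * pairSwap k l) = pfTerm A σ := by
  have hs : Equiv.Perm.sign (pairSwap k l) = 1 := by
    rw [pairSwap, Equiv.Perm.sign_permCongr, Equiv.Perm.sign_prodCongrLeft]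
    simp
  unfold pfTerm
  rw [Equiv.Perm.sign_mul, hs, mul_one]
  congr 1
  rw [← Equiv.prod_comp (Equiv.swap k l)
    (fun j => A (σ (pairEquiv n (j, 0))) (σ (pairEquiv n (j, 1))))]
  refine Finset.prod_congr rfl fun j _ => ?_
  simp [pairSwap, Equiv.permCongr_apply]

/-- The summand is invariant under swaps inside a pair and under exchanges of pairs. These move the
position of the value 0 to the front, and there are 2(n + 1) positions. -/
theorem sum_pfTerm_eq {n : ℕ} (A : Matrix (Fin (2 * (n + 1))) (Fin (2 * (n + 1))) ℂ)
    (hA : ∀ i j, A j i = - A i j) :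
    ∑ σ, pfTerm A σ = 2 * (n + 1) * ∑ σ, if σ 0 = 0 then pfTerm A σ else 0 := by
  have h0 : pairEquiv (n + 1) (0, 0) = 0 := by rw [pairEquiv_zero]; rfl
  have h1 : ∀ k : Fin (n + 1), ∑ σ, (if σ (pairEquiv (n + 1) (k, 0)) = 0 then pfTerm A σ else 0)
      = ∑ σ, if σ 0 = 0 then pfTerm A σ else 0 := by
    intro k
    rw [← Equiv.sum_comp (Equiv.mulRight (pairSwap 0 k))]
    refine Finset.sum_congr rfl fun σ _ => ?_
    simp only [Equiv.coe_mulRight, pfTerm_mul_pairSwap]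
    congr 2
    rw [Equiv.Perm.mul_apply, pairSwap]
    simp [Equiv.permCongr_apply, h0]
  have h2 : ∀ k : Fin (n + 1), ∑ σ, (if σ (pairEquiv (n + 1) (k, 1)) = 0 then pfTerm A σ else 0)
      = ∑ σ, if σ 0 = 0 then pfTerm A σ else 0 := by
    intro k
    rw [← h1 k, ← Equiv.sum_comp (Equiv.mulRight
      (Equiv.swap (pairEquiv (n + 1) (k, 0)) (pairEquiv (n + 1) (k, 1))))]
    refine Finset.sum_congr rfl fun σ _ => ?_
    simp only [Equiv.coe_mulRight, pfTerm_mul_swap A hA]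
    simp
  have h3 : ∀ σ : Equiv.Perm (Fin (2 * (n + 1))), pfTerm A σ
      = ∑ q, if σ q = 0 then pfTerm A σ else 0 := by
    intro σ
    rw [Finset.sum_eq_single (σ.symm 0)]
    · simp
    · intro b _ hb
      rw [if_neg]
      intro h
      exact hb (by rw [← h]; simp)
    · simp
  rw [Finset.sum_congr rfl fun σ _ => h3 σ, Finset.sum_comm,
    ← (pairEquiv (n + 1)).sum_comp, Fintype.sum_prod_type]
  simp only [Fin.sum_univ_two, h1, h2]
  simp
  ring

theorem decomposeFin_symm_twice {m : ℕ} (e : Equiv.Perm (Fin m)) :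
    Equiv.Perm.decomposeFin.symm (0, Equiv.Perm.decomposeFin.symm (0, e)) 0 = 0 ∧
    Equiv.Perm.decomposeFin.symm (0, Equiv.Perm.decomposeFin.symm (0, e)) 1 = 1 ∧
    (∀ x : Fin m, Equiv.Perm.decomposeFin.symm (0, Equiv.Perm.decomposeFin.symm (0, e))
      x.succ.succ = (e x).succ.succ) ∧
    Equiv.Perm.sign (Equiv.Perm.decomposeFin.symm (0, Equiv.Perm.decomposeFin.symm (0, e)))
      = Equiv.Perm.sign e := by
  refine ⟨by simp, by simp, fun x => by simp, by simp⟩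

/-- Only permutations fixing 0 need counting, and as row 0 has its single possible nonzero entry in
column 1, they must fix 1 as well. The factor 2(n + 1) accounts for the change of normalisation. -/
theorem pfaffian_block {n : ℕ} (A : Matrix (Fin (2 * (n + 1))) (Fin (2 * (n + 1))) ℂ)
    (hA : ∀ i j, A j i = - A i j)
    (h0 : ∀ j : Fin (2 * n), A 0 j.succ.succ = 0) :
    pfaffian A = A 0 1 *
      pfaffian (Matrix.of fun i j : Fin (2 * n) => A i.succ.succ j.succ.succ) := by
  have e0 : pairEquiv (n + 1) (0, 0) = 0 := by rw [pairEquiv_zero]; rfl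
  have e1 : pairEquiv (n + 1) (0, 1) = 1 := by rw [pairEquiv_one]; rfl
  have e0' : ∀ k : Fin n, pairEquiv (n + 1) (k.succ, 0) = (pairEquiv n (k, 0)).succ.succ := by
    intro k; rw [pairEquiv_zero, pairEquiv_zero]; ext; simp; ring
  have e1' : ∀ k : Fin n, pairEquiv (n + 1) (k.succ, 1) = (pairEquiv n (k, 1)).succ.succ := by
    intro k; rw [pairEquiv_one, pairEquiv_one]; ext; simp; ring
  have hd : A 0 0 = 0 := by
    have := hA 0 0
    linear_combination this / 2
  have hsum : ∑ σ, (if σ 0 = 0 then pfTerm A σ else 0) = A 0 1 *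
      ∑ e, pfTerm (Matrix.of fun i j : Fin (2 * n) => A i.succ.succ j.succ.succ) e := by
    rw [show (∑ σ : Equiv.Perm (Fin (2 * (n + 1))), (if σ 0 = 0 then pfTerm A σ else 0)) =
      ∑ σ : Equiv.Perm (Fin (2 * n + 1 + 1)),
        (if σ 0 = 0 then pfTerm (n := n + 1) A σ else 0) from rfl]
    rw [sum_perm_of_fix_zero _ (fun σ hσ => if_neg hσ)]
    rw [sum_perm_of_fix_zero, Finset.mul_sum]
    · refine Finset.sum_congr rfl fun e _ => ?_
      rw [if_pos (Equiv.Perm.decomposeFin_symm_apply_zero _ _)]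
      unfold pfTerm
      rw [Fin.prod_univ_succ]
      simp only [e0, e1, e0', e1']
      obtain ⟨τ0, τ1, τ2, τs⟩ := decomposeFin_symm_twice e
      rw [τs]
      change _ * (A (Equiv.Perm.decomposeFin.symm (0, Equiv.Perm.decomposeFin.symm (0, e)) 0)
        (Equiv.Perm.decomposeFin.symm (0, Equiv.Perm.decomposeFin.symm (0, e)) 1) *
        ∏ x, A (Equiv.Perm.decomposeFin.symm (0, Equiv.Perm.decomposeFin.symm (0, e))
            (pairEquiv n (x, 0)).succ.succ)
          (Equiv.Perm.decomposeFin.symm (0, Equiv.Perm.decomposeFin.symm (0, e))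
            (pairEquiv n (x, 1)).succ.succ)) = _
      simp only [τ0, τ1, τ2, Matrix.of_apply]
      exact mul_left_comm _ _ _
    · intro e he
      rw [if_pos (Equiv.Perm.decomposeFin_symm_apply_zero _ _)]
      unfold pfTerm
      convert mul_zero _
      apply Finset.prod_eq_zero (Finset.mem_univ (0 : Fin (n + 1)))
      rw [e0, e1]
      change A (Equiv.Perm.decomposeFin.symm (0, e) 0) (Equiv.Perm.decomposeFin.symm (0, e) 1) = 0
      rw [Equiv.Perm.decomposeFin_symm_apply_zero, Equiv.Perm.decomposeFin_symm_apply_one]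
      obtain ⟨j, hj⟩ := Fin.exists_succ_eq.mpr he
      rw [← hj, Equiv.swap_self]
      exact h0 j
  have hs := sum_pfTerm_eq A hA
  rw [hsum] at hs
  rw [pfaffian_eq_sum, pfaffian_eq_sum]
  change _ * ∑ σ, pfTerm A σ = A 0 1 * (_ * ∑ σ, pfTerm _ σ)
  rw [hs, Nat.factorial_succ]
  push_cast
  have : ((n : ℂ) + 1) ≠ 0 := by exact_mod_cast Nat.succ_ne_zero n
  field_simp
  ring

/-! ### Schur complements and Schur's Pfaffian. -/

/-- A = L D Lᵀ with L lower triangular of diagonal (1, 1, φ) and D the direct sum of a 2 × 2 skew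
block and S. The scaling φ is there because the complement of a Schur matrix has the same shape only
up to row and column factors. -/
theorem pfaffian_schur_complement {n : ℕ} (A : Matrix (Fin (2 * n + 1 + 1)) (Fin (2 * n + 1 + 1)) ℂ)
    (hA : ∀ i j, A j i = - A i j) (S : Matrix (Fin (2 * n)) (Fin (2 * n)) ℂ)
    (hS : ∀ i j, S j i = - S i j) (φ : Fin (2 * n) → ℂ) (hp : A 0 1 ≠ 0)
    (h : ∀ i j : Fin (2 * n), A i.succ.succ j.succ.succ * A 0 1
      - A 0 i.succ.succ * A 1 j.succ.succ + A 0 j.succ.succ * A 1 i.succ.succ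
      = A 0 1 * (φ i * φ j * S i j)) :
    pfaffian (n := n + 1) A = (∏ i, φ i) * A 0 1 * pfaffian S := by
  set p := A 0 1 with hpdef
  have hd : ∀ i, A i i = 0 := fun i => by
    have := hA i i
    linear_combination this / 2
  let D : Matrix (Fin (2 * n + 1 + 1)) (Fin (2 * n + 1 + 1)) ℂ :=
    Fin.cons (Fin.cons 0 (Fin.cons p 0)) (Fin.cons (Fin.cons (-p) 0)
      (fun i => Fin.cons 0 (Fin.cons 0 (fun j => S i j))))
  let L : Matrix (Fin (2 * n + 1 + 1)) (Fin (2 * n + 1 + 1)) ℂ :=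
    Fin.cons (Fin.cons 1 0) (Fin.cons (Fin.cons 0 (Fin.cons 1 0))
      (fun i => Fin.cons (- A 1 i.succ.succ / p) (Fin.cons (A 0 i.succ.succ / p)
        (fun j => if i = j then φ i else 0))))
  have D00 : D 0 0 = 0 := rfl
  have D01 : D 0 1 = p := rfl
  have D10 : D 1 0 = -p := rfl
  have D11 : D 1 1 = 0 := rfl
  have D0 : ∀ j : Fin (2 * n), D 0 j.succ.succ = 0 := fun j => rfl
  have D1 : ∀ j : Fin (2 * n), D 1 j.succ.succ = 0 := fun j => rfl
  have D0' : ∀ j : Fin (2 * n), D j.succ.succ 0 = 0 := fun j => rfl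
  have D1' : ∀ j : Fin (2 * n), D j.succ.succ 1 = 0 := fun j => rfl
  have DS : ∀ i j : Fin (2 * n), D i.succ.succ j.succ.succ = S i j := fun i j => rfl
  have L00 : L 0 0 = 1 := rfl
  have L01 : L 0 1 = 0 := rfl
  have L10 : L 1 0 = 0 := rfl
  have L11 : L 1 1 = 1 := rfl
  have L0 : ∀ j : Fin (2 * n), L 0 j.succ.succ = 0 := fun j => rfl
  have L1 : ∀ j : Fin (2 * n), L 1 j.succ.succ = 0 := fun j => rfl
  have L0' : ∀ j : Fin (2 * n), L j.succ.succ 0 = - A 1 j.succ.succ / p := fun j => rfl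
  have L1' : ∀ j : Fin (2 * n), L j.succ.succ 1 = A 0 j.succ.succ / p := fun j => rfl
  have LS : ∀ i j : Fin (2 * n), L i.succ.succ j.succ.succ = if i = j then φ i else 0 :=
    fun i j => rfl
  have s01 : (Fin.succ 0 : Fin (2 * n + 1 + 1)) = 1 := rfl
  have hDskew : ∀ i j, D j i = - D i j := by
    intro i j
    refine Fin.cases ?_ (fun i => Fin.cases ?_ (fun i => ?_) i) i <;>
    refine Fin.cases ?_ (fun j => Fin.cases ?_ (fun j => ?_) j) j <;>
    simp only [s01, D00, D01, D10, D11, D0, D1, D0', D1', DS, neg_zero, neg_neg]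
    exact hS _ _
  have hfac : A = L * D * L.transpose := by
    ext i j
    simp only [Matrix.mul_apply, Matrix.transpose_apply, Fin.sum_univ_succ, s01]
    refine Fin.cases ?_ (fun i => Fin.cases ?_ (fun i => ?_) i) i <;>
    refine Fin.cases ?_ (fun j => Fin.cases ?_ (fun j => ?_) j) j <;>
    simp only [s01, D00, D01, D10, D11, D0, D1, D0', D1', DS, L00, L01, L10, L11, L0, L1, L0', L1',
      LS, hd, mul_zero, zero_mul, Finset.sum_const_zero, add_zero, zero_add, one_mul, mul_one,
      ite_mul, mul_ite, Finset.sum_ite_eq, Finset.mem_univ, if_true]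
    · rw [hpdef]
    · field_simp
    · exact hA _ _
    · field_simp
    · rw [hA]; field_simp
    · rw [hA]; field_simp
    · field_simp
      linear_combination h i j
  have hdet : L.det = ∏ i, φ i := by
    rw [Matrix.det_of_isLowerTriangular L]
    · simp [Fin.prod_univ_succ, s01, L00, L11, LS]
    · intro i j hij
      revert hij
      refine Fin.cases ?_ (fun i => Fin.cases ?_ (fun i => ?_) i) i <;>
      refine Fin.cases ?_ (fun j => Fin.cases ?_ (fun j => ?_) j) j <;>
      simp [s01, L01, L10, L0, L1, L0', L1', LS]
      · exact fun h => absurd (show i.succ.succ < (0 : Fin (2 * n + 1 + 1)) from h) (by simp)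
      · exact fun h => absurd (show i.succ.succ < (1 : Fin (2 * n + 1 + 1)) from h)
          (by simp [Fin.lt_def])
      · exact fun h e => absurd h (by simp [e])
  have h1 := pfaffian_congr_mul (n := n + 1) D L
  have h2 := pfaffian_block (n := n) D hDskew D0
  rw [show (A : Matrix (Fin (2 * (n + 1))) (Fin (2 * (n + 1))) ℂ) = L * D * L.transpose from hfac]
  refine h1.trans ?_
  rw [h2]
  have h3 : Matrix.det (n := Fin (2 * (n + 1))) L = ∏ i, φ i := hdet
  rw [h3, mul_assoc]
  rfl

/-- Eliminating x₀ and x₁ leaves a Schur matrix in the other variables, rescaled by the factors t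
(x₀-x_i)(x₁-x_i)/((1-t x₀x_i)(1-t x₁x_i)). These supply the missing factors of the product and a
power t^{2n}. Injectivity keeps the pivot nonzero. -/
theorem pfaffian_schur (t : ℂ) : ∀ (n : ℕ) (x : Fin (2 * n) → ℂ), Function.Injective x →
    (∀ i j, i ≠ j → 1 - t * x i * x j ≠ 0) →
    pfaffian (Matrix.of fun i j => (x i - x j) / (1 - t * x i * x j))
      = t ^ (n * (n - 1)) * ∏ i, ∏ j ∈ Ioi i, (x i - x j) / (1 - t * x i * x j) := by
  intro n
  induction n with
  | zero =>
    intro x _ _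
    simp [pfaffian]
  | succ n ih =>
    intro x hx ht
    change pfaffian (n := n + 1) (Matrix.of fun i j : Fin (2 * n + 1 + 1) =>
      (x i - x j) / (1 - t * x i * x j)) = t ^ ((n + 1) * n) *
      ∏ i : Fin (2 * n + 1 + 1), ∏ j ∈ Ioi i, (x i - x j) / (1 - t * x i * x j)
    have hskew : ∀ a b : ℂ, (b - a) / (1 - t * b * a) = - ((a - b) / (1 - t * a * b)) := by
      intro a b
      rw [← neg_div, neg_sub, mul_right_comm]
    let x' : Fin (2 * n + 1 + 1) → ℂ := x
    have hx' : Function.Injective x' := hx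
    have ht' : ∀ i j, i ≠ j → 1 - t * x' i * x' j ≠ 0 := ht
    have h01 : x' 0 - x' 1 ≠ 0 := sub_ne_zero.mpr fun h => absurd (hx' h) (by simp)
    have d01 := ht' 0 1 (by simp)
    have d0 : ∀ i : Fin (2 * n), 1 - t * x' 0 * x' i.succ.succ ≠ 0 := fun i =>
      ht' _ _ (Fin.succ_ne_zero _).symm
    have d1 : ∀ i : Fin (2 * n), 1 - t * x' 1 * x' i.succ.succ ≠ 0 := fun i =>
      ht' _ _ (fun h => absurd (Fin.succ_injective (2 * n + 1) (show Fin.succ 0 = _ from h)).symm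
        (Fin.succ_ne_zero _))
    rw [pfaffian_schur_complement (Matrix.of fun i j : Fin (2 * n + 1 + 1) =>
      (x' i - x' j) / (1 - t * x' i * x' j)) (fun i j => hskew (x' i) (x' j))
      (Matrix.of fun i j : Fin (2 * n) => (x' i.succ.succ - x' j.succ.succ) /
        (1 - t * x' i.succ.succ * x' j.succ.succ))
      (fun i j => hskew (x' i.succ.succ) (x' j.succ.succ))
      (fun i => t * ((x' 0 - x' i.succ.succ) / (1 - t * x' 0 * x' i.succ.succ) *
        ((x' 1 - x' i.succ.succ) / (1 - t * x' 1 * x' i.succ.succ))))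
      (div_ne_zero h01 d01)]
    · rw [ih (fun i => x' i.succ.succ)]
      · rw [Fin.prod_univ_succ, Fin.prod_univ_succ]
        simp only [Fin.prod_Ioi_zero, Fin.prod_Ioi_succ]
        rw [Fin.prod_univ_succ]
        simp only [Finset.prod_mul_distrib, Matrix.of_apply, Finset.prod_const, Finset.card_univ,
          Fintype.card_fin]
        have hpow : t ^ (2 * n) * t ^ (n * (n - 1)) = t ^ ((n + 1) * n) := by
          rw [← pow_add]
          congr 1
          cases n with
          | zero => rfl
          | succ m => simp; ring
        rw [← hpow]
        change _ = _ * ((x' 0 - x' 1) / (1 - t * x' 0 * x' 1) * (∏ i : Fin (2 * n),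
          (x' 0 - x' i.succ.succ) / (1 - t * x' 0 * x' i.succ.succ)) *
          ((∏ i : Fin (2 * n), (x' 1 - x' i.succ.succ) / (1 - t * x' 1 * x' i.succ.succ)) *
          ∏ i : Fin (2 * n), ∏ j ∈ Ioi i, (x' i.succ.succ - x' j.succ.succ) /
            (1 - t * x' i.succ.succ * x' j.succ.succ)))
        simp only [x']
        ring
      · intro i j h
        exact Fin.succ_injective _ (Fin.succ_injective _ (hx' h))
      · intro i j h
        exact ht' _ _ fun h' => h (Fin.succ_injective _ (Fin.succ_injective _ h'))
    · intro i j
      simp only [Matrix.of_apply]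
      by_cases hij : i = j
      · subst hij
        simp
      have dij := ht' i.succ.succ j.succ.succ
        fun h' => hij (Fin.succ_injective _ (Fin.succ_injective _ h'))
      have e1 := d0 i
      have e2 := d0 j
      have e3 := d1 i
      have e4 := d1 j
      clear d0 d1
      generalize x' i.succ.succ = a at *
      generalize x' j.succ.succ = b at *
      generalize x' 0 = p at *
      generalize x' 1 = q at *
      generalize h1 : 1 - t * a * b = d1 at *
      generalize h2 : 1 - t * p * a = d2 at *
      generalize h3 : 1 - t * p * b = d3 at *
      generalize h4 : 1 - t * q * a = d4 at *
      generalize h5 : 1 - t * q * b = d5 at *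
      generalize h6 : 1 - t * p * q = d6 at *
      field_simp
      subst h1 h2 h3 h4 h5 h6
      ring

/-! ### The terminating q-Watson sum of odd order. -/

/-- The ratio of two consecutive entries of `nullCoeff`. -/
noncomputable def nullRatio (t y M : ℂ) (j : ℕ) : ℂ :=
  t * (1 - t ^ j / M) * (1 - y * M * t ^ (j + 1)) * (1 - y * t ^ (2 * j + 1)) /
    ((1 - t ^ (j + 1)) * (1 - y * t ^ (j + 1)) * (1 - y * t ^ (2 * j + 2)))

/-- The summands of the terminating series in the `q`-Watson sum of Andrews, base `t`, with
`M = t ^ m`. -/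
noncomputable def nullCoeff (t y M : ℂ) (i : ℕ) : ℂ := ∏ j ∈ range i, nullRatio t y M j

theorem nullCoeff_succ (t y M : ℂ) (i : ℕ) :
    nullCoeff t y M (i + 1) = nullCoeff t y M i * nullRatio t y M i :=
  Finset.prod_range_succ _ _

theorem nullCoeff_eq_zero {t y : ℂ} (ht : t ≠ 0) {m i : ℕ} (h : m < i) :
    nullCoeff t y (t ^ m) i = 0 := by
  apply Finset.prod_eq_zero (Finset.mem_range.mpr h)
  rw [nullRatio, div_self (pow_ne_zero m ht)]
  simp

/-- The ratio of the weights in the contiguity relation for `nullCoeff`. -/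
noncomputable def watsonRatio (t y M : ℂ) (j : ℕ) : ℂ :=
  t * (1 - t ^ j / (t ^ 2 * M)) * (1 - y * (t * M) * t ^ j) * (1 - y * t ^ (2 * j + 1)) /
    ((1 - t ^ (j + 1)) * (1 - y * t ^ (j + 1)) * (1 - y * t ^ (2 * j + 2)))

/-- This and `nullCoeff_watson_right` write the summands of orders M and t²M as quadratics in t^i
times one common weight, so that linear combinations of them can be telescoped. -/
theorem nullCoeff_watson_left {t y M : ℂ} (ht : t ≠ 0) (hM : M ≠ 0) (i : ℕ) :
    nullCoeff t y M i * ((1 - 1 / (t ^ 2 * M)) * (1 - 1 / (t * M))) =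
      (∏ j ∈ range i, watsonRatio t y M j) *
        ((1 - t ^ i / (t ^ 2 * M)) * (1 - t ^ i / (t * M))) := by
  induction i with
  | zero => simp [nullCoeff]
  | succ i ih =>
    rw [nullCoeff_succ, mul_right_comm, ih, Finset.prod_range_succ]
    have e1 : t ^ (i + 1) / (t ^ 2 * M) = t ^ i / (t * M) := by field_simp; ring
    have e2 : t ^ (i + 1) / (t * M) = t ^ i / M := by field_simp; ring
    rw [e1, e2]
    simp only [nullRatio, watsonRatio, div_eq_mul_inv]
    ring

theorem nullCoeff_watson_right (t y M : ℂ) (i : ℕ) :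
    nullCoeff t y (t ^ 2 * M) i * ((1 - y * (t * M)) * (1 - y * (t ^ 2 * M))) =
      (∏ j ∈ range i, watsonRatio t y M j) *
        ((1 - y * (t * M) * t ^ i) * (1 - y * (t ^ 2 * M) * t ^ i)) := by
  induction i with
  | zero => simp [nullCoeff]
  | succ i ih =>
    rw [nullCoeff_succ, mul_right_comm, ih, Finset.prod_range_succ]
    simp only [nullRatio, watsonRatio, div_eq_mul_inv]
    ring

/-- The telescoping certificate for the contiguity relation, with W = t M and T = t^i: the right
side is the difference of two consecutive boundary terms after removal of the common weight. -/
theorem watson_contiguous_identity {t y W T a k h : ℂ} (ht : t ≠ 0) (hW : W ≠ 0) (hT : T ≠ 0)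
    (h1 : 1 - y * W ≠ 0) (h2 : 1 - y * (t * W) ≠ 0)
    (ha : a = (1 - 1 / (t * W)) * (1 - 1 / W) / ((1 - y * W) * (1 - y * (t * W))))
    (hk : k = y * t * (1 - W) ^ 2 / (1 - y * (t * W)) ^ 2)
    (hh : h = -((1 - W) * (1 - y * t * W ^ 2)) / (W * (1 - y * W) * (1 - y * (t * W)) ^ 2)) :
    a * ((1 - y * W * T) * (1 - y * (t * W) * T)) - k * ((1 - T / (t * W)) * (1 - T / W))
      = h / T * ((1 - T / (t * W)) * (1 - y * W * T) * (1 - y * t * T ^ 2)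
        - (1 - T) * (1 - y * T) * (1 - y * T ^ 2)) := by
  subst ha hk hh
  generalize hd1 : 1 - y * W = d1 at *
  generalize hd2 : 1 - y * (t * W) = d2 at *
  field_simp
  subst hd1 hd2
  ring

theorem watson_contiguous {t y M : ℂ} (ht : t ≠ 0) (hM : M ≠ 0)
    (h1 : 1 - y * (t * M) ≠ 0) (h2 : 1 - y * (t ^ 2 * M) ≠ 0) (K : ℕ)
    (htj : ∀ j < K, 1 - t ^ (j + 1) ≠ 0) (hy1 : ∀ j < K, 1 - y * t ^ (j + 1) ≠ 0)
    (hy2 : ∀ j < K, 1 - y * t ^ (2 * j + 2) ≠ 0) :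
    (1 - 1 / (t ^ 2 * M)) * (1 - 1 / (t * M)) * ∑ i ∈ range K, (nullCoeff t y (t ^ 2 * M) i
      - y * t * (1 - t * M) ^ 2 / (1 - y * (t ^ 2 * M)) ^ 2 * nullCoeff t y M i) =
    -((1 - t * M) * (1 - y * t * (t * M) ^ 2)) /
        (t * M * (1 - y * (t * M)) * (1 - y * (t ^ 2 * M)) ^ 2) / t ^ K *
      (∏ j ∈ range K, watsonRatio t y M j) *
        ((1 - t ^ K) * (1 - y * t ^ K) * (1 - y * t ^ (2 * K))) := by
  induction K with
  | zero => simp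
  | succ K ih =>
    rw [Finset.sum_range_succ, mul_add, ih (fun j hj => htj j (by omega))
      (fun j hj => hy1 j (by omega)) (fun j hj => hy2 j (by omega)), Finset.prod_range_succ]
    have hl := nullCoeff_watson_left (y := y) ht hM K
    have hr := nullCoeff_watson_right t y M K
    set U := ∏ j ∈ range K, watsonRatio t y M j
    have hid := watson_contiguous_identity (t := t) (y := y) (W := t * M) (T := t ^ K) ht
      (mul_ne_zero ht hM) (pow_ne_zero K ht) h1 (by rwa [← mul_assoc t t M, ← sq]) rfl rfl rfl
    have e : t * (t * M) = t ^ 2 * M := by ring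
    rw [e] at hid
    set k := y * t * (1 - t * M) ^ 2 / (1 - y * (t ^ 2 * M)) ^ 2
    set h := -((1 - t * M) * (1 - y * t * (t * M) ^ 2)) /
        (t * M * (1 - y * (t * M)) * (1 - y * (t ^ 2 * M)) ^ 2)
    have hr' : nullCoeff t y (t ^ 2 * M) K = U * ((1 - y * (t * M) * t ^ K) *
        (1 - y * (t ^ 2 * M) * t ^ K)) / ((1 - y * (t * M)) * (1 - y * (t ^ 2 * M))) := by
      rw [eq_div_iff (mul_ne_zero h1 h2)]
      exact hr
    have hstep : h / t ^ (K + 1) * (U * watsonRatio t y M K) *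
        ((1 - t ^ (K + 1)) * (1 - y * t ^ (K + 1)) * (1 - y * t ^ (2 * (K + 1)))) =
        h / t ^ K * U * ((1 - t ^ K / (t ^ 2 * M)) * (1 - y * (t * M) * t ^ K)
          * (1 - y * t ^ (2 * K + 1))) := by
      have a1 := htj K (by omega)
      have a2 := hy1 K (by omega)
      have a3 := hy2 K (by omega)
      rw [watsonRatio, show 2 * (K + 1) = 2 * K + 2 by ring]
      generalize 1 - t ^ (K + 1) = d1 at *
      generalize 1 - y * t ^ (K + 1) = d2 at *
      generalize 1 - y * t ^ (2 * K + 2) = d3 at *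
      generalize 1 - t ^ K / (t ^ 2 * M) = w1
      generalize 1 - y * (t * M) * t ^ K = w2
      generalize 1 - y * t ^ (2 * K + 1) = w3
      rw [pow_succ]
      have := pow_ne_zero K ht
      field_simp
    rw [hstep, mul_sub, hr']
    have e3 : t ^ (2 * K) = (t ^ K) ^ 2 := by ring
    have e4 : t ^ (2 * K + 1) = t * (t ^ K) ^ 2 := by ring
    rw [e3, e4]
    linear_combination U * hid - k * hl

/-- Induction on the order in steps of two. Order one has just the terms 1 and -1, and contiguity
makes the sum of order m + 2 a multiple of that of order m. -/
theorem watson_odd {t y : ℂ} (ht : t ≠ 0) (ht1 : ∀ j, 1 - t ^ (j + 1) ≠ 0) (l : ℕ)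
    (hy : ∀ e, 1 ≤ e → e ≤ 4 * l + 4 → 1 - y * t ^ e ≠ 0) (K : ℕ) (hK : 2 * l + 2 ≤ K) :
    ∑ i ∈ range K, nullCoeff t y (t ^ (2 * l + 1)) i = 0 := by
  have hext : ∀ (m K : ℕ), m + 1 ≤ K → ∑ i ∈ range K, nullCoeff t y (t ^ m) i
      = ∑ i ∈ range (m + 1), nullCoeff t y (t ^ m) i := by
    intro m K hK
    symm
    apply Finset.sum_subset (Finset.range_mono hK)
    intro i _ hi
    exact nullCoeff_eq_zero ht (by simpa using hi)
  rw [hext _ _ (by omega)]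
  clear hK K
  induction l with
  | zero =>
    have a1 := hy 1 (by norm_num) (by norm_num)
    have a2 := hy 2 (by norm_num) (by norm_num)
    have a3 := ht1 0
    have h : nullRatio t y t 0 = -1 := by
      simp only [nullRatio, mul_zero, zero_add, pow_zero, pow_one] at *
      rw [div_eq_iff (mul_ne_zero (mul_ne_zero a3 a1) a2)]
      field_simp
      ring
    simp [Finset.sum_range_succ, nullCoeff, h]
  | succ l ih =>
    have ih := ih (fun e h1 h2 => hy e h1 (by omega))
    have hM := pow_ne_zero (2 * l + 1) ht
    have key := watson_contiguous (y := y) ht hM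
      (by rw [← pow_succ']; exact hy _ (by omega) (by omega))
      (by rw [← pow_add]; exact hy _ (by omega) (by omega)) (2 * l + 4)
      (fun j _ => ht1 j) (fun j hj => hy _ (by omega) (by omega))
      (fun j hj => hy _ (by omega) (by omega))
    -- The boundary term disappears: the factor j = 2l + 3 contains 1 - t^j/(t²M) = 0.
    have hU : ∏ j ∈ range (2 * l + 4), watsonRatio t y (t ^ (2 * l + 1)) j = 0 := by
      apply Finset.prod_eq_zero (Finset.mem_range.mpr (show 2 * l + 3 < 2 * l + 4 by omega))
      rw [watsonRatio, ← pow_add, show 2 + (2 * l + 1) = 2 * l + 3 by ring,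
        div_self (pow_ne_zero _ ht)]
      simp
    have hne : ∀ j, 1 - 1 / t ^ (j + 1) ≠ 0 := by
      intro j h
      apply ht1 j
      have := pow_ne_zero (j + 1) ht
      field_simp at h
      linear_combination -h
    rw [hU, mul_zero, zero_mul, Finset.sum_sub_distrib, ← Finset.mul_sum,
      hext _ _ (by omega : 2 * l + 1 + 1 ≤ 2 * l + 4), ih, mul_zero, sub_zero, ← pow_succ',
      ← pow_add, show 2 + (2 * l + 1) = 2 * (l + 1) + 1 by ring] at key
    exact (mul_eq_zero.mp key).resolve_left (mul_ne_zero (hne _) (hne _))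

/-! ### The null vector of the pencil. -/

/-- The row `(z, c t ^ i)` of the matrix pencil, `κ` being the pencil parameter. -/
noncomputable def pencilRow (t c κ z : ℂ) (i : ℕ) : ℂ :=
  (z - c * t ^ i) * ((1 - t) * (1 - z / c) * (1 - t ^ i)
      / ((1 - z * (c * t ^ i)) * (1 - t * z * (c * t ^ i)))
    + κ / (1 - t * z * (c * t ^ i)))

/-- The boundary term of the telescoping sum for `pencilRow`. -/
noncomputable def pencilBoundary (t c M z : ℂ) (i : ℕ) : ℂ :=
  -(nullCoeff t (c ^ 2) M i * (1 - t ^ i) * (1 - (c * t ^ i) ^ 2) / (c * t ^ i) *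
    (1 - 1 / (c ^ 2 * t ^ i))) / (1 - z * (c * t ^ i))

/-- The value at infinity of `pencilRow` times the null vector. -/
noncomputable def pencilConst (t c M κ : ℂ) (i : ℕ) : ℂ :=
  -(nullCoeff t (c ^ 2) M i * ((1 - t) * (1 - t ^ i) / (c * t * (c * t ^ i) ^ 2)
    + κ / (t * (c * t ^ i))))

/-- One telescoping step, with T = t^i. The alternative T = 1 in `hz0` matters because 1 - z c may
vanish (c² = 1 is not excluded); for i = 0 every term with that denominator carries the factor 1 -
T. -/
theorem pencil_identity {t c M T z κ v : ℂ} (ht : t ≠ 0) (hc : c ≠ 0) (hM : M ≠ 0) (hT : T ≠ 0)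
    (hκ : κ = (1 - M) * (t - 1 / (c ^ 2 * M)))
    (h1 : 1 - t ^ 1 * T ≠ 0) (h2 : 1 - c ^ 2 * (t * T) ≠ 0) (h3 : 1 - c ^ 2 * (t ^ 2 * T ^ 2) ≠ 0)
    (hz0 : 1 - z * (c * T) ≠ 0 ∨ T = 1)
    (hz : 1 - t * z * (c * T) ≠ 0) :
    v * ((z - c * T) * ((1 - t) * (1 - z / c) * (1 - T)
      / ((1 - z * (c * T)) * (1 - t * z * (c * T))) + κ / (1 - t * z * (c * T)))) =
    -(v * (t * (1 - T / M) * (1 - c ^ 2 * M * (t * T)) * (1 - c ^ 2 * (t * T ^ 2)) /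
      ((1 - t * T) * (1 - c ^ 2 * (t * T)) * (1 - c ^ 2 * (t ^ 2 * T ^ 2))))
      * (1 - t * T) * (1 - (c * (t * T)) ^ 2) / (c * (t * T)) *
      (1 - 1 / (c ^ 2 * (t * T)))) / (1 - z * (c * (t * T)))
    - -(v * (1 - T) * (1 - (c * T) ^ 2) / (c * T) * (1 - 1 / (c ^ 2 * T))) / (1 - z * (c * T))
    + -(v * ((1 - t) * (1 - T) / (c * t * (c * T) ^ 2) + κ / (t * (c * T)))) := by
  have e1 : v * (t * (1 - T / M) * (1 - c ^ 2 * M * (t * T)) * (1 - c ^ 2 * (t * T ^ 2)) /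
      ((1 - t * T) * (1 - c ^ 2 * (t * T)) * (1 - c ^ 2 * (t ^ 2 * T ^ 2))))
      * (1 - t * T) * (1 - (c * (t * T)) ^ 2) / (c * (t * T)) *
      (1 - 1 / (c ^ 2 * (t * T))) =
      - (v * (t * (1 - T / M) * (1 - c ^ 2 * M * (t * T)) * (1 - c ^ 2 * (t * T ^ 2)))
        / (c * (t * T)) / (c ^ 2 * (t * T))) := by
    have e : (1 - (c * (t * T)) ^ 2) = 1 - c ^ 2 * (t ^ 2 * T ^ 2) := by ring
    have e' : (1 - 1 / (c ^ 2 * (t * T))) = - (1 - c ^ 2 * (t * T)) / (c ^ 2 * (t * T)) := by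
      field_simp
      ring
    rw [e, e']
    rw [pow_one] at h1
    generalize 1 - t * T = d1 at *
    generalize 1 - c ^ 2 * (t * T) = d2 at *
    generalize 1 - c ^ 2 * (t ^ 2 * T ^ 2) = d3 at *
    field_simp
  rw [e1]
  have e2 : 1 - z * (c * (t * T)) = 1 - t * z * (c * T) := by ring
  rw [e2]
  clear e1 e2 h1 h2 h3
  subst hκ
  rcases hz0 with hz0 | rfl
  · generalize hd1 : 1 - t * z * (c * T) = d1 at *
    generalize hd2 : 1 - z * (c * T) = d2 at *
    field_simp
    subst hd1 hd2
    ring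
  · generalize hd1 : 1 - t * z * (c * 1) = d1 at *
    simp only [sub_self, mul_zero, zero_mul, zero_div, neg_zero, sub_zero, zero_add]
    field_simp
    subst hd1
    ring

/-- Partial fractions in z: entry i has poles at 1/(c t^i) and 1/(c t^{i+1}), and the coefficients
are such that residues of neighbouring entries cancel. What survives is the last pole and the values
at z = ∞. -/
theorem pencil_telescope {t c M κ z : ℂ} (ht : t ≠ 0) (hc : c ≠ 0) (hM : M ≠ 0)
    (hκ : κ = (1 - M) * (t - 1 / (c ^ 2 * M))) (ht1 : ∀ j, 1 - t ^ (j + 1) ≠ 0) (K : ℕ)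
    (h2 : ∀ j < K, 1 - c ^ 2 * t ^ (j + 1) ≠ 0) (h3 : ∀ j < K, 1 - c ^ 2 * t ^ (2 * j + 2) ≠ 0)
    (hz : ∀ j < K, 1 - z * (c * t ^ (j + 1)) ≠ 0) :
    ∑ i ∈ range K, nullCoeff t (c ^ 2) M i * pencilRow t c κ z i
      = pencilBoundary t c M z K + ∑ i ∈ range K, pencilConst t c M κ i := by
  induction K with
  | zero => simp [pencilBoundary]
  | succ K ih =>
    rw [Finset.sum_range_succ, Finset.sum_range_succ, ih (fun j hj => h2 j (by omega))
      (fun j hj => h3 j (by omega)) (fun j hj => hz j (by omega))]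
    have a1 := ht1 K
    have a2 := h2 K (by omega)
    have a3 := h3 K (by omega)
    have a4 := hz K (by omega)
    have e1 : t ^ (K + 1) = t * t ^ K := pow_succ' _ _
    have e2 : t ^ (2 * K + 2) = t ^ 2 * (t ^ K) ^ 2 := by ring
    have e3 : t ^ (2 * K + 1) = t * (t ^ K) ^ 2 := by ring
    rw [e1] at a1 a2 a4
    rw [e2] at a3
    have hid := pencil_identity (v := nullCoeff t (c ^ 2) M K) (z := z) ht hc hM (pow_ne_zero K ht)
      hκ (by rwa [pow_one]) a2 a3 ?_ ?_
    · simp only [pencilRow, pencilBoundary, pencilConst, nullCoeff_succ, nullRatio, e1, e2, e3]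
      linear_combination hid
    · rcases Nat.eq_zero_or_pos K with rfl | hK
      · right; simp
      · left
        have := hz (K - 1) (by omega)
        rwa [Nat.sub_add_cancel hK] at this
    · convert a4 using 2
      ring

/-- Dropping the term i = 0 and shifting the index replaces y by y t² and lowers the even order 2l +
2 to the odd order 2l + 1, termwise. -/
theorem nullCoeff_shift {t y : ℂ} {l : ℕ} (ht : t ≠ 0) (ht1 : ∀ j, 1 - t ^ (j + 1) ≠ 0) (i : ℕ)
    (hy : ∀ j < i + 2, 1 - y * t ^ (j + 1) ≠ 0) :
    nullCoeff t y (t ^ (2 * l + 2)) (i + 1) * (1 - t ^ (i + 1)) / (1 - y * t ^ (i + 2))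
      = nullRatio t y (t ^ (2 * l + 2)) 0 * (1 - t) / (1 - y * t ^ 2) *
        nullCoeff t (y * t ^ 2) (t ^ (2 * l + 1)) i := by
  induction i with
  | zero => simp [nullCoeff]
  | succ i ih =>
    have ih := ih (fun j hj => hy j (by omega))
    rw [nullCoeff_succ t (y * t ^ 2), ← mul_assoc, ← ih, nullCoeff_succ _ _ _ (i + 1)]
    have a1 := hy (i + 1) (by omega)
    have a2 := hy (i + 2) (by omega)
    have a3 := ht1 (i + 1)
    have a4 := ht1 i
    have e1 : t ^ (i + 1) / t ^ (2 * l + 2) = t ^ i / t ^ (2 * l + 1) := by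
      field_simp
      ring
    simp only [nullRatio, e1]
    have e2 : y * t ^ (2 * l + 2) * t ^ (i + 1 + 1) = y * t ^ 2 * t ^ (2 * l + 1) * t ^ (i + 1) := by
      ring
    have e3 : y * t ^ (2 * (i + 1) + 1) = y * t ^ 2 * t ^ (2 * i + 1) := by ring
    have e4 : y * t ^ (2 * (i + 1) + 2) = y * t ^ 2 * t ^ (2 * i + 2) := by ring
    have e5 : y * t ^ 2 * t ^ (i + 1) = y * t ^ (i + 2 + 1) := by ring
    rw [e2, e3, e4, e5, show i + 1 + 2 = i + 2 + 1 by ring]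
    rw [show i + 1 + 1 = i + 2 by ring] at *
    generalize 1 - y * t ^ (i + 2) = d1 at *
    generalize 1 - y * t ^ (i + 2 + 1) = d2 at *
    generalize 1 - t ^ (i + 2) = d3 at *
    generalize 1 - t ^ (i + 1) = d4 at *
    generalize 1 - y * t ^ 2 * t ^ (2 * i + 2) = d5 at *
    simp only [div_eq_mul_inv, mul_inv]
    have b1 : d1 * d1⁻¹ = 1 := mul_inv_cancel₀ a1
    field_simp

/-- The coefficients terminate, so the boundary term is zero and the sum is independent of z. At z =
c the factor 1 - z/c removes everything but the κ part, which is a Watson sum of odd order. -/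
theorem pencil_null {t c z : ℂ} (ht : t ≠ 0) (hc : c ≠ 0) (ht1 : ∀ j, 1 - t ^ (j + 1) ≠ 0) (l : ℕ)
    (hy : ∀ e, 1 ≤ e → e ≤ 4 * l + 2 → 1 - c ^ 2 * t ^ e ≠ 0)
    (hz : ∀ j ≤ 2 * l, 1 - z * (c * t ^ (j + 1)) ≠ 0) :
    ∑ i ∈ range (2 * l + 1), nullCoeff t (c ^ 2) (t ^ (2 * l)) i *
      pencilRow t c ((1 - t ^ (2 * l)) * (t - 1 / (c ^ 2 * t ^ (2 * l)))) z i = 0 := by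
  set κ := (1 - t ^ (2 * l)) * (t - 1 / (c ^ 2 * t ^ (2 * l))) with hκ
  have hM := pow_ne_zero (2 * l) ht
  have hb : ∀ z, pencilBoundary t c (t ^ (2 * l)) z (2 * l + 1) = 0 := by
    intro z
    rw [pencilBoundary, nullCoeff_eq_zero ht (by omega)]
    simp
  have h2 : ∀ j < 2 * l + 1, 1 - c ^ 2 * t ^ (j + 1) ≠ 0 := fun j hj => hy _ (by omega) (by omega)
  have h3 : ∀ j < 2 * l + 1, 1 - c ^ 2 * t ^ (2 * j + 2) ≠ 0 :=
    fun j hj => hy _ (by omega) (by omega)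
  have hy' : ∀ j, 1 - c * (c * t ^ j) = 1 - c ^ 2 * t ^ j := fun j => by ring
  rw [pencil_telescope ht hc hM hκ ht1 _ h2 h3 (fun j hj => hz j (by omega)), hb, zero_add]
  have hC := pencil_telescope (z := c) ht hc hM hκ ht1 _ h2 h3
    (fun j hj => by rw [hy']; exact hy _ (by omega) (by omega))
  rw [hb, zero_add] at hC
  rw [← hC]
  have hrow : ∀ i, nullCoeff t (c ^ 2) (t ^ (2 * l)) i * pencilRow t c κ c i = κ * c *
      (nullCoeff t (c ^ 2) (t ^ (2 * l)) i * (1 - t ^ i) / (1 - c ^ 2 * t ^ (i + 1))) := by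
    intro i
    rw [pencilRow, div_self hc, sub_self, mul_zero, zero_mul, zero_div, zero_add,
      show 1 - t * c * (c * t ^ i) = 1 - c ^ 2 * t ^ (i + 1) by ring]
    ring
  simp only [hrow]
  rw [← Finset.mul_sum]
  cases l with
  | zero => simp
  | succ l =>
    convert mul_zero _
    rw [show 2 * (l + 1) + 1 = 2 * l + 2 + 1 by ring, Finset.sum_range_succ']
    simp only [pow_zero, sub_self, mul_zero, zero_div, add_zero, show 2 * (l + 1) = 2 * l + 2 by ring]
    have hs := watson_odd (y := c ^ 2 * t ^ 2) ht ht1 l (fun e h1 h2 => by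
      rw [mul_assoc, ← pow_add]; exact hy _ (by omega) (by omega)) (2 * l + 2) le_rfl
    rw [← mul_zero (nullRatio t (c ^ 2) (t ^ (2 * l + 2)) 0 * (1 - t) / (1 - c ^ 2 * t ^ 2)), ← hs,
      Finset.mul_sum]
    refine Finset.sum_congr rfl fun i hi => ?_
    rw [Finset.mem_range] at hi
    exact nullCoeff_shift ht ht1 i (fun j hj => hy _ (by omega) (by omega))

/-! ### The Pfaffian as a polynomial in the pencil parameter. -/

theorem exists_polynomial_pfaffian {n : ℕ} (A B : Matrix (Fin (2 * n)) (Fin (2 * n)) ℂ) :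
    ∃ p : Polynomial ℂ, p.natDegree ≤ n ∧ p.coeff n = pfaffian B ∧
      ∀ κ, p.eval κ = pfaffian (Matrix.of fun i j => A i j + κ * B i j) := by
  have hlin : ∀ i j, (Polynomial.C (A i j) + Polynomial.X * Polynomial.C (B i j)).natDegree ≤ 1 := by
    intro i j
    compute_degree
  have hprod : ∀ σ : Equiv.Perm (Fin (2 * n)),
      (∏ k : Fin n, (Polynomial.C (A (σ (pairEquiv n (k, 0))) (σ (pairEquiv n (k, 1)))) +
        Polynomial.X * Polynomial.C (B (σ (pairEquiv n (k, 0))) (σ (pairEquiv n (k, 1)))))).natDegree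
        ≤ n := by
    intro σ
    refine (Polynomial.natDegree_prod_le _ _).trans ?_
    refine (Finset.sum_le_card_nsmul _ _ 1 fun k _ => hlin _ _).trans ?_
    simp
  refine ⟨Polynomial.C (1 / ((2 : ℂ) ^ n * (Nat.factorial n : ℂ))) *
    ∑ σ : Equiv.Perm (Fin (2 * n)), Polynomial.C (((Equiv.Perm.sign σ : ℤ) : ℂ)) *
      ∏ k : Fin n, (Polynomial.C (A (σ (pairEquiv n (k, 0))) (σ (pairEquiv n (k, 1)))) +
        Polynomial.X * Polynomial.C (B (σ (pairEquiv n (k, 0))) (σ (pairEquiv n (k, 1))))),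
    ?_, ?_, ?_⟩
  · refine (Polynomial.natDegree_C_mul_le _ _).trans ?_
    refine Polynomial.natDegree_sum_le_of_forall_le _ _ fun σ _ => ?_
    exact (Polynomial.natDegree_C_mul_le _ _).trans (hprod σ)
  · rw [pfaffian_eq_sum, Polynomial.coeff_C_mul, Polynomial.finsetSum_coeff]
    congr 1
    refine Finset.sum_congr rfl fun σ _ => ?_
    rw [Polynomial.coeff_C_mul]
    congr 1
    have := Polynomial.coeff_prod_of_natDegree_le (Finset.univ : Finset (Fin n))
      (fun k => Polynomial.C (A (σ (pairEquiv n (k, 0))) (σ (pairEquiv n (k, 1)))) +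
        Polynomial.X * Polynomial.C (B (σ (pairEquiv n (k, 0))) (σ (pairEquiv n (k, 1)))))
      1 (fun k _ => hlin _ _)
    rw [Finset.card_univ, Fintype.card_fin, mul_one] at this
    rw [this]
    refine Finset.prod_congr rfl fun k _ => ?_
    simp
  · intro κ
    rw [pfaffian_eq_sum]
    simp [Polynomial.eval_finsetSum, Polynomial.eval_prod, mul_comm κ]

theorem pfaffian_pencil_eq_prod {n : ℕ} (A B : Matrix (Fin (2 * n)) (Fin (2 * n)) ℂ)
    (r : ℕ → ℂ) (hr : Set.InjOn r (range n))
    (h : ∀ l < n, pfaffian (Matrix.of fun i j => A i j + r l * B i j) = 0) (κ : ℂ) :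
    pfaffian (Matrix.of fun i j => A i j + κ * B i j)
      = pfaffian B * ∏ l ∈ range n, (κ - r l) := by
  obtain ⟨p, hdeg, hcoeff, heval⟩ := exists_polynomial_pfaffian A B
  set q : Polynomial ℂ := ∏ l ∈ range n, (Polynomial.X - Polynomial.C (r l)) with hq
  have hqm : q.Monic := Polynomial.monic_prod_of_monic _ _ fun l _ => Polynomial.monic_X_sub_C _
  have hqd : q.natDegree = n := by
    rw [hq, Polynomial.natDegree_prod_of_monic _ _ fun l _ => Polynomial.monic_X_sub_C _]
    simp
  have hpq : p = Polynomial.C (pfaffian B) * q := by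
    apply Polynomial.eq_of_degree_sub_lt_of_eval_finset_eq ((range n).image r)
    · rw [Finset.card_image_of_injOn hr, Finset.card_range, Polynomial.degree_lt_iff_coeff_zero]
      intro m hm
      rw [Polynomial.coeff_sub, Polynomial.coeff_C_mul]
      rcases hm.eq_or_lt with rfl | hm
      · have : q.coeff n = 1 := by
          rw [← hqd]; exact hqm
        rw [hcoeff, this, mul_one, sub_self]
      · rw [Polynomial.coeff_eq_zero_of_natDegree_lt (hdeg.trans_lt hm),
          Polynomial.coeff_eq_zero_of_natDegree_lt (hqd.trans_lt hm)]
        simp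
    · intro x hx
      obtain ⟨l, hl, rfl⟩ := Finset.mem_image.mp hx
      rw [heval, h l (Finset.mem_range.mp hl), Polynomial.eval_mul, hq, Polynomial.eval_prod,
        Finset.prod_eq_zero hl (by simp), mul_zero]
  rw [← heval, hpq, Polynomial.eval_mul, hq, Polynomial.eval_prod]
  simp

theorem pencilRow_antisymm {t c : ℂ} (hc : c ≠ 0) (κ : ℂ) (a b : ℕ) :
    pencilRow t c κ (c * t ^ b) a = - pencilRow t c κ (c * t ^ a) b := by
  have e1 : c * t ^ a / c = t ^ a := by field_simp
  have e2 : c * t ^ b / c = t ^ b := by field_simp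
  rw [pencilRow, pencilRow, e1, e2, mul_comm (c * t ^ a) (c * t ^ b),
    mul_right_comm t (c * t ^ a) (c * t ^ b)]
  ring

theorem sum_fin_rev_eq_sum_range (N : ℕ) (f : ℕ → ℂ) :
    ∑ j : Fin N, f (N - 1 - (j : ℕ)) = ∑ i ∈ range N, f i := by
  rw [Finset.sum_range, ← Equiv.sum_comp Fin.revPerm]
  refine Finset.sum_congr rfl fun j _ => ?_
  congr 1
  simp
  omega

theorem pfaffian_pencilRow {n : ℕ} {t c : ℂ} (ht : t ≠ 0) (hc : c ≠ 0)
    (hinj : Function.Injective fun j : ℕ => t ^ j)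
    (hy : ∀ e, 1 ≤ e → e ≤ 4 * n - 2 → 1 - c ^ 2 * t ^ e ≠ 0) (κ : ℂ) :
    pfaffian (Matrix.of fun i j : Fin (2 * n) =>
      pencilRow t c κ (c * t ^ (2 * n - 1 - (i : ℕ))) (2 * n - 1 - (j : ℕ)))
    = pfaffian (Matrix.of fun i j : Fin (2 * n) =>
        (c * t ^ (2 * n - 1 - (i : ℕ)) - c * t ^ (2 * n - 1 - (j : ℕ))) /
          (1 - t * (c * t ^ (2 * n - 1 - (i : ℕ))) * (c * t ^ (2 * n - 1 - (j : ℕ))))) *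
      ∏ l ∈ range n, (κ - (1 - t ^ (2 * l)) * (t - 1 / (c ^ 2 * t ^ (2 * l)))) := by
  have ht1 : ∀ j, 1 - t ^ (j + 1) ≠ 0 := by
    intro j h
    have : t ^ (j + 1) = t ^ 0 := by rw [pow_zero]; linear_combination -h
    exact absurd (hinj this) (by omega)
  have hlin : ∀ κ, (Matrix.of fun i j : Fin (2 * n) =>
      pencilRow t c κ (c * t ^ (2 * n - 1 - (i : ℕ))) (2 * n - 1 - (j : ℕ)))
      = Matrix.of fun i j : Fin (2 * n) => (Matrix.of fun i j : Fin (2 * n) =>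
        pencilRow t c 0 (c * t ^ (2 * n - 1 - (i : ℕ))) (2 * n - 1 - (j : ℕ))) i j +
        κ * (Matrix.of fun i j : Fin (2 * n) =>
        (c * t ^ (2 * n - 1 - (i : ℕ)) - c * t ^ (2 * n - 1 - (j : ℕ))) /
          (1 - t * (c * t ^ (2 * n - 1 - (i : ℕ))) * (c * t ^ (2 * n - 1 - (j : ℕ))))) i j := by
    intro κ
    ext i j
    simp only [Matrix.of_apply, pencilRow]
    ring
  rw [hlin]
  apply pfaffian_pencil_eq_prod (Matrix.of fun i j : Fin (2 * n) =>
        pencilRow t c 0 (c * t ^ (2 * n - 1 - (i : ℕ))) (2 * n - 1 - (j : ℕ))) _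
    (fun l => (1 - t ^ (2 * l)) * (t - 1 / (c ^ 2 * t ^ (2 * l))))
  · intro i hi j hj hij
    have hi' : i < n := by simpa using hi
    have hj' : j < n := by simpa using hj
    by_contra hne
    have hg := pow_ne_zero (2 * i) ht
    have hh := pow_ne_zero (2 * j) ht
    have h1 : t ^ (2 * j) - t ^ (2 * i) ≠ 0 := by
      rw [sub_ne_zero]
      intro h
      exact hne (by have := hinj h; omega)
    have h2 : 1 - c ^ 2 * t ^ (2 * i + 2 * j + 1) ≠ 0 := hy _ (by omega) (by omega)
    -- Up to the nonzero factor c² t^{2i+2j}, this product is the difference of the roots r_i and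
    -- r_j, so the roots are distinct.
    apply mul_ne_zero h1 h2
    have e : t ^ (2 * i + 2 * j + 1) = t ^ (2 * i) * t ^ (2 * j) * t := by ring
    rw [e]
    simp only at hij
    generalize t ^ (2 * i) = g at *
    generalize t ^ (2 * j) = h at *
    have : (h - g) * (1 - c ^ 2 * (g * h * t)) = -(c ^ 2 * g * h) *
        ((1 - g) * (t - 1 / (c ^ 2 * g)) - (1 - h) * (t - 1 / (c ^ 2 * h))) := by
      field_simp
      ring
    rw [this, hij, sub_self, mul_zero]
  · intro l hl
    rw [← hlin]
    apply pfaffian_eq_zero_of_mulVec _ _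
      (fun j => nullCoeff t (c ^ 2) (t ^ (2 * l)) (2 * n - 1 - (j : ℕ)))
    · intro h
      -- The indices run backwards, so the last entry is `nullCoeff` at 0, the empty product 1.
      have := congrFun h ⟨2 * n - 1, by omega⟩
      simp [nullCoeff] at this
    · ext i
      simp only [Matrix.mulVec, dotProduct, Matrix.of_apply, Pi.zero_apply]
      rw [sum_fin_rev_eq_sum_range (2 * n) (fun j => pencilRow t c _ _ j *
        nullCoeff t (c ^ 2) (t ^ (2 * l)) j)]
      have := pencil_null (z := c * t ^ (2 * n - 1 - (i : ℕ))) ht hc ht1 l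
        (fun e h1 h2 => hy e h1 (by omega)) (fun j hj => by
          rw [show c * t ^ (2 * n - 1 - (i : ℕ)) * (c * t ^ (j + 1))
            = c ^ 2 * t ^ (2 * n - 1 - (i : ℕ) + (j + 1)) by ring]
          exact hy _ (by omega) (by omega))
      rw [← this]
      symm
      simp only [mul_comm (nullCoeff _ _ _ _)]
      apply Finset.sum_subset (Finset.range_mono (by omega))
      intro j _ hj
      rw [nullCoeff_eq_zero ht (by simpa using hj), mul_zero]
    · ext i j
      simp only [Matrix.transpose_apply, Matrix.of_apply, Matrix.neg_apply]
      exact pencilRow_antisymm hc _ _ _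

/-! ### Evaluation of the specialized Pfaffian. -/

theorem prod_Icc_one_eq_prod_range (F : ℕ → ℂ) (n : ℕ) :
    ∏ j ∈ Icc 1 n, F j = ∏ l ∈ range n, F (l + 1) := by
  induction n with
  | zero => simp
  | succ n ih => rw [Finset.prod_Icc_succ_top (by omega), ih, Finset.prod_range_succ]

theorem prod_fin_rev_eq_prod_range (N : ℕ) (f : ℕ → ℂ) :
    ∏ j : Fin N, f (N - 1 - (j : ℕ)) = ∏ i ∈ range N, f i := by
  rw [Finset.prod_range, ← Equiv.prod_comp Fin.revPerm]
  refine Finset.prod_congr rfl fun j _ => ?_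
  congr 1
  simp
  omega

theorem prod_pairs_rev (G : ℕ → ℕ → ℂ) (N : ℕ) :
    ∏ i : Fin N, ∏ j ∈ Ioi i, G (N - 1 - (i : ℕ)) (N - 1 - (j : ℕ))
      = ∏ a ∈ range N, ∏ b ∈ range a, G a b := by
  induction N with
  | zero => simp
  | succ N ih =>
    rw [Fin.prod_univ_succ, Finset.prod_range_succ, ← ih, mul_comm]
    simp only [Fin.prod_Ioi_zero, Fin.prod_Ioi_succ, Fin.val_succ, Fin.val_zero]
    congr 1
    · refine Finset.prod_congr rfl fun i _ => Finset.prod_congr rfl fun j _ => ?_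
      congr 1 <;> omega
    · rw [← prod_fin_rev_eq_prod_range N (G N)]
      refine Finset.prod_congr rfl fun j _ => ?_
      congr 1
      omega

theorem specialization_eq (n : ℕ) (t γ s₀ : ℂ) (i : Fin (2 * n)) :
    specialization n t γ s₀ i = 1 / (γ * s₀) * t ^ (2 * n - 1 - (i : ℕ)) := by
  rw [specialization, show 2 * n - ((i : ℕ) + 1) = 2 * n - 1 - (i : ℕ) by omega]
  ring

/-- Here `X`, `Y`, `P` stand for t^{2n-i}, t^{2n-j}, t^{2n}, so that t^i = P/X and t^j = P/Y. -/
theorem entry_identity {t γ s X Y P : ℂ} (hγ : γ ≠ 0) (hs : s ≠ 0) (hP : P ≠ 0) (hX : X ≠ 0)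
    (hY : Y ≠ 0) (h1 : (γ * s) ^ 2 - X * Y ≠ 0) (h2 : (γ * s) ^ 2 - t * (X * Y) ≠ 0) :
    ((1 - t) * (1 - γ * s * (X / (γ * s))) * (1 - γ * s * (Y / (γ * s)))
    + (1 - γ) * (t - γ * s ^ 2) * (1 - X / (γ * s) * (Y / (γ * s)))) * (X / (γ * s) - Y / (γ * s)) /
      ((1 - X / (γ * s) * (Y / (γ * s))) * (1 - t * (X / (γ * s)) * (Y / (γ * s)))) =
    (P / Y - P / X) * (γ ^ 2 * s ^ 2 * (1 - t) * (P / X - P) * (P / Y - P)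
        + (1 - γ) * (t - s ^ 2 * γ) * (P / X * (P / Y) * γ ^ 2 * s ^ 2 - P ^ 2)) /
    (P ^ 3 / (X ^ 2 * Y ^ 2) * (γ * s)
      * (γ * s - X * Y / (γ * s))
      * (γ * s - t * (X * Y) / (γ * s))) := by
  have hσ : γ * s ≠ 0 := mul_ne_zero hγ hs
  have e1 : 1 - X / (γ * s) * (Y / (γ * s)) = ((γ * s) ^ 2 - X * Y) / (γ * s) ^ 2 := by
    field_simp
  have e2 : 1 - t * (X / (γ * s)) * (Y / (γ * s)) = ((γ * s) ^ 2 - t * (X * Y)) / (γ * s) ^ 2 := by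
    field_simp
  have e3 : γ * s - X * Y / (γ * s) = ((γ * s) ^ 2 - X * Y) / (γ * s) := by
    field_simp
  have e4 : γ * s - t * (X * Y) / (γ * s) = ((γ * s) ^ 2 - t * (X * Y)) / (γ * s) := by
    field_simp
  rw [e1, e2, e3, e4]
  generalize hd1 : (γ * s) ^ 2 - X * Y = d1 at *
  generalize hd2 : (γ * s) ^ 2 - t * (X * Y) = d2 at *
  field_simp
  subst hd1
  ring

theorem pfKernel_specialization_eq (n : ℕ) {t γ s₀ : ℂ} (ht : t ≠ 0) (hγ : γ ≠ 0) (hs : s₀ ≠ 0)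
    (hden : ∀ m ∈ Finset.Icc 1 (4 * n - 2), (γ * s₀) ^ 2 ≠ t ^ m) (i j : Fin (2 * n)) :
    pfKernel t γ s₀ (specialization n t γ s₀ i) (specialization n t γ s₀ j)
      = specializedEntry n t γ s₀ ((i : ℕ) + 1) ((j : ℕ) + 1) := by
  by_cases hij : i = j
  · subst hij
    simp [pfKernel, specializedEntry]
  have hij' : (i : ℕ) ≠ j := fun h => hij (Fin.ext h)
  have hi := i.isLt
  have hj := j.isLt
  rw [pfKernel, zTwo, specializedEntry]
  simp only [specialization]
  obtain ⟨a, ha⟩ : ∃ a, a = 2 * n - ((i : ℕ) + 1) := ⟨_, rfl⟩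
  obtain ⟨b, hb⟩ : ∃ b, b = 2 * n - ((j : ℕ) + 1) := ⟨_, rfl⟩
  rw [← ha, ← hb]
  have hX := pow_ne_zero a ht
  have hY := pow_ne_zero b ht
  have hP := pow_ne_zero (2 * n) ht
  have e1 : t ^ ((i : ℕ) + 1) = t ^ (2 * n) / t ^ a := by
    rw [eq_div_iff hX, ← pow_add]; congr 1; omega
  have e2 : t ^ ((j : ℕ) + 1) = t ^ (2 * n) / t ^ b := by
    rw [eq_div_iff hY, ← pow_add]; congr 1; omega
  have e3 : t ^ (4 * n - ((i : ℕ) + 1) - ((j : ℕ) + 1)) = t ^ a * t ^ b := by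
    rw [← pow_add]; congr 1; omega
  have e4 : t ^ (4 * n + 1 - ((i : ℕ) + 1) - ((j : ℕ) + 1)) = t * (t ^ a * t ^ b) := by
    rw [← pow_add, ← pow_succ']; congr 1; omega
  have e5 : t ^ (((i : ℕ) + 1) + ((j : ℕ) + 1)) = t ^ (2 * n) / t ^ a * (t ^ (2 * n) / t ^ b) := by
    rw [pow_add, e1, e2]
  have e6 : t ^ (2 * ((((i : ℕ) + 1 : ℕ)) : ℤ) + 2 * ((((j : ℕ) + 1 : ℕ)) : ℤ) - 2 * (n : ℤ))
      = (t ^ (2 * n)) ^ 3 / ((t ^ a) ^ 2 * (t ^ b) ^ 2) := by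
    rw [eq_div_iff (by positivity), ← pow_mul, ← pow_mul, ← pow_mul, ← pow_add, ← zpow_natCast,
      ← zpow_natCast, ← zpow_add₀ ht]
    congr 1
    push_cast
    omega
  have e7 : t ^ (4 * n) = (t ^ (2 * n)) ^ 2 := by rw [← pow_mul]; congr 1; ring
  rw [e1, e2, e3, e4, e5, e6, e7]
  apply entry_identity hγ hs hP hX hY
  · rw [sub_ne_zero, ← pow_add]
    exact hden _ (by rw [Finset.mem_Icc]; omega)
  · rw [sub_ne_zero, ← pow_add, ← pow_succ']
    exact hden _ (by rw [Finset.mem_Icc]; omega)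

theorem pfKernel_eq_pencilRow {t γ s₀ c z : ℂ} (hγ : γ ≠ 0) (hs : s₀ ≠ 0) (hc : c = 1 / (γ * s₀))
    (i : ℕ) (h : 1 - z * (c * t ^ i) ≠ 0 ∨ z = c * t ^ i) :
    pfKernel t γ s₀ z (c * t ^ i) = pencilRow t c ((1 - γ) * (t - γ * s₀ ^ 2)) z i := by
  rcases h with h | h
  · have e1 : z / c = γ * s₀ * z := by rw [hc]; field_simp
    have e2 : t ^ i = γ * s₀ * (c * t ^ i) := by rw [hc]; field_simp
    have e3 : 1 - t ^ i = 1 - γ * s₀ * (c * t ^ i) := by rw [← e2]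
    rw [pfKernel, pencilRow, zTwo, e1, e3]
    clear e1 e2 e3
    generalize c * t ^ i = w at *
    generalize hd2 : 1 - t * z * w = d2
    generalize hd1 : 1 - z * w = d1 at *
    by_cases h2 : d2 = 0
    · simp [h2]
    · field_simp
  · simp [pfKernel, pencilRow, h]

theorem pfaffian_specialization (n : ℕ) {t γ s₀ : ℂ} (ht : t ≠ 0) (hγ : γ ≠ 0) (hs : s₀ ≠ 0)
    (hinj : Function.Injective fun j : ℕ => t ^ j)
    (hden : ∀ m ∈ Finset.Icc 1 (4 * n - 2), (γ * s₀) ^ 2 ≠ t ^ m) :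
    pfaffian (Matrix.of fun i j : Fin (2 * n) =>
        pfKernel t γ s₀ (specialization n t γ s₀ i) (specialization n t γ s₀ j))
      = (-1) ^ n * γ ^ n * t ^ (n ^ 2) * vandermondeFactor n t γ s₀ *
          ∏ j ∈ Finset.Icc 1 n, ((1 - s₀ ^ 2 * γ * t ^ (-2 * (j : ℤ) + 1)) *
              (1 - γ⁻¹ * t ^ (2 * j - 2))) := by
  set c := 1 / (γ * s₀) with hc
  have hσ : γ * s₀ ≠ 0 := mul_ne_zero hγ hs
  have hc0 : c ≠ 0 := one_div_ne_zero hσ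
  have hy : ∀ e, 1 ≤ e → e ≤ 4 * n - 2 → 1 - c ^ 2 * t ^ e ≠ 0 := by
    intro e h1 h2 h
    apply hden e (Finset.mem_Icc.mpr ⟨h1, h2⟩)
    rw [hc] at h
    field_simp at h
    linear_combination h
  have hdiff : ∀ i j : Fin (2 * n), i ≠ j → (i : ℕ) ≠ j := fun i j h h' => h (Fin.ext h')
  have h1 : (Matrix.of fun i j : Fin (2 * n) =>
      pfKernel t γ s₀ (specialization n t γ s₀ i) (specialization n t γ s₀ j)) =
      Matrix.of fun i j : Fin (2 * n) => pencilRow t c ((1 - γ) * (t - γ * s₀ ^ 2))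
        (c * t ^ (2 * n - 1 - (i : ℕ))) (2 * n - 1 - (j : ℕ)) := by
    ext i j
    rw [Matrix.of_apply, Matrix.of_apply, specialization_eq, specialization_eq, ← hc]
    apply pfKernel_eq_pencilRow hγ hs hc
    by_cases hij : i = j
    · right; rw [hij]
    · left
      have := hdiff i j hij
      rw [show c * t ^ (2 * n - 1 - (i : ℕ)) * (c * t ^ (2 * n - 1 - (j : ℕ)))
        = c ^ 2 * t ^ (2 * n - 1 - (i : ℕ) + (2 * n - 1 - (j : ℕ))) by ring]
      exact hy _ (by omega) (by omega)
  rw [h1, pfaffian_pencilRow ht hc0 hinj hy, pfaffian_schur t n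
    (fun i => c * t ^ (2 * n - 1 - (i : ℕ)))]
  · rw [prod_pairs_rev (fun a b => (c * t ^ a - c * t ^ b) / (1 - t * (c * t ^ a) * (c * t ^ b)))]
    have hv : ∏ a ∈ range (2 * n), ∏ b ∈ range a,
        (c * t ^ a - c * t ^ b) / (1 - t * (c * t ^ a) * (c * t ^ b))
        = vandermondeFactor n t γ s₀ := by
      refine Finset.prod_congr rfl fun a _ => Finset.prod_congr rfl fun b _ => ?_
      have e1 : c * t ^ a - c * t ^ b = (t ^ a - t ^ b) / (γ * s₀) := by rw [hc]; ring
      have e2 : 1 - t * (c * t ^ a) * (c * t ^ b)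
          = (γ * s₀ - t ^ (b + a + 1) / (γ * s₀)) / (γ * s₀) := by
        rw [hc]; field_simp; ring
      rw [e1, e2, div_div_div_cancel_right₀ hσ]
    -- With c fixed, (1-γ)(t - 1/(c²γ)) takes the value r_l at γ = t^{2l} and, by its symmetry γ ↔
    -- 1/(c²tγ), at γ = 1/(c²t^{2l+1}). The second root is the condition γ s₀² = t^{2l+1}.
    have hp : ∀ l ∈ range n, ((1 - γ) * (t - γ * s₀ ^ 2) -
        (1 - t ^ (2 * l)) * (t - 1 / (c ^ 2 * t ^ (2 * l)))) = (-1 * γ * t) *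
        ((1 - s₀ ^ 2 * γ * t ^ (-2 * ((l + 1 : ℕ) : ℤ) + 1)) *
              (1 - γ⁻¹ * t ^ (2 * (l + 1) - 2))) := by
      intro l _
      have e : t ^ (-2 * ((l + 1 : ℕ) : ℤ) + 1) = 1 / (t ^ (2 * l) * t) := by
        rw [eq_div_iff (mul_ne_zero (pow_ne_zero _ ht) ht), ← pow_succ, ← zpow_natCast,
          ← zpow_add₀ ht, ← zpow_zero t]
        congr 1
        push_cast
        ring
      rw [e, show 2 * (l + 1) - 2 = 2 * l by omega, hc]
      have := pow_ne_zero (2 * l) ht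
      field_simp
      ring
    rw [hv, Finset.prod_congr rfl hp, Finset.prod_mul_distrib, prod_Icc_one_eq_prod_range,
      Finset.prod_const, Finset.card_range, mul_pow, mul_pow]
    have hpow : t ^ (n * (n - 1)) * t ^ n = t ^ (n ^ 2) := by
      rw [← pow_add]
      congr 1
      cases n with
      | zero => rfl
      | succ m => simp; ring
    rw [← hpow]
    ring
  · intro i j h
    have := hinj (mul_left_cancel₀ hc0 h)
    ext
    omega
  · intro i j hij
    have := hdiff i j hij
    rw [show t * (c * t ^ (2 * n - 1 - (i : ℕ))) * (c * t ^ (2 * n - 1 - (j : ℕ)))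
      = c ^ 2 * t ^ (2 * n - 1 - (i : ℕ) + (2 * n - 1 - (j : ℕ)) + 1) by ring]
    exact hy _ (by omega) (by omega)

/-! ### Fusion of the rows in one column. -/

/-- The weighted sum over the configurations of one column with rapidities `us` (from bottom to
top), left inputs `as`, `i` paths at the bottom and `m` at the top; a configuration with `k`
outgoing paths on the right is weighted by `f k`. -/
noncomputable def colSum (t g s : ℂ) (m : ℕ) : List ℂ → List (Fin 2) → ℕ → (ℕ → ℂ) → ℂ
  | [], [], i, f => if i = m then f 0 else 0
  | u :: us, a :: as, i, f => ∑ b : Fin 2, vertexWeight t g s u i a (i + a - b) b *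
      colSum t g s m us as (i + a - b) (fun k => f (k + b))
  | _, _, _, _ => 0

/-- Conservation of paths. The truncated subtraction at i = a = 0, b = 1 is harmless, because the
weight with i' = 0 vanishes there too. -/
theorem vertexWeight_eq_zero (t g s u : ℂ) (i i' : ℕ) (a b : Fin 2)
    (h : i' ≠ i + a - b) : vertexWeight t g s u i a i' b = 0 := by
  fin_cases a <;> fin_cases b <;> simp [vertexWeight] at * <;> omega

theorem sum_fin_succ_arrow {X : Type*} [Fintype X] {n : ℕ} (F : (Fin (n + 1) → X) → ℂ) :
    ∑ h, F h = ∑ x, ∑ h : Fin n → X, F (Fin.cons x h) := by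
  rw [← Equiv.sum_comp (Fin.consEquiv fun _ : Fin (n + 1) => X), Fintype.sum_prod_type]
  rfl

theorem sum_column_eq_colSum (t g s : ℂ) (m K : ℕ) : ∀ (N : ℕ) (u : Fin N → ℂ) (a : Fin N → Fin 2)
    (i : ℕ) (f : ℕ → ℂ), i + N ≤ K →
    ∑ b : Fin N → Fin 2, f (∑ r, (b r : ℕ)) * ∑ v : Fin (N + 1) → Fin (K + 1),
      (if (v 0 : ℕ) = i ∧ (v (Fin.last _) : ℕ) = m then
        ∏ r, vertexWeight t g s (u r) (v r.castSucc) (a r) (v r.succ) (b r) else 0)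
    = colSum t g s m (List.ofFn u) (List.ofFn a) i f := by
  intro N
  induction N with
  | zero =>
    intro u a i f hi
    simp only [List.ofFn_zero, colSum, sum_fin_succ_arrow]
    simp only [Fintype.sum_unique, Finset.univ_eq_empty, Finset.sum_empty, Finset.prod_empty,
      Fin.cons_zero, Fin.last_zero]
    by_cases h : i = m
    · subst h
      rw [if_pos rfl, Finset.sum_eq_single ⟨i, by omega⟩]
      · simp
      · intro b _ hb
        rw [if_neg]
        rintro ⟨h, -⟩
        exact hb (Fin.ext h)
      · simp
    · rw [if_neg h, Finset.sum_eq_zero, mul_zero]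
      intro x _
      rw [if_neg]
      rintro ⟨h1, h2⟩
      exact h (h1.symm.trans h2)
  | succ N ih =>
    intro u a i f hi
    rw [List.ofFn_succ, List.ofFn_succ, colSum, sum_fin_succ_arrow]
    refine Finset.sum_congr rfl fun b _ => ?_
    rw [← ih _ _ _ _ (by have := (a 0).isLt; omega), Finset.mul_sum]
    refine Finset.sum_congr rfl fun b' _ => ?_
    rw [mul_left_comm, Fin.sum_univ_succ]
    simp only [Fin.cons_zero, Fin.cons_succ]
    rw [add_comm (b : ℕ)]
    congr 1
    rw [sum_fin_succ_arrow, Finset.sum_eq_single ⟨i, by omega⟩, Finset.mul_sum]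
    · refine Finset.sum_congr rfl fun v _ => ?_
      simp only [Fin.prod_univ_succ, Fin.cons_zero, Fin.cons_succ, Fin.castSucc_zero,
        ← Fin.succ_castSucc, ← Fin.succ_last]
      by_cases hv : (v 0 : ℕ) = i + a 0 - b
      · simp [hv]
      · rw [vertexWeight_eq_zero _ _ _ _ _ _ _ _ hv]
        simp [hv]
    · intro x _ hx
      apply Finset.sum_eq_zero
      intro v _
      rw [if_neg]
      rintro ⟨h, -⟩
      exact hx (Fin.ext h)
    · simp

/-- The local relation behind fusion: with rapidities in ratio t and outputs weighted by their
number alone, an empty and an occupied left edge in adjacent rows may trade places. It uses the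
unshifted weights, g = 1. -/
theorem colSum_swap (t s u : ℂ) (m : ℕ) (us : List ℂ) (as : List (Fin 2)) (i : ℕ)
    (f : ℕ → ℂ) :
    colSum t 1 s m (u * t :: u :: us) (0 :: 1 :: as) i f
      = colSum t 1 s m (u * t :: u :: us) (1 :: 0 :: as) i f := by
  rcases i with _ | i
  · simp [colSum, vertexWeight, div_eq_mul_inv]
    ring
  · simp [colSum, vertexWeight, div_eq_mul_inv]
    ring

/-- The geometric progression `c t ^ (N - 1), …, c t, c`. -/
noncomputable def geoList (t c : ℂ) : ℕ → List ℂ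
  | 0 => []
  | N + 1 => c * t ^ N :: geoList t c N

theorem geoList_eq_ofFn (t c : ℂ) (N : ℕ) :
    geoList t c N = List.ofFn fun i : Fin N => c * t ^ (N - 1 - (i : ℕ)) := by
  induction N with
  | zero => rfl
  | succ N ih =>
    rw [geoList, List.ofFn_succ, ih]
    congr 2
    ext i
    congr 2
    simp
    omega

theorem colSum_perm (t s c : ℂ) (m : ℕ) {as bs : List (Fin 2)} (h : as.Perm bs) :
    ∀ (i : ℕ) (f : ℕ → ℂ), colSum t 1 s m (geoList t c as.length) as i f
      = colSum t 1 s m (geoList t c bs.length) bs i f := by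
  induction h with
  | nil => intros; rfl
  | cons x h ih =>
    intro i f
    simp only [List.length_cons, geoList, colSum, ih]
    rw [h.length_eq]
  | swap x y l =>
    intro i f
    simp only [List.length_cons, geoList, pow_succ, ← mul_assoc]
    fin_cases x <;> fin_cases y
    · rfl
    · exact (colSum_swap _ _ _ _ _ _ _ _).symm
    · exact colSum_swap _ _ _ _ _ _ _ _
    · rfl
  | trans _ _ ih1 ih2 => intro i f; rw [ih1, ih2]

theorem perm_replicate_append (as : List (Fin 2)) :
    as.Perm (List.replicate (as.count 0) 0 ++ List.replicate (as.count 1) 1) := by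
  rw [List.perm_iff_count]
  intro x
  fin_cases x <;> simp [List.count_replicate]

/-- Empty rows at the bottom leave the vertical edge empty and each contribute (1 - su)/(1 - su) =
1. -/
theorem colSum_zeros (t s c : ℂ) (m : ℕ) (as : List (Fin 2)) (z : ℕ)
    (hs : ∀ j < z + as.length, 1 - s * (c * t ^ j) ≠ 0) (f : ℕ → ℂ) :
    colSum t 1 s m (geoList t c (z + as.length)) (List.replicate z 0 ++ as) 0 f
      = colSum t 1 s m (geoList t c as.length) as 0 f := by
  induction z with
  | zero => simp
  | succ z ih =>
    rw [← ih (fun j hj => hs j (by omega)), List.replicate_succ, List.cons_append,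
      show z + 1 + as.length = z + as.length + 1 by ring, geoList, colSum]
    have := hs (z + as.length) (by omega)
    simp [vertexWeight, div_self this]

/-- The `q`-factorial `(t; t)_n`. -/
noncomputable def qFact (t : ℂ) (n : ℕ) : ℂ := ∏ j ∈ range n, (1 - t ^ (j + 1))

/-- The weight of a column in which all `l + p` left inputs are occupied, `i` paths enter at the
bottom and `i + p` leave at the top. -/
noncomputable def fusedWeight (t g s c : ℂ) (i l p : ℕ) : ℂ :=
  (∏ h ∈ range p, (1 - g * t ^ (i + h + 1))) * (qFact t (l + p) / (qFact t l * qFact t p)) *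
    (∏ j ∈ range l, (c * t ^ j - s * g * t ^ i)) / ∏ j ∈ range (l + p), (1 - s * (c * t ^ j))

theorem qFact_succ (t : ℂ) (n : ℕ) : qFact t (n + 1) = qFact t n * (1 - t ^ (n + 1)) :=
  Finset.prod_range_succ _ _

theorem prod_shift_eq (t c S : ℂ) (l : ℕ) : ∏ j ∈ range (l + 1), (c * t ^ j - S * t) =
    t ^ l * (c - S * t) * ∏ j ∈ range l, (c * t ^ j - S) := by
  rw [Finset.prod_range_succ']
  have : ∀ j ∈ range l, c * t ^ (j + 1) - S * t = t * (c * t ^ j - S) := fun j _ => by ring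
  rw [Finset.prod_congr rfl this, Finset.prod_mul_distrib]
  simp
  ring

theorem fusedWeight_succ_zero_left (t g s c : ℂ) (i p : ℕ) (hq : ∀ n, qFact t n ≠ 0) :
    fusedWeight t g s c i 0 (p + 1)
      = (1 - g * t ^ (i + 1)) / (1 - s * (c * t ^ p)) * fusedWeight t g s c (i + 1) 0 p := by
  have h1 := hq p
  have h2 := hq (p + 1)
  simp only [fusedWeight, zero_add, Finset.prod_range_zero, mul_one]
  rw [Finset.prod_range_succ', Finset.prod_range_succ (fun j => 1 - s * (c * t ^ j)) p]
  have e : ∀ h, i + (h + 1) + 1 = i + 1 + h + 1 := fun h => by ring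
  have h0 : qFact t 0 = 1 := rfl
  simp only [e, add_zero, h0, one_mul, div_self h1, div_self h2, mul_one]
  rw [div_mul_div_comm]
  ring

theorem fusedWeight_succ_zero_right (t g s c : ℂ) (i l : ℕ) (hq : ∀ n, qFact t n ≠ 0) :
    fusedWeight t g s c i (l + 1) 0
      = (c * t ^ l - s * g * t ^ i) / (1 - s * (c * t ^ l)) * fusedWeight t g s c i l 0 := by
  have h1 := hq l
  have h2 := hq (l + 1)
  have h0 : qFact t 0 = 1 := rfl
  simp only [fusedWeight, add_zero, Finset.prod_range_zero, mul_one, one_mul, h0,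
    div_self h1, div_self h2]
  rw [Finset.prod_range_succ, Finset.prod_range_succ (fun j => 1 - s * (c * t ^ j)) l]
  rw [div_mul_div_comm]
  ring

/-- A weighted q-Pascal rule: the path of the bottom row, of rapidity c t^{l+p+1}, either turns up
or goes straight on. -/
theorem fusedWeight_succ_succ (t g s c : ℂ) (i l p : ℕ) (hq : ∀ n, qFact t n ≠ 0) :
    fusedWeight t g s c i (l + 1) (p + 1)
      = (1 - g * t ^ (i + 1)) / (1 - s * (c * t ^ (l + p + 1))) *
          fusedWeight t g s c (i + 1) (l + 1) p +
        (c * t ^ (l + p + 1) - s * g * t ^ i) / (1 - s * (c * t ^ (l + p + 1))) *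
          fusedWeight t g s c i l (p + 1) := by
  have q1 := hq l
  have q2 := hq p
  have q3 : (1 - t ^ (l + 1)) ≠ 0 := fun h => hq (l + 1) (by rw [qFact_succ, h, mul_zero])
  have q4 : (1 - t ^ (p + 1)) ≠ 0 := fun h => hq (p + 1) (by rw [qFact_succ, h, mul_zero])
  have e : ∀ h, i + (h + 1) + 1 = i + 1 + h + 1 := fun h => by ring
  have e1 : s * g * t ^ (i + 1) = s * g * t ^ i * t := by ring
  simp only [fusedWeight]
  rw [show l + 1 + (p + 1) = l + p + 1 + 1 by ring, show l + 1 + p = l + p + 1 by ring,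
    show l + (p + 1) = l + p + 1 by ring, qFact_succ t (l + p + 1), qFact_succ t l,
    qFact_succ t p, e1, prod_shift_eq, Finset.prod_range_succ',
    Finset.prod_range_succ (fun j => c * t ^ j - s * g * t ^ i),
    Finset.prod_range_succ (fun j => 1 - s * (c * t ^ j)) (l + p + 1)]
  simp only [e, add_zero]
  generalize ∏ x ∈ range p, (1 - g * t ^ (i + 1 + x + 1)) = A
  generalize ∏ x ∈ range l, (c * t ^ x - s * g * t ^ i) = B
  generalize ∏ x ∈ range (l + p + 1), (1 - s * (c * t ^ x)) = D
  generalize hd : 1 - s * (c * t ^ (l + p + 1)) = d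
  generalize qFact t (l + p + 1) = Q
  generalize qFact t l = Ql at *
  generalize qFact t p = Qp at *
  rw [div_mul_div_comm, div_mul_div_comm, mul_comm D d, ← add_div]
  congr 1
  have ex : t ^ (l + p + 1) = t ^ l * t ^ p * t := by ring
  have ex2 : t ^ (l + p + 1 + 1) = t ^ l * t ^ p * t ^ 2 := by ring
  rw [ex, ex2]
  rw [pow_succ] at q3 q4
  rw [pow_succ t l, pow_succ t p]
  generalize t ^ l = L at *
  generalize t ^ p = P at *
  generalize hd3 : 1 - L * t = d3 at *
  generalize hd4 : 1 - P * t = d4 at *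
  field_simp
  subst hd3 hd4
  ring

theorem colSum_ones_of_lt (t g s c : ℂ) (m : ℕ) : ∀ (k i : ℕ) (f : ℕ → ℂ), m < i →
    colSum t g s m (geoList t c k) (List.replicate k 1) i f = 0 := by
  intro k
  induction k with
  | zero =>
    intro i f h
    simp [geoList, colSum, h.ne']
  | succ k ih =>
    intro i f h
    simp [geoList, colSum, List.replicate_succ, ih _ _ h, ih _ _ (h.trans (Nat.lt_succ_self i))]

theorem colSum_ones (t g s c : ℂ) (hq : ∀ n, qFact t n ≠ 0) : ∀ (k i p : ℕ) (f : ℕ → ℂ),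
    colSum t g s (i + p) (geoList t c k) (List.replicate k 1) i f
      = if p ≤ k then fusedWeight t g s c i (k - p) p * f (k - p) else 0 := by
  intro k
  induction k with
  | zero =>
    intro i p f
    rcases p with _ | p
    · simp [geoList, colSum, fusedWeight, qFact]
    · simp [geoList, colSum]
  | succ k ih =>
    intro i p f
    have w1 : vertexWeight t g s (c * t ^ k) i 1 (i + 1) 0
        = (1 - g * t ^ (i + 1)) / (1 - s * (c * t ^ k)) := by simp [vertexWeight]
    have w2 : vertexWeight t g s (c * t ^ k) i 1 i 1
        = (c * t ^ k - s * g * t ^ i) / (1 - s * (c * t ^ k)) := by simp [vertexWeight]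
    rw [geoList, List.replicate_succ, colSum, Fin.sum_univ_two]
    simp only [Fin.val_zero, Fin.val_one, Nat.sub_zero, Nat.add_sub_cancel, add_zero, w1, w2, ih]
    rcases p with _ | p
    · rw [add_zero, colSum_ones_of_lt _ _ _ _ _ _ _ _ (Nat.lt_succ_self i)]
      simp only [Nat.zero_le, if_true, Nat.sub_zero, fusedWeight_succ_zero_right _ _ _ _ _ _ hq]
      ring
    · rw [show i + (p + 1) = i + 1 + p by ring, ih]
      rcases lt_trichotomy p k with h | h | h
      · obtain ⟨l, rfl⟩ : ∃ l, k = l + p + 1 := ⟨k - p - 1, by omega⟩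
        rw [if_pos h.le, if_pos (by omega), if_pos (by omega),
          show l + p + 1 - p = l + 1 by omega, show l + p + 1 - (p + 1) = l by omega,
          show l + p + 1 + 1 - (p + 1) = l + 1 by omega, fusedWeight_succ_succ _ _ _ _ _ _ _ hq]
        ring
      · subst h
        rw [if_pos le_rfl, if_neg (by omega), if_pos le_rfl, Nat.sub_self, Nat.sub_self,
          fusedWeight_succ_zero_left _ _ _ _ _ _ hq]
        ring
      · rw [if_neg (by omega), if_neg (by omega), if_neg (by omega)]
        ring

/-! ### From path ensembles to products over columns. -/

/-- The weight of one column with left inputs `a`, right outputs `b`, no paths at the bottom and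
`m` paths at the top. -/
noncomputable def colWeight (t g s : ℂ) (m : ℕ) {N : ℕ} (u : Fin N → ℂ) (a b : Fin N → Fin 2) : ℂ :=
  ∑ v : Fin (N + 1) → Fin (N + 1), if (v 0 : ℕ) = 0 ∧ (v (Fin.last _) : ℕ) = m then
    ∏ r, vertexWeight t g s (u r) (v r.castSucc) (a r) (v r.succ) (b r) else 0

theorem sum_val_eq_count {N : ℕ} (a : Fin N → Fin 2) :
    ∑ r, (a r : ℕ) = (List.ofFn a).count 1 := by
  have h : ∀ as : List (Fin 2), (as.map (Fin.val : Fin 2 → ℕ)).sum = as.count 1 := by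
    intro as
    induction as with
    | nil => rfl
    | cons x as ih =>
      rw [List.map_cons, List.sum_cons, ih, List.count_cons]
      fin_cases x <;> simp [add_comm]
  rw [← h, List.map_ofFn, List.sum_ofFn]
  rfl

/-- Permuting the left inputs brings the empty rows to the bottom, where they have weight one; a
shorter column with all inputs occupied remains. -/
theorem sum_colWeight_mul (t s c : ℂ) (hq : ∀ n, qFact t n ≠ 0) (m N : ℕ)
    (hs : ∀ j < N, 1 - s * (c * t ^ j) ≠ 0) (a : Fin N → Fin 2) (f : ℕ → ℂ) :
    ∑ b, colWeight t 1 s m (fun i : Fin N => c * t ^ (N - 1 - (i : ℕ))) a b * f (∑ r, (b r : ℕ))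
      = if m ≤ ∑ r, (a r : ℕ) then
          fusedWeight t 1 s c 0 (∑ r, (a r : ℕ) - m) m * f (∑ r, (a r : ℕ) - m) else 0 := by
  have h := sum_column_eq_colSum t 1 s m N N (fun i : Fin N => c * t ^ (N - 1 - (i : ℕ))) a 0 f
    (by omega)
  have hperm := perm_replicate_append (List.ofFn a)
  have hlen := hperm.length_eq
  rw [List.length_ofFn, List.length_append, List.length_replicate, List.length_replicate] at hlen
  have h2 := colSum_perm t s c m hperm 0 f
  have h3 := colSum_zeros t s c m (List.replicate ((List.ofFn a).count 1) 1)
    ((List.ofFn a).count 0) (by rw [List.length_replicate, ← hlen]; exact hs) f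
  have h4 := colSum_ones t 1 s c hq ((List.ofFn a).count 1) 0 m f
  rw [zero_add] at h4
  rw [List.length_replicate] at h3
  rw [List.length_append, List.length_replicate, List.length_replicate, List.length_ofFn, h3,
    h4] at h2
  rw [← geoList_eq_ofFn, h2] at h
  rw [sum_val_eq_count, ← h]
  exact Finset.sum_congr rfl fun b _ => mul_comm _ _

/-- Serves column 0: all its left edges are occupied, so no exchange of rows is needed and the shift
g is arbitrary. -/
theorem sum_colWeight_ones_mul (t g s c : ℂ) (hq : ∀ n, qFact t n ≠ 0) (m N : ℕ) (f : ℕ → ℂ) :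
    ∑ b, colWeight t g s m (fun i : Fin N => c * t ^ (N - 1 - (i : ℕ))) (fun _ => 1) b *
        f (∑ r, (b r : ℕ))
      = if m ≤ N then fusedWeight t g s c 0 (N - m) m * f (N - m) else 0 := by
  have h := sum_column_eq_colSum t g s m N N (fun i : Fin N => c * t ^ (N - 1 - (i : ℕ)))
    (fun _ => 1) 0 f (by omega)
  have h4 := colSum_ones t g s c hq N 0 m f
  rw [zero_add] at h4
  rw [← geoList_eq_ofFn, List.ofFn_const, h4] at h
  rw [← h]
  exact Finset.sum_congr rfl fun b _ => mul_comm _ _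

theorem spinHL_eq_sum_colWeight (t α : ℂ) (s : ℕ → ℂ) {N : ℕ} (u : Fin N → ℂ) (lam : Fin N → ℕ) :
    spinHL t α s u lam = ∑ H : Fin (largestPart lam + 1 + 1) → Fin N → Fin 2,
      if H 0 = (fun _ => 1) ∧ H (Fin.last _) = (fun _ => 0) then
        ∏ x : Fin (largestPart lam + 1), colWeight t (if x = 0 then t ^ α else 1) (s x)
          (partMult lam x) u (H x.castSucc) (H x.succ) else 0 := by
  rw [spinHL, ← Equiv.sum_comp (Equiv.piComm fun (_ : Fin (largestPart lam + 2)) (_ : Fin N) =>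
    Fin 2)]
  refine Finset.sum_congr rfl fun H _ => ?_
  by_cases hH : H 0 = (fun _ => 1) ∧ H (Fin.last _) = (fun _ => 0)
  · rw [if_pos hH]
    have hH' : ∀ r, (Equiv.piComm fun (_ : Fin (largestPart lam + 2)) (_ : Fin N) => Fin 2) H r 0
        = 1 ∧ (Equiv.piComm fun (_ : Fin (largestPart lam + 2)) (_ : Fin N) => Fin 2) H r
          (Fin.last _) = 0 :=
      fun r => ⟨congrFun hH.1 r, congrFun hH.2 r⟩
    simp only [colWeight]
    rw [Finset.prod_univ_sum, Fintype.piFinset_univ,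
      ← Equiv.sum_comp (Equiv.piComm fun (_ : Fin (largestPart lam + 1)) (_ : Fin (N + 1)) =>
        Fin (N + 1))]
    refine Finset.sum_congr rfl fun V _ => ?_
    rw [Finset.prod_ite_zero]
    by_cases hV : ∀ x, ((V x 0 : ℕ) = 0 ∧ (V x (Fin.last _) : ℕ) = partMult lam x)
    · rw [if_pos (fun x _ => hV x), if_pos ⟨hH', fun x => ⟨Fin.ext (hV x).1, (hV x).2⟩⟩,
        Finset.prod_comm]
      rfl
    · rw [if_neg (show ¬ ∀ x ∈ univ, _ from fun h => hV fun x => h x (Finset.mem_univ x)), if_neg]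
      exact fun h => hV fun x => ⟨congrArg Fin.val (h.2 x).1, (h.2 x).2⟩
  · rw [if_neg hH]
    apply Finset.sum_eq_zero
    intro V _
    rw [if_neg]
    rintro ⟨h, -⟩
    exact hH ⟨funext fun r => (h r).1, funext fun r => (h r).2⟩

/-- The product of the column weights `E x l`, where `l` is the number of paths that continue to
the right of the column `x`, when `m x` paths leave in each of the columns `x₀, …, x₀ + K - 1`. -/
noncomputable def columnProd (E : ℕ → ℕ → ℂ) (m : ℕ → ℕ) : ℕ → ℕ → ℂ
  | 0, _ => 1
  | K + 1, x₀ => E x₀ (∑ y ∈ range K, m (x₀ + 1 + y)) * columnProd E m K (x₀ + 1)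

theorem sum_paths_succ {A : Type*} [Fintype A] [DecidableEq A] (K : ℕ) (z a : A)
    (W : ℕ → A → A → ℂ) :
    (∑ H : Fin (K + 1 + 1) → A, if H 0 = a ∧ H (Fin.last _) = z then
        ∏ x : Fin (K + 1), W x (H x.castSucc) (H x.succ) else 0)
      = ∑ b, W 0 a b * ∑ H : Fin (K + 1) → A, if H 0 = b ∧ H (Fin.last _) = z then
        ∏ x : Fin K, W (1 + x) (H x.castSucc) (H x.succ) else 0 := by
  have e : ∀ x : Fin K, W (1 + (x : ℕ)) = W ((x : ℕ) + 1) := fun x => by rw [add_comm]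
  simp only [e]
  rw [sum_fin_succ_arrow, Finset.sum_eq_single a]
  · simp only [Finset.mul_sum]
    rw [Finset.sum_comm]
    refine Finset.sum_congr rfl fun H _ => ?_
    rw [Finset.sum_eq_single (H 0)]
    · simp only [Fin.prod_univ_succ, Fin.cons_zero, Fin.cons_succ, Fin.castSucc_zero,
        ← Fin.succ_castSucc, ← Fin.succ_last, Fin.val_succ, Fin.val_zero]
      by_cases h : H (Fin.last K) = z <;> simp [h]
    · intro b _ hb
      rw [if_neg (fun h => hb h.1.symm), mul_zero]
    · simp
  · intro b _ hb
    apply Finset.sum_eq_zero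
    intro H _
    rw [if_neg]
    rintro ⟨h, -⟩
    exact hb h
  · simp

/-- The sum over everything to the right of a column depends only on how many paths leave that
column, which is exactly the kind of `f` that the hypothesis on `W` admits. -/
theorem sum_paths_eq_columnProd {N : ℕ} (E : ℕ → ℕ → ℂ) (m : ℕ → ℕ)
    (W : ℕ → (Fin N → Fin 2) → (Fin N → Fin 2) → ℂ) (K : ℕ) : ∀ (x₀ : ℕ)
    (_ : ∀ x, x₀ ≤ x → ∀ a (f : ℕ → ℂ), ∑ b, W x a b * f (∑ r, (b r : ℕ)) =
      if m x ≤ ∑ r, (a r : ℕ) then E x (∑ r, (a r : ℕ) - m x) * f (∑ r, (a r : ℕ) - m x) else 0)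
    (a : Fin N → Fin 2),
    (∑ H : Fin (K + 1) → Fin N → Fin 2, if H 0 = a ∧ H (Fin.last _) = (fun _ => 0) then
        ∏ x : Fin K, W (x₀ + x) (H x.castSucc) (H x.succ) else 0)
      = if ∑ r, (a r : ℕ) = ∑ y ∈ range K, m (x₀ + y) then columnProd E m K x₀ else 0 := by
  induction K with
  | zero =>
    intro x₀ _ a
    rw [sum_fin_succ_arrow, Finset.sum_eq_single a]
    · simp [columnProd, funext_iff]
    · intro b _ hb
      simp [hb]
    · simp
  | succ K ih =>
    intro x₀ hW a
    rw [sum_paths_succ K _ _ fun x => W (x₀ + x)]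
    have ih := ih (x₀ + 1) (fun x hx => hW x (by omega))
    rw [columnProd]
    obtain ⟨x₁, hx₁⟩ : ∃ x₁, x₁ = x₀ + 1 := ⟨_, rfl⟩
    have e : ∀ x, x₀ + (1 + x) = x₁ + x := fun x => by rw [hx₁]; ring
    have e' : ∀ x, x₀ + (x + 1) = x₁ + x := fun x => by rw [hx₁]; ring
    rw [← hx₁] at ih ⊢
    simp only [e, ih, add_zero]
    rw [hW x₀ le_rfl a (fun k => if k = ∑ y ∈ range K, m (x₁ + y) then
      columnProd E m K x₁ else 0), Finset.sum_range_succ']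
    simp only [e', add_zero]
    by_cases h : ∑ r, (a r : ℕ) = ∑ y ∈ range K, m (x₁ + y) + m x₀
    · rw [if_pos (by omega), if_pos (by omega), if_pos h,
        show ∑ r, (a r : ℕ) - m x₀ = ∑ y ∈ range K, m (x₁ + y) by omega]
    · rw [if_neg h]
      by_cases h' : m x₀ ≤ ∑ r, (a r : ℕ)
      · rw [if_pos h', if_neg (by omega), mul_zero]
      · rw [if_neg h']

theorem spinHL_eq_columnProd {t c α : ℂ} {s : ℕ → ℂ} {N : ℕ} (hq : ∀ n, qFact t n ≠ 0)
    (hs : ∀ x, ∀ j < N, 1 - s x * (c * t ^ j) ≠ 0) (lam : Fin N → ℕ)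
    (hN : ∑ y ∈ range (largestPart lam + 1), partMult lam y = N) :
    spinHL t α s (fun i : Fin N => c * t ^ (N - 1 - (i : ℕ))) lam =
      columnProd (fun x l => fusedWeight t (if x = 0 then t ^ α else 1) (s x) c 0 l
        (partMult lam x)) (partMult lam) (largestPart lam + 1) 0 := by
  rw [spinHL_eq_sum_colWeight]
  have h := sum_paths_succ (largestPart lam) (fun _ => 0) (fun _ : Fin N => (1 : Fin 2))
    (fun x => colWeight t (if x = 0 then t ^ α else 1) (s x) (partMult lam x)
      (fun i : Fin N => c * t ^ (N - 1 - (i : ℕ))))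
  have h2 := sum_paths_eq_columnProd (N := N) (fun x l =>
    fusedWeight t (if x = 0 then t ^ α else 1) (s x) c 0 l (partMult lam x)) (partMult lam)
    (fun x => colWeight t (if x = 0 then t ^ α else 1) (s x) (partMult lam x)
      (fun i : Fin N => c * t ^ (N - 1 - (i : ℕ)))) (largestPart lam) 1
    (by
      intro x hx a f
      simp only [if_neg (show x ≠ 0 by omega)]
      exact sum_colWeight_mul t (s x) c hq (partMult lam x) N (hs x) a f)
  have e : ∀ x : Fin (largestPart lam + 1), (if x = 0 then t ^ α else (1 : ℂ))
      = if (x : ℕ) = 0 then t ^ α else 1 := by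
    intro x
    simp only [Fin.ext_iff, Fin.val_zero]
  simp only [e]
  rw [h]
  simp only [h2]
  have h4 := sum_colWeight_ones_mul t (t ^ α) (s 0) c hq (partMult lam 0) N
    (fun k => if k = ∑ y ∈ range (largestPart lam), partMult lam (1 + y) then
      columnProd (fun x l => fusedWeight t (if x = 0 then t ^ α else 1) (s x) c 0 l
        (partMult lam x)) (partMult lam) (largestPart lam) 1 else 0)
  simp only [if_true]
  refine h4.trans ?_
  have hN' : ∑ y ∈ range (largestPart lam), partMult lam (1 + y) + partMult lam 0 = N := by
    refine Eq.trans ?_ hN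
    rw [Finset.sum_range_succ']
    congr 1
    exact Finset.sum_congr rfl fun y _ => by rw [add_comm]
  rw [if_pos (by omega), if_pos (by omega), columnProd, if_pos rfl]
  simp only [zero_add]
  congr 2
  omega

/-! ### The transfer recursion: boundedness and convergence. -/

theorem sum_antidiagonal_eq_add_sum_range {R : Type*} [AddCommMonoid R] (F : ℕ → ℕ → R) (k : ℕ) :
    ∑ ab ∈ antidiagonal k, F ab.1 ab.2 = F 0 k + ∑ b ∈ range k, F (k - b) b := by
  rw [← Finset.Nat.sum_antidiagonal_swap]
  simp only [Prod.fst_swap, Prod.snd_swap]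
  rw [Finset.Nat.sum_antidiagonal_eq_sum_range_succ (fun b a => F a b), Finset.sum_range_succ,
    Nat.sub_self, add_comm]

/-- The product of the weights `e x (p x) r`, where `r` is the sum of the entries of `p` to the
right of `x`. -/
noncomputable def tupleProd {R : Type*} [CommSemiring R] (e : ℕ → ℕ → ℕ → R) :
    (K : ℕ) → (Fin K → ℕ) → ℕ → R
  | 0, _, _ => 1
  | K + 1, p, x => e x (p 0) (∑ i : Fin K, p i.succ) * tupleProd e K (fun i => p i.succ) (x + 1)

/-- The sum of `tupleProd` over all tuples with sum `k`. -/
noncomputable def transferSum {R : Type*} [CommSemiring R] (e : ℕ → ℕ → ℕ → R) (K k x : ℕ) : R :=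
  ∑ p ∈ Finset.Nat.antidiagonalTuple K k, tupleProd e K p x

theorem transferSum_zero {R : Type*} [CommSemiring R] (e : ℕ → ℕ → ℕ → R) (k x : ℕ) :
    transferSum e 0 k x = if k = 0 then 1 else 0 := by
  rcases k with _ | k <;> simp [transferSum, tupleProd]

theorem transferSum_succ {R : Type*} [CommSemiring R] (e : ℕ → ℕ → ℕ → R) (K k x : ℕ) :
    transferSum e (K + 1) k x
      = ∑ ab ∈ antidiagonal k, e x ab.1 ab.2 * transferSum e K ab.2 (x + 1) := by
  simp only [transferSum, Finset.mul_sum]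
  rw [Finset.sum_sigma']
  refine Finset.sum_bij' (fun p _ => ⟨(p 0, ∑ i : Fin K, p i.succ), fun i => p i.succ⟩)
    (fun q _ => Fin.cons q.1.1 q.2) ?_ ?_ ?_ ?_ ?_
  · intro p hp
    rw [Finset.Nat.mem_antidiagonalTuple, Fin.sum_univ_succ] at hp
    simp [Finset.Nat.mem_antidiagonalTuple, hp]
  · rintro ⟨⟨a, b⟩, q⟩ hq
    simp only [mem_sigma, HasAntidiagonal.mem_antidiagonal, Finset.Nat.mem_antidiagonalTuple] at hq
    simp [Finset.Nat.mem_antidiagonalTuple, Fin.sum_univ_succ, hq]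
  · intro p _
    ext i
    refine Fin.cases ?_ (fun i => ?_) i <;> simp
  · rintro ⟨⟨a, b⟩, q⟩ hq
    simp only [mem_sigma, HasAntidiagonal.mem_antidiagonal, Finset.Nat.mem_antidiagonalTuple] at hq
    simp [hq.2]
  · intro p _
    rfl

theorem norm_tupleProd (e : ℕ → ℕ → ℕ → ℂ) : ∀ (K : ℕ) (p : Fin K → ℕ) (x : ℕ),
    ‖tupleProd e K p x‖ = tupleProd (fun x a b => ‖e x a b‖) K p x := by
  intro K
  induction K with
  | zero => intro p x; simp [tupleProd]
  | succ K ih => intro p x; simp [tupleProd, ih]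

/-- The recursion is triangular in k with diagonal ρ < θ, and smaller k act as a source of size θ^L;
hence induction on k and then on L, uniformly in x. It is used with θ = 1 for boundedness and with θ
< 1 for convergence. -/
theorem exists_geometric_bound {ρ θ C B₀ : ℝ} (hρ : 0 ≤ ρ) (hθ : ρ < θ) (hC : 0 ≤ C) (hB₀ : 0 ≤ B₀)
    (n : ℕ) (z : ℕ → ℕ → ℕ → ℝ) (h0 : ∀ L x, z L x 0 ≤ B₀ * θ ^ L)
    (hL : ∀ x, ∀ k ≤ n, z 0 x k ≤ B₀)
    (hrec : ∀ L x k, 1 ≤ k → k ≤ n →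
      z (L + 1) x k ≤ ρ * z L (x + 1) k + C * ∑ r ∈ range k, z L (x + 1) r) :
    ∀ k ≤ n, ∃ B, 0 ≤ B ∧ ∀ r ≤ k, ∀ L x, z L x r ≤ B * θ ^ L := by
  have hθ0 : 0 < θ := hρ.trans_lt hθ
  intro k
  induction k with
  | zero =>
    intro _
    refine ⟨B₀, hB₀, fun r hr L x => ?_⟩
    obtain rfl : r = 0 := by omega
    exact h0 L x
  | succ k ih =>
    intro hk
    obtain ⟨B, hB, hb⟩ := ih (by omega)
    have hd : 0 < θ - ρ := sub_pos.mpr hθ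
    have hnn : 0 ≤ C * ((k + 1 : ℕ) * B) / (θ - ρ) := by positivity
    -- The last summand ensures ρB' + C(k+1)B ≤ θB', which closes the induction on L.
    refine ⟨B + B₀ + C * ((k + 1 : ℕ) * B) / (θ - ρ), by positivity, ?_⟩
    set B' := B + B₀ + C * ((k + 1 : ℕ) * B) / (θ - ρ) with hB'
    have hB'0 : 0 ≤ B' := by positivity
    have hkey : C * ((k + 1 : ℕ) * B) ≤ B' * (θ - ρ) := by
      have : C * ((k + 1 : ℕ) * B) / (θ - ρ) ≤ B' := by rw [hB']; linarith
      rwa [div_le_iff₀ hd] at this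
    intro r hr
    rcases Nat.lt_or_ge r (k + 1) with hr' | hr'
    · intro L x
      refine (hb r (by omega) L x).trans ?_
      have : 0 ≤ θ ^ L := by positivity
      apply mul_le_mul_of_nonneg_right _ this
      linarith
    · obtain rfl : r = k + 1 := by omega
      intro L
      induction L with
      | zero =>
        intro x
        rw [pow_zero, mul_one]
        exact (hL x _ hk).trans (by linarith)
      | succ L ihL =>
        intro x
        refine (hrec L x _ (by omega) hk).trans ?_
        have hp : 0 ≤ θ ^ L := by positivity
        have h1 : ρ * z L (x + 1) (k + 1) ≤ ρ * (B' * θ ^ L) :=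
          mul_le_mul_of_nonneg_left (ihL _) hρ
        have h2 : ∑ r ∈ range (k + 1), z L (x + 1) r ≤ (k + 1 : ℕ) * (B * θ ^ L) := by
          refine (Finset.sum_le_card_nsmul _ _ (B * θ ^ L) ?_).trans ?_
          · intro r hr
            exact hb r (by have := Finset.mem_range.mp hr; omega) L _
          · rw [Finset.card_range, nsmul_eq_mul]
        have h3 := mul_le_mul_of_nonneg_left h2 hC
        have h4 := mul_le_mul_of_nonneg_right hkey hp
        rw [pow_succ]
        linarith

theorem transferSum_norm_nonneg (e : ℕ → ℕ → ℕ → ℂ) (K k x : ℕ) :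
    0 ≤ transferSum (fun x a b => ‖e x a b‖) K k x := by
  apply Finset.sum_nonneg
  intro p _
  rw [← norm_tupleProd]
  exact norm_nonneg _

theorem transferSum_zero_right {R : Type*} [CommSemiring R] (e : ℕ → ℕ → ℕ → R) (K : ℕ) :
    ∀ x, (∀ y, x ≤ y → e y 0 0 = 1) → transferSum e K 0 x = 1 := by
  induction K with
  | zero => intro x _; simp [transferSum_zero]
  | succ K ih =>
    intro x h
    rw [transferSum_succ]
    simp [h x le_rfl, ih (x + 1) fun y hy => h y (by omega)]

/-- Uniform boundedness of the truncated absolute sums. -/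
theorem exists_transferSum_norm_le {e : ℕ → ℕ → ℕ → ℂ} {ρ C : ℝ} {n : ℕ} (hρ : 0 ≤ ρ)
    (hρ1 : ρ < 1) (hC : 0 ≤ C) (he0 : ∀ x, 1 ≤ x → e x 0 0 = 1)
    (heρ : ∀ x, 1 ≤ x → ∀ k, 1 ≤ k → k ≤ n → ‖e x 0 k‖ ≤ ρ)
    (heC : ∀ x, 1 ≤ x → ∀ a b, a + b ≤ n → ‖e x a b‖ ≤ C) :
    ∃ B, 0 ≤ B ∧ ∀ k ≤ n, ∀ L, transferSum (fun x a b => ‖e x a b‖) L k 1 ≤ B := by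
  obtain ⟨B, hB, hb⟩ := exists_geometric_bound (B₀ := 1) hρ hρ1 hC zero_le_one n
    (fun L x k => transferSum (fun x a b => ‖e x a b‖) L k (x + 1))
    (by
      intro L x
      rw [transferSum_zero_right]
      · simp
      · intro y hy
        rw [he0 y (by omega), norm_one])
    (by
      intro x k _
      rw [transferSum_zero]
      split_ifs <;> norm_num)
    (by
      intro L x k hk hkn
      rw [transferSum_succ, sum_antidiagonal_eq_add_sum_range (fun a b => ‖e (x + 1) a b‖ *
        transferSum (fun x a b => ‖e x a b‖) L b (x + 1 + 1)), Finset.mul_sum]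
      apply add_le_add
      · exact mul_le_mul_of_nonneg_right (heρ _ (by omega) k hk hkn) (transferSum_norm_nonneg _ _ _ _)
      · apply Finset.sum_le_sum
        intro b hb
        rw [Finset.mem_range] at hb
        exact mul_le_mul_of_nonneg_right (heC _ (by omega) _ _ (by omega))
          (transferSum_norm_nonneg _ _ _ _)) n le_rfl
  refine ⟨B, hB, fun k hk L => ?_⟩
  simpa using hb k hk L 0

/-- Convergence of the truncated sums to a stationary solution of the recursion. -/
theorem tendsto_transferSum {e : ℕ → ℕ → ℕ → ℂ} {ρ C : ℝ} {n : ℕ} (hρ : 0 ≤ ρ)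
    (hρ1 : ρ < 1) (hC : 0 ≤ C) (he0 : ∀ x, 1 ≤ x → e x 0 0 = 1)
    (heρ : ∀ x, 1 ≤ x → ∀ k, 1 ≤ k → k ≤ n → ‖e x 0 k‖ ≤ ρ)
    (heC : ∀ x, 1 ≤ x → ∀ a b, a + b ≤ n → ‖e x a b‖ ≤ C) (g : ℕ → ℂ) (hg0 : g 0 = 1)
    (hg : ∀ x, 1 ≤ x → ∀ k ≤ n, ∑ ab ∈ antidiagonal k, e x ab.1 ab.2 * g ab.2 = g k) :
    ∀ k ≤ n, Filter.Tendsto (fun L => transferSum e L k 1) Filter.atTop (nhds (g k)) := by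
  -- Any θ strictly between ρ and 1 would do. Since `g` is stationary, its difference from the
  -- truncated sum obeys the same recursion, and it vanishes at k = 0.
  have hθ : ρ < (1 + ρ) / 2 := by linarith
  have hθ1 : (1 + ρ) / 2 < 1 := by linarith
  have hθ0 : 0 ≤ (1 + ρ) / 2 := by linarith
  have hB₀ : (0 : ℝ) ≤ 1 + ∑ k ∈ range (n + 1), ‖g k‖ := by positivity
  obtain ⟨B, hB, hb⟩ := exists_geometric_bound (B₀ := 1 + ∑ k ∈ range (n + 1), ‖g k‖) hρ hθ hC hB₀ n
    (fun L x k => ‖transferSum e L k (x + 1) - g k‖)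
    (by
      intro L x
      rw [transferSum_zero_right e L (x + 1) fun y hy => he0 y (by omega), hg0, sub_self, norm_zero]
      positivity)
    (by
      intro x k hk
      have hs : ‖g k‖ ≤ ∑ k ∈ range (n + 1), ‖g k‖ :=
        Finset.single_le_sum (f := fun k => ‖g k‖) (fun i _ => norm_nonneg _)
          (Finset.mem_range.mpr (by omega))
      rw [transferSum_zero]
      refine (norm_sub_le _ _).trans (add_le_add ?_ hs)
      split_ifs <;> simp)
    (by
      intro L x k hk hkn
      rw [transferSum_succ, ← hg (x + 1) (by omega) k hkn, ← Finset.sum_sub_distrib,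
        Finset.sum_congr rfl fun ab _ => (mul_sub (e (x + 1) ab.1 ab.2)
          (transferSum e L ab.2 (x + 1 + 1)) (g ab.2)).symm,
        sum_antidiagonal_eq_add_sum_range (fun a b => e (x + 1) a b *
          (transferSum e L b (x + 1 + 1) - g b)), Finset.mul_sum]
      refine (norm_add_le _ _).trans (add_le_add ?_ ?_)
      · rw [norm_mul]
        rw [hg (x + 1) (by omega) k hkn]
        exact mul_le_mul_of_nonneg_right (heρ _ (by omega) k hk hkn) (norm_nonneg _)
      · refine (norm_sum_le _ _).trans (Finset.sum_le_sum ?_)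
        intro b hb
        rw [Finset.mem_range] at hb
        rw [norm_mul]
        exact mul_le_mul_of_nonneg_right (heC _ (by omega) _ _ (by omega)) (norm_nonneg _)) n le_rfl
  intro k hk
  rw [tendsto_iff_norm_sub_tendsto_zero]
  apply squeeze_zero (fun L => norm_nonneg _) (fun L => hb k hk L 0)
  rw [← mul_zero B]
  exact (tendsto_pow_atTop_nhds_zero_of_lt_one hθ0 hθ1).const_mul B

/-! ### Even signatures as tuples of half multiplicities. -/

theorem count_ofFn_eq_partMult {N : ℕ} (lam : Fin N → ℕ) (i : ℕ) :
    (List.ofFn lam).count i = partMult lam i := by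
  rw [← Multiset.coe_count, ← Fin.univ_val_map, Multiset.count_map, partMult, Finset.card_def,
    Finset.filter_val]
  simp only [eq_comm]

theorem eq_of_partMult_eq {N : ℕ} {lam mu : Fin N → ℕ} (hl : Antitone lam) (hm : Antitone mu)
    (h : ∀ i, partMult lam i = partMult mu i) : lam = mu := by
  apply List.ofFn_injective
  apply List.Perm.eq_of_pairwise' hl.sortedGE_ofFn.pairwise hm.sortedGE_ofFn.pairwise
  rw [List.perm_iff_count]
  intro i
  rw [count_ofFn_eq_partMult, count_ofFn_eq_partMult, h]

theorem exists_antitone_of_partMult {N : ℕ} (M : Multiset ℕ) (hM : Multiset.card M = N) :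
    ∃ lam : Fin N → ℕ, Antitone lam ∧ ∀ i, partMult lam i = M.count i := by
  subst hM
  have hlen := Multiset.length_sort (s := M) (r := (· ≥ ·))
  refine ⟨fun k => (M.sort (· ≥ ·)).get (Fin.cast hlen.symm k), ?_, ?_⟩
  · have h : (M.sort (· ≥ ·)).SortedGE := (Multiset.pairwise_sort M (· ≥ ·)).sortedGE
    intro i j hij
    exact h.antitone_get (by exact hij)
  · intro i
    rw [← count_ofFn_eq_partMult, ← List.ofFn_congr hlen, List.ofFn_get, ← Multiset.coe_count,
      Multiset.sort_eq]

theorem sum_partMult {N : ℕ} (lam : Fin N → ℕ) (K : ℕ) (h : ∀ k, lam k < K) :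
    ∑ y ∈ range K, partMult lam y = N := by
  have := Finset.card_eq_sum_card_fiberwise (s := (univ : Finset (Fin N))) (t := range K)
    (f := lam) (fun k _ => by simpa using h k)
  rw [Finset.card_univ, Fintype.card_fin] at this
  exact this.symm

theorem partMult_eq_zero {N : ℕ} {lam : Fin N → ℕ} {i : ℕ} (h : largestPart lam < i) :
    partMult lam i = 0 := by
  rw [partMult, Finset.card_eq_zero, Finset.filter_eq_empty_iff]
  intro k _ hk
  have : lam k ≤ largestPart lam := Finset.le_sup (f := lam) (Finset.mem_univ k)
  omega

/-- The half multiplicities of a signature, as a tuple. -/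
def halfMult {N : ℕ} (K : ℕ) (lam : EvenSignature N) : Fin K → ℕ :=
  fun i => partMult lam.1 i / 2

theorem two_mul_half {N : ℕ} (lam : EvenSignature N) (i : ℕ) :
    2 * (partMult lam.1 i / 2) = partMult lam.1 i :=
  Nat.two_mul_div_two_of_even (lam.2.2 i)

theorem halfMult_mem {n L : ℕ} (lam : EvenSignature (2 * n)) (h : largestPart lam.1 ≤ L) :
    halfMult (L + 1) lam ∈ Finset.Nat.antidiagonalTuple (L + 1) n := by
  rw [Finset.Nat.mem_antidiagonalTuple]
  have h1 := sum_partMult lam.1 (L + 1) (fun k => by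
    have : lam.1 k ≤ largestPart lam.1 := Finset.le_sup (f := lam.1) (Finset.mem_univ k)
    omega)
  rw [Finset.sum_range] at h1
  have h2 : ∑ i : Fin (L + 1), 2 * halfMult (L + 1) lam i = 2 * n := by
    refine Eq.trans ?_ h1
    exact Finset.sum_congr rfl fun i _ => two_mul_half lam i
  rw [← Finset.mul_sum] at h2
  omega

theorem halfMult_injOn {n L : ℕ} {lam mu : EvenSignature (2 * n)} (hl : largestPart lam.1 ≤ L)
    (hm : largestPart mu.1 ≤ L) (h : halfMult (L + 1) lam = halfMult (L + 1) mu) : lam = mu := by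
  apply Subtype.ext
  apply eq_of_partMult_eq lam.2.1 mu.2.1
  intro i
  rcases Nat.lt_or_ge i (L + 1) with hi | hi
  · have := congrFun h ⟨i, hi⟩
    rw [← two_mul_half lam i, ← two_mul_half mu i]
    exact congrArg (2 * ·) this
  · rw [partMult_eq_zero (by omega), partMult_eq_zero (by omega)]

theorem exists_halfMult_eq {n L : ℕ} {p : Fin (L + 1) → ℕ}
    (hp : p ∈ Finset.Nat.antidiagonalTuple (L + 1) n) :
    ∃ lam : EvenSignature (2 * n), largestPart lam.1 ≤ L ∧ halfMult (L + 1) lam = p := by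
  rw [Finset.Nat.mem_antidiagonalTuple] at hp
  obtain ⟨lam, hanti, hlam⟩ := exists_antitone_of_partMult (N := 2 * n)
    (∑ i : Fin (L + 1), (2 * p i) • ({(i : ℕ)} : Multiset ℕ)) (by
      simp [Multiset.card_sum, ← hp, Finset.mul_sum])
  have hcount : ∀ j, partMult lam j = ∑ i : Fin (L + 1), if (i : ℕ) = j then 2 * p i else 0 := by
    intro j
    rw [hlam, Multiset.count_sum']
    refine Finset.sum_congr rfl fun i _ => ?_
    rw [Multiset.count_nsmul, Multiset.count_singleton]
    by_cases h : (i : ℕ) = j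
    · simp [h]
    · simp [h, Ne.symm h]
  have heven : ∀ j, Even (partMult lam j) := by
    intro j
    rw [hcount]
    apply Finset.sum_induction _ Even (fun _ _ => Even.add) (by simp)
    intro i _
    split_ifs <;> simp
  refine ⟨⟨lam, hanti, heven⟩, ?_, ?_⟩
  · apply Finset.sup_le
    intro k _
    by_contra hk
    have h0 : partMult lam (lam k) = 0 := by
      rw [hcount]
      apply Finset.sum_eq_zero
      intro i _
      rw [if_neg]
      have := i.isLt
      have hk' : ¬ lam k ≤ L := hk
      omega
    rw [partMult, Finset.card_eq_zero, Finset.filter_eq_empty_iff] at h0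
    exact h0 (Finset.mem_univ k) rfl
  · ext j
    change partMult lam j / 2 = p j
    rw [hcount, Finset.sum_eq_single j]
    · simp
    · intro i _ hi
      rw [if_neg]
      exact fun h => hi (Fin.ext h)
    · simp

theorem finite_largestPart_le (n L : ℕ) :
    {lam : EvenSignature (2 * n) | largestPart lam.1 ≤ L}.Finite := by
  apply Set.Finite.of_finite_image (f := halfMult (L + 1))
  · apply (Finset.Nat.antidiagonalTuple (L + 1) n).finite_toSet.subset
    rintro _ ⟨lam, hlam, rfl⟩
    exact halfMult_mem lam hlam
  · intro lam hl mu hm h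
    exact halfMult_injOn hl hm h

theorem sum_largestPart_le {R : Type*} [AddCommMonoid R] (n L : ℕ) (F : (Fin (L + 1) → ℕ) → R) :
    ∑ lam ∈ (finite_largestPart_le n L).toFinset, F (halfMult (L + 1) lam)
      = ∑ p ∈ Finset.Nat.antidiagonalTuple (L + 1) n, F p := by
  apply Finset.sum_bij (fun lam _ => halfMult (L + 1) lam)
  · intro lam h
    exact halfMult_mem lam (by simpa using h)
  · intro lam hl mu hm h
    exact halfMult_injOn (by simpa using hl) (by simpa using hm) h
  · intro p hp
    obtain ⟨lam, h1, h2⟩ := exists_halfMult_eq hp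
    exact ⟨lam, by simpa using h1, h2⟩
  · intro lam _
    rfl

theorem tupleProd_succ_of_zero {R : Type*} [CommSemiring R] (e : ℕ → ℕ → ℕ → R) (p : ℕ → ℕ) :
    ∀ (K x : ℕ), (∀ y, x + K ≤ y → e y 0 0 = 1) → p (x + K) = 0 →
    tupleProd e (K + 1) (fun i : Fin (K + 1) => p (x + i)) x
      = tupleProd e K (fun i : Fin K => p (x + i)) x := by
  intro K
  induction K with
  | zero =>
    intro x h hp
    rw [add_zero] at hp
    simp [tupleProd, hp, h x]
  | succ K ih =>
    intro x h hp
    rw [tupleProd]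
    conv_rhs => rw [tupleProd]
    have e1 : ∀ y : ℕ, x + (y + 1) = x + 1 + y := fun y => by ring
    have hs : (fun i : Fin (K + 1) => p (x + (i.succ : Fin (K + 1 + 1)))) =
      fun i : Fin (K + 1) => p (x + 1 + i) := by
      ext i
      rw [Fin.val_succ, e1]
    have hs' : (fun i : Fin K => p (x + (i.succ : Fin (K + 1)))) =
      fun i : Fin K => p (x + 1 + i) := by
      ext i
      rw [Fin.val_succ, e1]
    rw [hs, hs', ih (x + 1) (fun y hy => h y (by omega)) (by rw [← e1]; exact hp)]
    congr 2
    rw [Fin.sum_univ_castSucc]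
    have : p (x + 1 + K) = 0 := by rw [← e1]; exact hp
    simp [this]

/-- Columns to the right of all parts have weight one, so all signatures with parts at most L can be
summed at the common length L + 1. -/
theorem tupleProd_extend {R : Type*} [CommSemiring R] (e : ℕ → ℕ → ℕ → R) (p : ℕ → ℕ)
    (he : ∀ y, 1 ≤ y → e y 0 0 = 1) (K K' : ℕ) (hK : 1 ≤ K) (h : K ≤ K')
    (hp : ∀ i, K ≤ i → p i = 0) :
    tupleProd e K' (fun i : Fin K' => p i) 0 = tupleProd e K (fun i : Fin K => p i) 0 := by
  induction K', h using Nat.le_induction with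
  | base => rfl
  | succ m hm ih =>
    rw [← ih]
    have := tupleProd_succ_of_zero e p m 0 (fun y hy => he y (by omega)) (hp _ (by omega))
    simpa using this

/-- Summation over the even signatures of a term that is a product over columns. -/
theorem hasSum_evenSignature {n : ℕ} (e : ℕ → ℕ → ℕ → ℂ) (T : EvenSignature (2 * n) → ℂ)
    (he : ∀ y, 1 ≤ y → e y 0 0 = 1)
    (hT : ∀ lam, T lam = tupleProd e (largestPart lam.1 + 1)
      (fun i => partMult lam.1 i / 2) 0) (B : ℝ)
    (hB : ∀ L, transferSum (fun x a b => ‖e x a b‖) (L + 1) n 0 ≤ B) :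
    Summable T ∧ Filter.Tendsto (fun L => transferSum e (L + 1) n 0) Filter.atTop
      (nhds (∑' lam, T lam)) := by
  have hT' : ∀ L (lam : EvenSignature (2 * n)), largestPart lam.1 ≤ L →
      T lam = tupleProd e (L + 1) (halfMult (L + 1) lam) 0 := by
    intro L lam h
    rw [hT]
    symm
    apply tupleProd_extend e (fun i => partMult lam.1 i / 2) he _ _ (by omega) (by omega)
    intro i hi
    rw [partMult_eq_zero (by omega)]
  have hsub : ∀ S : Finset (EvenSignature (2 * n)), ∃ L, S ⊆ (finite_largestPart_le n L).toFinset := by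
    intro S
    refine ⟨S.sup fun lam => largestPart lam.1, fun lam h => ?_⟩
    simp only [Set.Finite.mem_toFinset, Set.mem_ofPred_eq]
    exact Finset.le_sup (f := fun lam : EvenSignature (2 * n) => largestPart lam.1) h
  have hsum : Summable T := by
    apply Summable.of_norm
    apply summable_of_sum_le (c := B) (fun _ => norm_nonneg _)
    intro S
    obtain ⟨L, hL⟩ := hsub S
    refine (Finset.sum_le_sum_of_subset_of_nonneg hL fun _ _ _ => norm_nonneg _).trans ?_
    refine le_trans (le_of_eq ?_) (hB L)
    rw [transferSum, ← sum_largestPart_le n L]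
    refine Finset.sum_congr rfl fun lam h => ?_
    rw [hT' L lam (by simpa using h), norm_tupleProd]
  refine ⟨hsum, ?_⟩
  -- The sets of signatures with parts at most L exhaust all signatures, so the truncations converge
  -- to the sum of the series.
  have ht : Filter.Tendsto (fun L => (finite_largestPart_le n L).toFinset) Filter.atTop
      Filter.atTop := by
    apply Filter.tendsto_atTop_finset_of_monotone
    · intro L L' hLL' lam h
      simp only [Set.Finite.mem_toFinset, Set.mem_ofPred_eq] at *
      omega
    · intro lam
      exact ⟨largestPart lam.1, by simp⟩
  refine (hsum.hasSum.comp ht).congr fun L => ?_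
  simp only [Function.comp]
  rw [transferSum, ← sum_largestPart_le n L]
  refine Finset.sum_congr rfl fun lam h => ?_
  rw [hT' L lam (by simpa using h)]

/-! ### The q-Pfaff–Saalschütz sum. -/

/-- The shifted factorial `∏_{j < n} (1 - a q ^ j)`. -/
noncomputable def qPoch (q a : ℂ) (n : ℕ) : ℂ := ∏ j ∈ range n, (1 - a * q ^ j)

theorem qPoch_succ (q a : ℂ) (n : ℕ) : qPoch q a (n + 1) = qPoch q a n * (1 - a * q ^ n) :=
  Finset.prod_range_succ _ _

/-- The summand of the `q`-Pfaff–Saalschütz sum. -/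
noncomputable def saalTerm (q s r a b : ℂ) (n p : ℕ) : ℂ :=
  qFact q n / (qFact q p * qFact q (n - p)) *
    (∏ j ∈ range p, (s - a * q ^ j) * (r - b * q ^ j) / (1 - a * b * q ^ j)) * qPoch q (s * r) (n - p)

theorem saalTerm_succ_left (q s r a b : ℂ) (n p : ℕ) (hq : ∀ n, qFact q n ≠ 0) (h : p ≤ n) :
    saalTerm q s r a b (n + 1) p * (1 - q ^ (n - p + 1))
      = saalTerm q s r a b n p * ((1 - q ^ (n + 1)) * (1 - s * r * q ^ (n - p))) := by
  have h1 := hq p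
  have h2 := hq (n - p)
  have h3 : 1 - q ^ (n - p + 1) ≠ 0 := fun h => hq (n - p + 1) (by rw [qFact_succ, h, mul_zero])
  rw [saalTerm, saalTerm, show n + 1 - p = n - p + 1 by omega, qFact_succ, qFact_succ, qPoch_succ]
  generalize ∏ j ∈ range p, (s - a * q ^ j) * (r - b * q ^ j) / (1 - a * b * q ^ j) = P
  generalize qPoch q (s * r) (n - p) = R
  field_simp

theorem saalTerm_succ_right (q s r a b : ℂ) (n p : ℕ) (hq : ∀ n, qFact q n ≠ 0) (h : p < n)
    (hab : 1 - a * b * q ^ p ≠ 0) :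
    saalTerm q s r a b n (p + 1) * ((1 - q ^ (p + 1)) * (1 - a * b * q ^ p) *
        (1 - s * r * q ^ (n - (p + 1))))
      = saalTerm q s r a b n p * ((1 - q ^ (n - p)) * ((s - a * q ^ p) * (r - b * q ^ p))) := by
  obtain ⟨m, rfl⟩ : ∃ m, n = p + 1 + m := ⟨n - (p + 1), by omega⟩
  have h1 := hq p
  have h2 := hq m
  have h3 : 1 - q ^ (m + 1) ≠ 0 := fun h => hq (m + 1) (by rw [qFact_succ, h, mul_zero])
  have h4 : 1 - q ^ (p + 1) ≠ 0 := fun h => hq (p + 1) (by rw [qFact_succ, h, mul_zero])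
  rw [saalTerm, saalTerm, show p + 1 + m - (p + 1) = m by omega, show p + 1 + m - p = m + 1 by omega,
    qFact_succ q p, qFact_succ q m, qPoch_succ, Finset.prod_range_succ]
  generalize ∏ j ∈ range p, (s - a * q ^ j) * (r - b * q ^ j) / (1 - a * b * q ^ j) = P
  generalize qPoch q (s * r) m = R
  generalize 1 - a * b * q ^ p = d at *
  field_simp

/-- The induction step of `saal_partial`, with K = q^k and M = q^{n-k-1}; X, Y, Z are the terms
(n+1, k+1), (n, k+1), (n, k). -/
theorem saal_step {q a b s r K M X Y Z : ℂ} (hd : 1 - a * b * (K * q * M) ≠ 0)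
    (hM : 1 - M * q ≠ 0)
    (hX : X * (1 - M * q) = Y * ((1 - K * q * M * q) * (1 - s * r * M)))
    (hZ : Y * ((1 - K * q) * (1 - a * b * K) * (1 - s * r * M)) =
      Z * ((1 - M * q) * ((s - a * K) * (r - b * K)))) :
    -(M * q / (1 - a * b * (K * q * M))) * ((s - a * K) * (r - b * K)) * Z +
      (X - (1 - b * s * (K * q * M)) * (1 - a * r * (K * q * M)) / (1 - a * b * (K * q * M)) * Y)
    = -(M / (1 - a * b * (K * q * M))) * ((s - a * (K * q)) * (r - b * (K * q))) * Y := by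
  have hX' : X = Y * ((1 - K * q * M * q) * (1 - s * r * M)) / (1 - M * q) := by
    rw [eq_div_iff hM, hX]
  have hZ' : (s - a * K) * (r - b * K) * Z = Y * ((1 - K * q) * (1 - a * b * K) *
      (1 - s * r * M)) / (1 - M * q) := by
    rw [eq_div_iff hM, hZ]; ring
  rw [mul_assoc _ _ Z, hZ', hX']
  clear hX hZ hX' hZ'
  generalize hd1 : 1 - a * b * (K * q * M) = d1 at *
  generalize hd2 : 1 - M * q = d2 at *
  field_simp
  subst hd1 hd2
  ring

/-- The sum satisfies a first-order recurrence in n, and the defect of the summand telescopes with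
the right side as certificate. -/
theorem saal_partial (q s r a b : ℂ) (n : ℕ) (hq : ∀ n, qFact q n ≠ 0)
    (hab : ∀ j ≤ n, 1 - a * b * q ^ j ≠ 0) : ∀ k ≤ n,
    ∑ p ∈ range (k + 1), (saalTerm q s r a b (n + 1) p -
      (1 - b * s * q ^ n) * (1 - a * r * q ^ n) / (1 - a * b * q ^ n) * saalTerm q s r a b n p)
    = - (q ^ (n - k) / (1 - a * b * q ^ n)) * ((s - a * q ^ k) * (r - b * q ^ k)) *
        saalTerm q s r a b n k := by
  have hd := hab n le_rfl
  have hone : ∀ m, 1 - q ^ (m + 1) ≠ 0 := fun m h => hq (m + 1) (by rw [qFact_succ, h, mul_zero])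
  intro k
  induction k with
  | zero =>
    intro _
    have h := saalTerm_succ_left q s r a b n 0 hq (by omega)
    rw [Nat.sub_zero] at h
    have h' := mul_right_cancel₀ (hone n) (h.trans (by ring : _ = saalTerm q s r a b n 0 *
      (1 - s * r * q ^ n) * (1 - q ^ (n + 1))))
    simp only [zero_add, Finset.sum_range_one, Nat.sub_zero, pow_zero, mul_one]
    rw [h']
    generalize hd1 : 1 - a * b * q ^ n = d at hd ⊢
    field_simp
    subst hd1
    ring
  | succ k ih =>
    intro hk
    rw [Finset.sum_range_succ, ih (by omega)]
    obtain ⟨m, rfl⟩ : ∃ m, n = k + 1 + m := ⟨n - (k + 1), by omega⟩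
    have h1 := saalTerm_succ_left q s r a b (k + 1 + m) (k + 1) hq (by omega)
    have h2 := saalTerm_succ_right q s r a b (k + 1 + m) k hq (by omega) (hab k (by omega))
    rw [show k + 1 + m - (k + 1) = m by omega] at *
    rw [show k + 1 + m - k = m + 1 by omega] at *
    generalize saalTerm q s r a b (k + 1 + m + 1) (k + 1) = X at *
    generalize saalTerm q s r a b (k + 1 + m) (k + 1) = Y at *
    generalize saalTerm q s r a b (k + 1 + m) k = Z at *
    have e1 : q ^ (k + 1 + m) = q ^ k * q * q ^ m := by ring
    have e2 : q ^ (k + 1 + m + 1) = q ^ k * q * q ^ m * q := by ring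
    rw [e1] at hd ⊢
    rw [e2] at h1
    simp only [pow_succ] at h1 h2 ⊢
    exact saal_step hd (by simpa only [pow_succ] using hone m) h1 h2

/-- At k = n the telescoped defect is minus the extra term p = n + 1, so the recurrence holds
exactly. The form is polynomial in s and r, so these may be zero. -/
theorem saalschutz (q s r a b : ℂ) (n : ℕ) (hq : ∀ n, qFact q n ≠ 0)
    (hab : ∀ j < n, 1 - a * b * q ^ j ≠ 0) :
    ∑ p ∈ range (n + 1), saalTerm q s r a b n p
      = ∏ j ∈ range n, (1 - b * s * q ^ j) * (1 - a * r * q ^ j) / (1 - a * b * q ^ j) := by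
  induction n with
  | zero => simp [saalTerm, qFact, qPoch]
  | succ n ih =>
    rw [Finset.prod_range_succ, ← ih (fun j hj => hab j (by omega)), Finset.sum_range_succ]
    have h := saal_partial q s r a b n hq (fun j hj => hab j (by omega)) n le_rfl
    rw [Finset.sum_sub_distrib, ← Finset.mul_sum, Nat.sub_self, pow_zero] at h
    have hlast : saalTerm q s r a b (n + 1) (n + 1) = 1 / (1 - a * b * q ^ n) *
        ((s - a * q ^ n) * (r - b * q ^ n)) * saalTerm q s r a b n n := by
      have h0 : qFact q 0 = 1 := rfl
      rw [saalTerm, saalTerm, Nat.sub_self, Nat.sub_self, h0, mul_one, mul_one,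
        div_self (hq _), div_self (hq _), Finset.prod_range_succ]
      ring
    rw [hlast]
    linear_combination h

/-! ### Even column weights and the stationary solution. -/

theorem prod_range_two_mul {R : Type*} [CommMonoid R] (F : ℕ → R) (m : ℕ) :
    ∏ j ∈ range (2 * m), F j = ∏ j ∈ range m, F (2 * j) * F (2 * j + 1) := by
  induction m with
  | zero => simp
  | succ m ih =>
    rw [show 2 * (m + 1) = 2 * m + 1 + 1 by ring, Finset.prod_range_succ, Finset.prod_range_succ,
      Finset.prod_range_succ, ih, mul_assoc]

theorem qFact_two_mul (t : ℂ) (m : ℕ) : qFact t (2 * m) = qPoch (t ^ 2) t m * qFact (t ^ 2) m := by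
  rw [qFact, prod_range_two_mul, qPoch, qFact, ← Finset.prod_mul_distrib]
  refine Finset.prod_congr rfl fun j _ => ?_
  ring

/-- The weight of a column from which `2 a` of `2 a + 2 b` entering paths leave at the top,
together with its boundary coefficient. -/
noncomputable def evenWeight (t g s c : ℂ) (a b : ℕ) : ℂ :=
  (∏ j ∈ range a, (1 - s ^ 2 * g * t ^ (2 * j)) / (1 - g * t ^ (2 * (j + 1)))) *
    fusedWeight t g s c 0 (2 * b) (2 * a)

/-- The boundary denominators cancel the factors 1 - g t^h with h even, and (t;t)_{2m} splits into
(t;t²)_m (t²;t²)_m; the rest is a Saalschütz summand in base t². -/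
theorem evenWeight_eq {t g s c : ℂ} {a b : ℕ} (hg : ∀ j < a, 1 - g * t ^ (2 * (j + 1)) ≠ 0) :
    evenWeight t g s c a b =
      qPoch (t ^ 2) (s ^ 2 * g) a * qPoch (t ^ 2) (g * t) a *
        (qPoch (t ^ 2) t (a + b) * qFact (t ^ 2) (a + b) /
          (qPoch (t ^ 2) t b * qFact (t ^ 2) b * (qPoch (t ^ 2) t a * qFact (t ^ 2) a))) *
        (∏ j ∈ range b, (s * g - c * (t ^ 2) ^ j) * (s * g - c * t * (t ^ 2) ^ j)) /
        ∏ j ∈ range (2 * (a + b)), (1 - s * (c * t ^ j)) := by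
  have h1 : (∏ j ∈ range a, (1 - s ^ 2 * g * t ^ (2 * j)) / (1 - g * t ^ (2 * (j + 1)))) *
      ∏ h ∈ range (2 * a), (1 - g * t ^ (0 + h + 1)) =
      qPoch (t ^ 2) (s ^ 2 * g) a * qPoch (t ^ 2) (g * t) a := by
    rw [prod_range_two_mul, qPoch, qPoch, ← Finset.prod_mul_distrib, ← Finset.prod_mul_distrib]
    refine Finset.prod_congr rfl fun j hj => ?_
    have h := hg j (mem_range.1 hj)
    rw [show 0 + (2 * j + 1) + 1 = 2 * (j + 1) by ring, ← pow_mul]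
    rw [div_mul_eq_mul_div, div_eq_iff h]
    ring
  have h2 : ∏ j ∈ range (2 * b), (c * t ^ j - s * g * t ^ 0) =
      ∏ j ∈ range b, (s * g - c * (t ^ 2) ^ j) * (s * g - c * t * (t ^ 2) ^ j) := by
    rw [prod_range_two_mul]
    refine Finset.prod_congr rfl fun j _ => ?_
    ring
  rw [evenWeight, fusedWeight, h2, show 2 * b + 2 * a = 2 * (a + b) by ring, qFact_two_mul,
    qFact_two_mul, qFact_two_mul, ← h1]
  ring

/-- The ratio of shifted factorials that is stationary under the columns `x ≥ 1`. -/
noncomputable def stationary (t c : ℂ) (k : ℕ) : ℂ :=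
  qPoch (t ^ 2) t k / qPoch (t ^ 2) (c ^ 2 * t) k

theorem qPoch_ne_zero {q a : ℂ} {n : ℕ} (h : ∀ j < n, 1 - a * q ^ j ≠ 0) : qPoch q a n ≠ 0 :=
  Finset.prod_ne_zero_iff.2 fun j hj => h j (mem_range.1 hj)

theorem qFact_ne_zero {q : ℂ} {n : ℕ} (h : ∀ j, 1 - q ^ (j + 1) ≠ 0) : qFact q n ≠ 0 :=
  Finset.prod_ne_zero_iff.2 fun j _ => h j

theorem one_sub_sq_pow_ne {t : ℂ} (ht : ∀ j, 1 - t ^ (j + 1) ≠ 0) (j : ℕ) :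
    1 - (t ^ 2) ^ (j + 1) ≠ 0 := by
  rw [← pow_mul, show 2 * (j + 1) = 2 * j + 1 + 1 by ring]
  exact ht _

theorem one_sub_mul_sq_pow_ne {t : ℂ} (ht : ∀ j, 1 - t ^ (j + 1) ≠ 0) (j : ℕ) :
    1 - t * (t ^ 2) ^ j ≠ 0 := by
  rw [← pow_mul, ← pow_succ']
  exact ht _

theorem qPoch_mul_saalTerm {q u s r a b : ℂ} {k p m : ℕ} (h : m + p = k) :
    qFact q k / (qFact q m * qFact q p) * (∏ j ∈ range p, (s - a * q ^ j) * (r - b * q ^ j)) *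
        qPoch q (s * r) m / qPoch q (a * b) p * u = u * saalTerm q s r a b k p := by
  subst h
  rw [saalTerm, Nat.add_sub_cancel, Finset.prod_div_distrib, mul_comm (qFact q p)]
  simp only [qPoch]
  ring

/-- Saalschütz with parameters s, s, c, ct. The numerator of its product side is exactly the
denominator of the column weight, so s drops out and one function serves all columns. -/
theorem sum_evenWeight_mul_stationary {t s c : ℂ} {k : ℕ} (ht : ∀ j, 1 - t ^ (j + 1) ≠ 0)
    (hc : ∀ j < k, 1 - c ^ 2 * t * (t ^ 2) ^ j ≠ 0) (hs : ∀ j < 2 * k, 1 - s * (c * t ^ j) ≠ 0) :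
    ∑ ab ∈ antidiagonal k, evenWeight t 1 s c ab.1 ab.2 * stationary t c ab.2 = stationary t c k := by
  have hQ := one_sub_sq_pow_ne ht
  have hT := one_sub_mul_sq_pow_ne ht
  have hD := Finset.prod_ne_zero_iff.2 fun j hj => hs j (mem_range.1 hj)
  have key : ∀ ab ∈ antidiagonal k, evenWeight t 1 s c ab.1 ab.2 * stationary t c ab.2 =
      qPoch (t ^ 2) t k / (∏ j ∈ range (2 * k), (1 - s * (c * t ^ j))) *
        saalTerm (t ^ 2) s s c (c * t) k ab.2 := by
    rintro ⟨a, b⟩ hab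
    rw [HasAntidiagonal.mem_antidiagonal] at hab
    subst hab
    have ha := qPoch_ne_zero (n := a) fun j _ => hT j
    have hb := qPoch_ne_zero (n := b) fun j _ => hT j
    rw [evenWeight_eq (fun j _ => by rw [one_mul]; exact ht _), ← qPoch_mul_saalTerm rfl, stationary,
      show c * (c * t) = c ^ 2 * t by ring, show s ^ 2 * 1 = s * s by ring]
    simp only [one_mul, mul_one]
    generalize ∏ j ∈ range b, (s - c * (t ^ 2) ^ j) * (s - c * t * (t ^ 2) ^ j) = P
    generalize qPoch (t ^ 2) t a = A at *
    generalize qPoch (t ^ 2) t b = B at *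
    field_simp
  rw [Finset.sum_congr rfl key, ← Finset.mul_sum,
    ← Finset.Nat.sum_antidiagonal_swap (f := fun ab : ℕ × ℕ =>
      saalTerm (t ^ 2) s s c (c * t) k ab.2)]
  rw [Finset.Nat.sum_antidiagonal_eq_sum_range_succ_mk]
  simp only [Prod.swap_prod_mk]
  rw [saalschutz (t ^ 2) s s c (c * t) k (fun n => qFact_ne_zero hQ)
    (fun j hj => by rw [show c * (c * t) = c ^ 2 * t by ring]; exact hc j hj),
    Finset.prod_div_distrib, stationary, div_mul_div_comm, mul_comm (qPoch _ _ _), ← div_mul_div_comm]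
  have h1 : ∏ j ∈ range k, (1 - c * t * s * (t ^ 2) ^ j) * (1 - c * s * (t ^ 2) ^ j) =
      ∏ j ∈ range (2 * k), (1 - s * (c * t ^ j)) := by
    rw [prod_range_two_mul]
    refine Finset.prod_congr rfl fun j _ => ?_
    ring
  rw [h1, div_self hD, one_mul, show c * (c * t) = c ^ 2 * t by ring]
  rfl

/-- At c = 1/(gs) the straight-path factors become (gs)^{2b}(c²;t²)_b(c²t;t²)_b, which cancels the
denominator of `stationary`. A Saalschütz sum over the other index a remains, and the prefactor ∏(1
- t^j/g) is the denominator of column 0. -/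
theorem sum_evenWeight_zero_mul_stationary {t g s : ℂ} {n : ℕ} (ht0 : t ≠ 0)
    (ht : ∀ j, 1 - t ^ (j + 1) ≠ 0) (hg0 : g ≠ 0) (hs0 : s ≠ 0)
    (hg : ∀ j < n, 1 - g * t ^ (2 * (j + 1)) ≠ 0)
    (hc : ∀ j < n, 1 - (1 / (g * s)) ^ 2 * t * (t ^ 2) ^ j ≠ 0)
    (hs : ∀ j < 2 * n, 1 - s * (1 / (g * s) * t ^ j) ≠ 0) :
    (∏ j ∈ range (2 * n), (1 - t ^ j * g⁻¹)) *
      ∑ ab ∈ antidiagonal n, evenWeight t g s (1 / (g * s)) ab.1 ab.2 *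
        stationary t (1 / (g * s)) ab.2 =
      (-1) ^ n * g ^ n * t ^ (n ^ 2) * ∏ j ∈ Icc 1 n,
        ((1 - s ^ 2 * g * t ^ (-2 * (j : ℤ) + 1)) * (1 - g⁻¹ * t ^ (2 * j - 2))) := by
  have hQ := one_sub_sq_pow_ne ht
  have hT := one_sub_mul_sq_pow_ne ht
  have hD := Finset.prod_ne_zero_iff.2 fun j hj => hs j (mem_range.1 hj)
  have hD' : ∏ j ∈ range (2 * n), (1 - t ^ j * g⁻¹) =
      ∏ j ∈ range (2 * n), (1 - s * (1 / (g * s) * t ^ j)) := by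
    refine Finset.prod_congr rfl fun j _ => ?_
    field_simp
  have key : ∀ ab ∈ antidiagonal n, evenWeight t g s (1 / (g * s)) ab.1 ab.2 *
      stationary t (1 / (g * s)) ab.2 =
      qPoch (t ^ 2) t n / (∏ j ∈ range (2 * n), (1 - s * (1 / (g * s) * t ^ j))) *
        (g * s) ^ (2 * n) *
        saalTerm (t ^ 2) (1 / (g * s)) (1 / (g * s)) s (t / s) n ab.1 := by
    rintro ⟨a, b⟩ hab
    rw [HasAntidiagonal.mem_antidiagonal] at hab
    subst hab
    have ha := qPoch_ne_zero (n := a) fun j _ => hT j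
    have hb := qPoch_ne_zero (n := b) fun j _ => hT j
    have hp : qPoch (t ^ 2) (s ^ 2 * g) a * qPoch (t ^ 2) (g * t) a = (g * s) ^ (2 * a) *
        ∏ j ∈ range a, (1 / (g * s) - s * (t ^ 2) ^ j) * (1 / (g * s) - t / s * (t ^ 2) ^ j) := by
      rw [pow_mul, qPoch, qPoch, ← Finset.prod_mul_distrib, ← Finset.card_range a,
        ← Finset.prod_const, Finset.card_range, ← Finset.prod_mul_distrib]
      refine Finset.prod_congr rfl fun j _ => ?_
      field_simp
    have hr : ∏ j ∈ range b, (s * g - 1 / (g * s) * (t ^ 2) ^ j) *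
        (s * g - 1 / (g * s) * t * (t ^ 2) ^ j) = (g * s) ^ (2 * b) *
        (qPoch (t ^ 2) (1 / (g * s) * (1 / (g * s))) b *
          qPoch (t ^ 2) ((1 / (g * s)) ^ 2 * t) b) := by
      rw [pow_mul, qPoch, qPoch, ← Finset.prod_mul_distrib, ← Finset.card_range b,
        ← Finset.prod_const, Finset.card_range, ← Finset.prod_mul_distrib]
      refine Finset.prod_congr rfl fun j _ => ?_
      field_simp
    have hcb := qPoch_ne_zero (n := b) fun j hj => hc j (by omega)
    rw [evenWeight_eq (fun j hj => hg j (by omega)), ← qPoch_mul_saalTerm (add_comm b a), stationary,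
      hp, hr, show s * (t / s) = t by field_simp, mul_add, pow_add]
    generalize ∏ j ∈ range a, (1 / (g * s) - s * (t ^ 2) ^ j) *
      (1 / (g * s) - t / s * (t ^ 2) ^ j) = P
    generalize ∏ j ∈ range (2 * a + 2 * b), (1 - s * (1 / (g * s) * t ^ j)) = D at *
    generalize qPoch (t ^ 2) (1 / (g * s) * (1 / (g * s))) b = R
    generalize qPoch (t ^ 2) ((1 / (g * s)) ^ 2 * t) b = S at *
    generalize qPoch (t ^ 2) t a = A at *
    generalize qPoch (t ^ 2) t b = B at *
    generalize (g * s) ^ (2 * a) = G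
    generalize (g * s) ^ (2 * b) = H
    field_simp
  rw [Finset.sum_congr rfl key, ← Finset.mul_sum,
    Finset.Nat.sum_antidiagonal_eq_sum_range_succ_mk, hD', ← mul_assoc, ← mul_assoc,
    mul_div_cancel₀ _ hD,
    saalschutz (t ^ 2) _ _ s (t / s) n (fun n => qFact_ne_zero hQ)
      (fun j _ => by rw [show s * (t / s) = t by field_simp]; exact hT j),
    Finset.prod_div_distrib, show s * (t / s) = t by field_simp,
    show ∏ j ∈ range n, (1 - t * (t ^ 2) ^ j) = qPoch (t ^ 2) t n from rfl, mul_assoc,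
    mul_comm (qPoch _ _ _), mul_assoc, div_mul_cancel₀ _ (qPoch_ne_zero fun j _ => hT j),
    prod_Icc_one_eq_prod_range]
  have hsq : ∀ n : ℕ, (-1) ^ n * g ^ n * t ^ (n ^ 2) = ∏ j ∈ range n, -(g * t ^ (2 * j + 1)) := by
    intro n
    induction n with
    | zero => simp
    | succ n ih => rw [Finset.prod_range_succ, ← ih]; ring
  rw [hsq, pow_mul, ← Finset.prod_mul_distrib, ← Finset.card_range n, ← Finset.prod_const,
    Finset.card_range, ← Finset.prod_mul_distrib]
  refine Finset.prod_congr rfl fun j _ => ?_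
  rw [show (-2 * ((j + 1 : ℕ) : ℤ) + 1) = -((2 * j + 1 : ℕ) : ℤ) by push_cast; ring, zpow_neg,
    zpow_natCast, show 2 * (j + 1) - 2 = 2 * j by omega, ← pow_mul]
  field_simp
  ring

/-! ### The terms of the partition function as products over columns. -/

theorem prod_mul_columnProd {A : ℕ → ℂ} {E : ℕ → ℕ → ℂ} {e : ℕ → ℕ → ℕ → ℂ} {m p : ℕ → ℕ}
    (hm : ∀ x, 2 * p x = m x) (he : ∀ x l, A x * E x (2 * l) = e x (p x) l) (K : ℕ) : ∀ x₀,
    (∏ y ∈ range K, A (x₀ + y)) * columnProd E m K x₀ =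
      tupleProd e K (fun i => p (x₀ + i)) x₀ := by
  induction K with
  | zero => intro x₀; simp [columnProd, tupleProd]
  | succ K ih =>
    intro x₀
    have h1 : ∑ y ∈ range K, m (x₀ + 1 + y) = 2 * ∑ y ∈ range K, p (x₀ + 1 + y) := by
      rw [Finset.mul_sum]
      exact Finset.sum_congr rfl fun y _ => (hm _).symm
    have h2 := ih (x₀ + 1)
    rw [Finset.prod_range_succ', columnProd, tupleProd, h1]
    simp only [Fin.val_zero, Fin.val_succ, Nat.add_zero]
    rw [Finset.sum_range (fun y => p (x₀ + 1 + y))]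
    have h3 : ∀ y, x₀ + (y + 1) = x₀ + 1 + y := fun y => by ring
    rw [Finset.prod_congr rfl fun y _ => congrArg A (h3 y),
      show (fun i : Fin K => p (x₀ + (i + 1))) = fun i : Fin K => p (x₀ + 1 + i) from
        funext fun i => congrArg p (h3 i), ← h2, ← he]
    ring

theorem boundaryCoeff_eq (t α : ℂ) (s : ℕ → ℂ) {N : ℕ} (lam : Fin N → ℕ) :
    boundaryCoeff t α s lam = ∏ x ∈ range (largestPart lam + 1), ∏ j ∈ range (partMult lam x / 2),
      (1 - s x ^ 2 * (if x = 0 then t ^ α else 1) * t ^ (2 * j)) /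
        (1 - (if x = 0 then t ^ α else 1) * t ^ (2 * (j + 1))) := by
  rw [boundaryCoeff, Finset.prod_range_succ', prod_Icc_one_eq_prod_range, prod_Icc_one_eq_prod_range,
    mul_comm]
  simp only [if_true, Nat.add_eq_zero_iff, one_ne_zero, and_false, if_false, mul_one, one_mul,
    prod_Icc_one_eq_prod_range, show ∀ l, 2 * (l + 1) - 2 = 2 * l from fun l => by omega]

theorem partitionTerm_eq_tupleProd {t c α : ℂ} {s : ℕ → ℂ} {N : ℕ} (hq : ∀ n, qFact t n ≠ 0)
    (hs : ∀ x, ∀ j < N, 1 - s x * (c * t ^ j) ≠ 0) (lam : EvenSignature N) :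
    partitionTerm t α s (fun i : Fin N => c * t ^ (N - 1 - (i : ℕ))) lam =
      tupleProd (fun x a b => evenWeight t (if x = 0 then t ^ α else 1) (s x) c a b)
        (largestPart lam.1 + 1) (fun i => partMult lam.1 i / 2) 0 := by
  have hN := sum_partMult lam.1 (largestPart lam.1 + 1) fun k =>
    Nat.lt_succ_of_le (Finset.le_sup (f := lam.1) (Finset.mem_univ k))
  rw [partitionTerm, boundaryCoeff_eq, spinHL_eq_columnProd hq hs lam.1 hN]
  have h := prod_mul_columnProd (A := fun x => ∏ j ∈ range (partMult lam.1 x / 2),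
      (1 - s x ^ 2 * (if x = 0 then t ^ α else 1) * t ^ (2 * j)) /
        (1 - (if x = 0 then t ^ α else 1) * t ^ (2 * (j + 1))))
    (E := fun x l => fusedWeight t (if x = 0 then t ^ α else 1) (s x) c 0 l (partMult lam.1 x))
    (e := fun x a b => evenWeight t (if x = 0 then t ^ α else 1) (s x) c a b)
    (m := partMult lam.1) (p := fun x => partMult lam.1 x / 2) (two_mul_half lam)
    (by
      intro x l
      simp only [evenWeight, two_mul_half])
    (largestPart lam.1 + 1) 0
  simpa only [zero_add] using h

/-! ### Bounds on the column weights. -/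

/-- From 1 - u² = (1-su) - u(u-s) and s(1-u²) = u(1-su) - (u-s). This yields bounds uniform in the
column, although the s_x are not assumed bounded. -/
theorem one_add_norm_div_le {u s : ℂ} (hd : 1 - s * u ≠ 0) (h : ‖(u - s) / (1 - s * u)‖ < 1) :
    (1 + ‖s‖) / ‖1 - s * u‖ ≤ 2 * (1 + ‖u‖) / ‖1 - u ^ 2‖ := by
  have hd' : 0 < ‖1 - s * u‖ := norm_pos_iff.2 hd
  rw [norm_div, div_lt_one hd'] at h
  have hu : 1 - u ^ 2 ≠ 0 := by
    -- If u² = 1, then 1 - su = u(u - s) has the same norm as u - s, against `h`.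
    intro hu
    have e : 1 - s * u = u * (u - s) := by linear_combination hu
    have hn : ‖u‖ = 1 := by
      have : ‖u‖ ^ 2 = 1 := by
        rw [← norm_pow, ← sub_eq_zero.1 hu, norm_one]
      nlinarith [norm_nonneg u]
    rw [e, norm_mul, hn, one_mul] at h
    exact lt_irrefl _ h
  rw [div_le_div_iff₀ hd' (norm_pos_iff.2 hu)]
  have h1 : ‖1 - u ^ 2‖ ≤ (1 + ‖u‖) * ‖1 - s * u‖ := by
    calc ‖1 - u ^ 2‖ = ‖(1 - s * u) - u * (u - s)‖ := by congr 1; ring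
      _ ≤ ‖1 - s * u‖ + ‖u * (u - s)‖ := norm_sub_le _ _
      _ ≤ _ := by
        rw [norm_mul]
        nlinarith [norm_nonneg u]
  have h2 : ‖s‖ * ‖1 - u ^ 2‖ ≤ (1 + ‖u‖) * ‖1 - s * u‖ := by
    calc ‖s‖ * ‖1 - u ^ 2‖ = ‖u * (1 - s * u) - (u - s)‖ := by rw [← norm_mul]; congr 1; ring
      _ ≤ ‖u * (1 - s * u)‖ + ‖u - s‖ := norm_sub_le _ _
      _ ≤ _ := by
        rw [norm_mul]
        nlinarith [norm_nonneg u]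
  linarith

theorem evenWeight_zero_left {t s c : ℂ} (hq : ∀ n, qFact t n ≠ 0) (k : ℕ) :
    evenWeight t 1 s c 0 k = ∏ j ∈ range (2 * k), (c * t ^ j - s) / (1 - s * (c * t ^ j)) := by
  have h0 : qFact t 0 = 1 := rfl
  rw [evenWeight, fusedWeight, mul_zero, Finset.prod_range_zero, Finset.prod_range_zero, add_zero, h0,
    mul_one, div_self (hq _), Finset.prod_div_distrib]
  simp

theorem norm_evenWeight_zero_left_le {t s c : ℂ} {ρ : ℝ} (hq : ∀ n, qFact t n ≠ 0) (hρ : 0 ≤ ρ)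
    (hρ1 : ρ ≤ 1) {k : ℕ} (hk : 1 ≤ k)
    (h : ∀ j < 2 * k, ‖(c * t ^ j - s) / (1 - s * (c * t ^ j))‖ ≤ ρ) :
    ‖evenWeight t 1 s c 0 k‖ ≤ ρ := by
  rw [evenWeight_zero_left hq, norm_prod]
  refine (Finset.prod_le_prod (fun _ _ => norm_nonneg _) fun j hj => h j (mem_range.1 hj)).trans ?_
  rw [Finset.prod_const, Finset.card_range]
  exact pow_le_of_le_one hρ hρ1 (by omega)

/-- The part of the column weight that does not depend on the spin parameter. -/
noncomputable def evenConst (t : ℂ) (a b : ℕ) : ℂ :=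
  (∏ j ∈ range a, (1 - 1 * t ^ (2 * (j + 1))))⁻¹ * (∏ h ∈ range (2 * a), (1 - 1 * t ^ (0 + h + 1))) *
    (qFact t (2 * b + 2 * a) / (qFact t (2 * b) * qFact t (2 * a)))

theorem evenWeight_one (t s c : ℂ) (a b : ℕ) : evenWeight t 1 s c a b = evenConst t a b *
    (∏ j ∈ range a, (1 - s ^ 2 * t ^ (2 * j))) *
    (∏ j ∈ range (2 * a), (1 - s * (c * t ^ (2 * b + j)))⁻¹) *
    ∏ j ∈ range (2 * b), (c * t ^ j - s) / (1 - s * (c * t ^ j)) := by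
  rw [evenWeight, fusedWeight, evenConst, Finset.prod_range_add, Finset.prod_div_distrib,
    Finset.prod_div_distrib, Finset.prod_inv_distrib]
  simp only [mul_one, pow_zero]
  ring

/-- Each 1 - s²t^{2j} is at most (1 + ‖s‖)², which pairs with two of the 2a denominators left over
once the 2b straight rows have been bounded by one. -/
theorem norm_evenWeight_le {t s c : ℂ} {M : ℝ} {a b : ℕ} (ht : ‖t‖ ≤ 1)
    (hw : ∀ j < 2 * b, ‖(c * t ^ j - s) / (1 - s * (c * t ^ j))‖ ≤ 1)
    (hM : ∀ j < 2 * (a + b), (1 + ‖s‖) / ‖1 - s * (c * t ^ j)‖ ≤ M) :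
    ‖evenWeight t 1 s c a b‖ ≤ ‖evenConst t a b‖ * M ^ (2 * a) := by
  have h1 : ‖∏ j ∈ range (2 * b), (c * t ^ j - s) / (1 - s * (c * t ^ j))‖ ≤ 1 := by
    rw [norm_prod]
    exact Finset.prod_le_one (fun _ _ => norm_nonneg _) fun j hj => hw j (mem_range.1 hj)
  have h2 : ‖∏ j ∈ range a, (1 - s ^ 2 * t ^ (2 * j))‖ ≤ (1 + ‖s‖) ^ (2 * a) := by
    rw [norm_prod, pow_mul]
    refine (Finset.prod_le_prod (fun _ _ => norm_nonneg _) (g := fun _ => (1 + ‖s‖) ^ 2)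
      fun j _ => ?_).trans (by rw [Finset.prod_const, Finset.card_range])
    refine (norm_sub_le _ _).trans ?_
    rw [norm_one, norm_mul, norm_pow, norm_pow]
    have := pow_le_one₀ (n := 2 * j) (norm_nonneg t) ht
    nlinarith [norm_nonneg s, sq_nonneg ‖s‖]
  have h3 : (1 + ‖s‖) ^ (2 * a) * ‖∏ j ∈ range (2 * a), (1 - s * (c * t ^ (2 * b + j)))⁻¹‖ ≤
      M ^ (2 * a) := by
    rw [norm_prod, ← Finset.card_range (2 * a), ← Finset.prod_const, ← Finset.prod_const,
      Finset.card_range, ← Finset.prod_mul_distrib]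
    refine Finset.prod_le_prod (fun _ _ => by positivity) fun j hj => ?_
    rw [norm_inv, ← div_eq_mul_inv]
    exact hM _ (by have := mem_range.1 hj; omega)
  rw [evenWeight_one, mul_assoc, mul_assoc, norm_mul]
  refine mul_le_mul_of_nonneg_left ?_ (norm_nonneg _)
  rw [← mul_assoc, norm_mul, norm_mul]
  calc _ ≤ (1 + ‖s‖) ^ (2 * a) * ‖∏ j ∈ range (2 * a), (1 - s * (c * t ^ (2 * b + j)))⁻¹‖ * 1 := by
        gcongr
    _ ≤ _ := by rw [mul_one]; exact h3

/-! ### Assembly. -/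

theorem partitionFunction_specialization (n : ℕ) {t : ℝ} (ht0 : 0 < t) (ht1 : t < 1) {α γ : ℂ}
    (hγ : γ = (t : ℂ) ^ α) {s : ℕ → ℂ} (hs0 : s 0 ≠ 0)
    (hden : ∀ m ∈ Finset.Icc 1 (4 * n - 2), (γ * s 0) ^ 2 ≠ (t : ℂ) ^ m)
    (hA : Admissible t α s (specialization n t γ (s 0))) :
    Summable (partitionTerm t α s (specialization n t γ (s 0))) ∧
      (∏ j ∈ range (2 * n), (1 - (t : ℂ) ^ j * γ⁻¹)) *
        partitionFunction t α s (specialization n t γ (s 0)) =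
      (-1) ^ n * γ ^ n * (t : ℂ) ^ (n ^ 2) * ∏ j ∈ Icc 1 n,
        ((1 - s 0 ^ 2 * γ * (t : ℂ) ^ (-2 * (j : ℤ) + 1)) *
          (1 - γ⁻¹ * (t : ℂ) ^ (2 * j - 2))) := by
  have ht : (t : ℂ) ≠ 0 := by exact_mod_cast ht0.ne'
  have hγ0 : γ ≠ 0 := by
    rw [hγ, Complex.cpow_def_of_ne_zero ht]
    exact Complex.exp_ne_zero _
  have htn : ‖(t : ℂ)‖ ≤ 1 := by
    rw [Complex.norm_real, Real.norm_of_nonneg ht0.le]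
    exact ht1.le
  have htp : ∀ j, 1 - (t : ℂ) ^ (j + 1) ≠ 0 := by
    intro j h
    have h2 : t ^ (j + 1) = 1 := by exact_mod_cast (sub_eq_zero.1 h).symm
    exact (pow_lt_one₀ ht0.le ht1 (Nat.succ_ne_zero j)).ne h2
  have hq : ∀ n, qFact (t : ℂ) n ≠ 0 := fun n => qFact_ne_zero htp
  generalize hc : 1 / (γ * s 0) = c
  have hu : specialization n t γ (s 0) = fun i : Fin (2 * n) => c * (t : ℂ) ^ (2 * n - 1 - (i : ℕ)) :=
    funext fun i => by rw [specialization_eq, hc]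
  rw [hu] at hA ⊢
  obtain ⟨hA1, hA2, ε, hε, hA3⟩ := hA
  have hs : ∀ x, ∀ j < 2 * n, 1 - s x * (c * (t : ℂ) ^ j) ≠ 0 := by
    intro x j hj
    have h := hA1 ⟨2 * n - 1 - j, by omega⟩ x
    beta_reduce at h
    rwa [show 2 * n - 1 - (2 * n - 1 - j) = j by omega] at h
  have hw : ∀ x, 1 ≤ x → ∀ j < 2 * n,
      ‖(c * (t : ℂ) ^ j - s x) / (1 - s x * (c * (t : ℂ) ^ j))‖ ≤ 1 - ε := by
    intro x hx j hj
    have h := hA3 ⟨2 * n - 1 - j, by omega⟩ x hx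
    beta_reduce at h
    rwa [show 2 * n - 1 - (2 * n - 1 - j) = j by omega] at h
  have hct : ∀ j < n, 1 - c ^ 2 * t * ((t : ℂ) ^ 2) ^ j ≠ 0 := by
    intro j hj h
    apply hden (2 * j + 1) (Finset.mem_Icc.2 ⟨by omega, by omega⟩)
    rw [← hc] at h
    field_simp at h
    linear_combination h
  have hg : ∀ j < n, 1 - γ * (t : ℂ) ^ (2 * (j + 1)) ≠ 0 := by
    intro j hj
    rw [hγ]
    exact hA2 (j + 1) (Finset.mem_Icc.2 ⟨by omega, by omega⟩)
  set e : ℕ → ℕ → ℕ → ℂ := fun x a b =>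
    evenWeight (t : ℂ) (if x = 0 then (t : ℂ) ^ α else 1) (s x) c a b with he
  have hex : ∀ x, 1 ≤ x → ∀ a b, e x a b = evenWeight (t : ℂ) 1 (s x) c a b := by
    intro x hx a b
    simp only [he, if_neg (show x ≠ 0 by omega)]
  have he0 : ∀ x, 1 ≤ x → e x 0 0 = 1 := by
    intro x hx
    rw [hex x hx, evenWeight_zero_left hq, mul_zero, Finset.prod_range_zero]
  -- The maximum is taken because for n = 0 nothing forces ε ≤ 1.
  have hρ : (0 : ℝ) ≤ max (1 - ε) 0 := le_max_right _ _
  have hρ1 : max (1 - ε) 0 < 1 := max_lt (by linarith) one_pos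
  have heρ : ∀ x, 1 ≤ x → ∀ k, 1 ≤ k → k ≤ n → ‖e x 0 k‖ ≤ max (1 - ε) 0 := by
    intro x hx k hk hkn
    rw [hex x hx]
    exact norm_evenWeight_zero_left_le hq hρ hρ1.le hk fun j hj =>
      (hw x hx j (by omega)).trans (le_max_left _ _)
  -- A sum over the rows dominates each row's bound and does not involve the column.
  set M : ℝ := ∑ j ∈ range (2 * n), 2 * (1 + ‖c * (t : ℂ) ^ j‖) / ‖1 - (c * (t : ℂ) ^ j) ^ 2‖ with hM
  have hM0 : 0 ≤ M := Finset.sum_nonneg fun j _ => by positivity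
  have hCab : ∀ a b, 0 ≤ ‖evenConst (t : ℂ) a b‖ * M ^ (2 * a) := fun a b => by positivity
  set C : ℝ := ∑ a ∈ range (n + 1), ∑ b ∈ range (n + 1), ‖evenConst (t : ℂ) a b‖ * M ^ (2 * a) with hC
  have hC0 : 0 ≤ C := Finset.sum_nonneg fun a _ => Finset.sum_nonneg fun b _ => hCab a b
  have heC : ∀ x, 1 ≤ x → ∀ a b, a + b ≤ n → ‖e x a b‖ ≤ C := by
    intro x hx a b hab
    rw [hex x hx]
    refine (norm_evenWeight_le (M := M) htn (fun j hj => (hw x hx j (by omega)).trans (by linarith))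
      fun j hj => ?_).trans ?_
    · have h := hw x hx j (by omega)
      refine (one_add_norm_div_le (hs x j (by omega)) (by linarith)).trans ?_
      exact Finset.single_le_sum (f := fun j =>
        2 * (1 + ‖c * (t : ℂ) ^ j‖) / ‖1 - (c * (t : ℂ) ^ j) ^ 2‖) (fun j _ => by positivity)
        (Finset.mem_range.2 (by omega))
    · refine le_trans ?_ (Finset.single_le_sum (f := fun a => ∑ b ∈ range (n + 1),
        ‖evenConst (t : ℂ) a b‖ * M ^ (2 * a)) (fun a _ => Finset.sum_nonneg fun b _ => hCab a b)
        (Finset.mem_range.2 (show a < n + 1 by omega)))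
      exact Finset.single_le_sum (f := fun b => ‖evenConst (t : ℂ) a b‖ * M ^ (2 * a))
        (fun b _ => hCab a b) (Finset.mem_range.2 (by omega))
  obtain ⟨B, hB, hBL⟩ := exists_transferSum_norm_le hρ hρ1 hC0 he0 heρ heC
  have hlim := tendsto_transferSum hρ hρ1 hC0 he0 heρ heC (stationary (t : ℂ) c)
    (by simp [stationary, qPoch])
    (by
      intro x hx k hk
      simp only [hex x hx]
      exact sum_evenWeight_mul_stationary htp (fun j hj => hct j (by omega))
        fun j hj => hs x j (by omega))
  obtain ⟨hsum, hlim'⟩ := hasSum_evenSignature e _ he0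
    (partitionTerm_eq_tupleProd (α := α) hq hs)
    (∑ ab ∈ antidiagonal n, ‖e 0 ab.1 ab.2‖ * B)
    (by
      intro L
      rw [transferSum_succ]
      refine Finset.sum_le_sum fun ab hab => ?_
      rw [HasAntidiagonal.mem_antidiagonal] at hab
      exact mul_le_mul_of_nonneg_left (hBL _ (by omega) L) (norm_nonneg _))
  refine ⟨hsum, ?_⟩
  -- Column 0 is a fixed finite combination in front of the limit over the columns x ≥ 1, to which
  -- alone the contraction bounds apply.
  have hlim0 : Filter.Tendsto (fun L => transferSum e (L + 1) n 0) Filter.atTop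
      (nhds (∑ ab ∈ antidiagonal n, e 0 ab.1 ab.2 * stationary (t : ℂ) c ab.2)) := by
    simp only [transferSum_succ]
    refine tendsto_finsetSum _ fun ab hab => ?_
    rw [HasAntidiagonal.mem_antidiagonal] at hab
    exact (hlim ab.2 (by omega)).const_mul _
  rw [partitionFunction, tendsto_nhds_unique hlim' hlim0]
  subst hc
  simp only [he, if_true, ← hγ]
  exact sum_evenWeight_zero_mul_stationary ht htp hγ0 hs0 hg hct (hs 0)

theorem mainTheorem3 (n : ℕ) (t : ℝ) (ht0 : 0 < t) (ht1 : t < 1) (α γ : ℂ)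
    (hγ : γ = (t : ℂ) ^ α) (s : ℕ → ℂ) (hs0 : s 0 ≠ 0)
    (hden : ∀ m ∈ Finset.Icc 1 (4 * n - 2), (γ * s 0) ^ 2 ≠ (t : ℂ) ^ m) :
    pfaffian (Matrix.of fun i j : Fin (2 * n) =>
        pfKernel t γ (s 0) (specialization n t γ (s 0) i) (specialization n t γ (s 0) j))
      = pfaffian (Matrix.of fun i j : Fin (2 * n) =>
          specializedEntry n t γ (s 0) ((i : ℕ) + 1) ((j : ℕ) + 1)) ∧
    pfaffian (Matrix.of fun i j : Fin (2 * n) =>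
        specializedEntry n t γ (s 0) ((i : ℕ) + 1) ((j : ℕ) + 1))
      = (-1) ^ n * γ ^ n * (t : ℂ) ^ (n ^ 2) * vandermondeFactor n t γ (s 0) *
          ∏ j ∈ Finset.Icc 1 n,
            ((1 - s 0 ^ 2 * γ * (t : ℂ) ^ (-2 * (j : ℤ) + 1)) *
              (1 - γ⁻¹ * (t : ℂ) ^ (2 * j - 2))) ∧
    (Admissible t α s (specialization n t γ (s 0)) →
      Summable (partitionTerm t α s (specialization n t γ (s 0))) ∧
      pfaffian (Matrix.of fun i j : Fin (2 * n) =>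
          specializedEntry n t γ (s 0) ((i : ℕ) + 1) ((j : ℕ) + 1))
        = (∏ j ∈ Finset.range (2 * n), (1 - (t : ℂ) ^ j * γ⁻¹)) *
            vandermondeFactor n t γ (s 0) *
            partitionFunction t α s (specialization n t γ (s 0))) := by
  have ht : (t : ℂ) ≠ 0 := by exact_mod_cast ht0.ne'
  have hγ0 : γ ≠ 0 := by
    rw [hγ, Complex.cpow_def_of_ne_zero ht]
    exact Complex.exp_ne_zero _
  have hinj : Function.Injective fun j : ℕ => (t : ℂ) ^ j := by
    intro i j h
    beta_reduce at h
    have h2 : t ^ i = t ^ j := by exact_mod_cast h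
    exact (pow_right_injective₀ ht0 ht1.ne) h2
  have h1 : pfaffian (Matrix.of fun i j : Fin (2 * n) =>
        pfKernel t γ (s 0) (specialization n t γ (s 0) i) (specialization n t γ (s 0) j))
      = pfaffian (Matrix.of fun i j : Fin (2 * n) =>
          specializedEntry n t γ (s 0) ((i : ℕ) + 1) ((j : ℕ) + 1)) := by
    congr 1
    ext i j
    exact pfKernel_specialization_eq n ht hγ0 hs0 hden i j
  have h2 := h1.symm.trans (pfaffian_specialization n ht hγ0 hs0 hinj hden)
  refine ⟨h1, h2, fun hA => ?_⟩
  obtain ⟨h3, h4⟩ := partitionFunction_specialization n ht0 ht1 hγ hs0 hden hA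
  refine ⟨h3, ?_⟩
  rw [h2, mul_right_comm, ← h4, mul_right_comm]
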